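/- **Setting.** Let $n\ge 1$, and let $A_1,\dots,A_n$ (inputs) and $B_1,\dots,B_n$ (outputs) be quantum systems of finite dimensions $d_{A_i},d_{B_j}\ge 1$. Put $d_A=\max_i d_{A_i}$ and $d_B=\max_j d_{B_j}$. For permutations $\sigma,\pi$ of $\{1,\dots,n\}$, $\mathsf{Comb}[(A_{\sigma(1)},B_{\pi(1)}),\dots,(A_{\sigma(n)},B_{\pi(n)})]$ is the set of channels $\bigotimes_i A_i\to\bigotimes_j B_j$ that are a concatenation of $n$ channels connected by finite-dimensional memory systems, the $k$-th of which takes in $A_{\sigma(k)}$ and gives out $B_{\pi(k)}$, with no memory entering the first one or leaving the last one. Let $\mathcal C:\bigotimes_iA_i\to\bigotimes_jB_j$ be a channel without memory: $\mathcal C=\bigotimes_{i=1}^n\mathcal C_i$ with channels $\mathcal C_i:A_i\to B_{\pi''(i)}$ for some unknown permutation $\pi''$. For each $i$ let $\{P^i_\alpha\}_{\alpha=1}^{d_{A_i}^2}$, and for each $j$ let $\{Q^j_\beta\}_{\beta=1}^{d_{B_j}^2}$, be an informationally complete POVM with linearly independent elements on $A_i$, respectively $B_j$. Let $$\lambda_{\min}=\min\Big\{\min_i\lambda_{\min}\big(\textstyle\sum_\alpha|P^i_\alpha\rangle\!\rangle\langle\!\langle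 P^i_\alpha|\big),\ \min_j\lambda_{\min}\big(\textstyle\sum_\beta|Q^j_\beta\rangle\!\rangle\langle\!\langle Q^j_\beta|\big)\Big\},\qquad |X\rangle\!\rangle=\sum_{k,l}X_{kl}|k\rangle|l\rangle ,$$ where $\lambda_{\min}(F)$ of an operator $F$ is its least eigenvalue. For a bipartite operator $\rho$ on $A\otimes B$ put $\chi_1(\rho)=\|\rho-\mathrm{Tr}_B\rho\otimes\mathrm{Tr}_A\rho\|_1$, and let $\|\mathcal C-\mathcal D\|_\diamond=\max_\rho\|(\mathcal C\otimes\mathcal I)(\rho)-(\mathcal D\otimes\mathcal I)(\rho)\|_1$, the maximum being over the states $\rho$ of the input system and an ancilla of the same dimension. **The algorithm**, with black-box access to $\mathcal C$, a number $N$ of queries and a threshold $\chi_-$: 1. Repeat $N$ times, independently: for each $i$ draw $a_i$ independently with $\Pr[a_i=\alpha]=\mathrm{Tr}[P^i_\alpha]/d_{A_i}$; apply $\mathcal C$ once to $\bigotimes_i (P^i_{a_i})^T/\mathrm{Tr}[P^i_{a_i}]$; measure each output $B_j$ with $\{Q^j_\beta\}$, with outcome $b_j$. 2. For each pair $(i,j)$,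 let $\hat p$ be the empirical frequencies of $(a_i,b_j)$ over the $N$ rounds, and let $\hat\rho$ be the operator with $|\hat\rho\rangle\!\rangle=(F^{-1}S^\dagger\otimes G^{-1}R^\dagger)\sum_{\alpha,\beta}\hat p_{\alpha\beta}|\alpha\rangle|\beta\rangle$, where $S=\sum_\alpha|\alpha\rangle\langle\!\langle P^i_\alpha|$, $F=S^\dagger S$, $R=\sum_\beta|\beta\rangle\langle\!\langle Q^j_\beta|$, $G=R^\dagger R$ (and the tensor factors are regrouped as $A_i\otimes A_i\otimes B_j\otimes B_j$). Call the pair independent if $\chi_1(\hat\rho)\le\chi_-$. 3. For $i=1,\dots,n$: let $\pi(i)$ be the first $j$ such that $(i,j)$ is not independent, if there is one, and mark $i$ and $j$ as matched. Then, for $i=1,\dots,n$: if $i$ is unmatched, let $\pi(i)$ be the first unmatched $j$, if there is one, and mark both as matched. Output $\pi$. **Cost model.** One step is an elementary classical operation (exact arithmetic); preparing a state of a $d$-dimensional system takes $O(d)$ steps, measuring a POVM with $m$ outcomes takes $O(m^2)$ steps, drawing one of $m$ labels from a given law takes $O(1+\log m)$ steps, and evaluating the trace norm of an $m\times m$ matrix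 takes $O(m^4)$ steps. The matrices $F^{-1}S^\dagger$ and $G^{-1}R^\dagger$ are computed in advance. Queries are counted separately. **Theorem.** There is a universal constant $K>0$, and, for given constants in the cost model, a constant $K'>0$, such that for all $n$, all dimensions, all POVMs and all $\mathcal C$ as above, and all $\varepsilon>0$ and $0<\kappa<1$, the algorithm, run with $$\chi_-=\frac{\varepsilon}{2nd_A},\qquad N=\Big\lceil K\,n^2d_A^6d_B^4\,\lambda_{\min}^{-2}\,\varepsilon^{-2}\log\frac{n\,d_A\,d_B}{\kappa}\Big\rceil ,$$ has the following properties. * With probability at least $1-\kappa$ its output $\pi$ is a permutation of $\{1,\dots,n\}$ such that $$\exists\,\mathcal D\in\mathsf{Comb}[(A_1,B_{\pi(1)}),\dots,(A_n,B_{\pi(n)})],\qquad\|\mathcal C-\mathcal D\|_\diamond\le\varepsilon .$$ * It always makes exactly $N$ queries to $\mathcal C$, so its query complexity is $O\big(n^2d_A^6d_B^4\lambda_{\min}^{-2}\varepsilon^{-2}\log(nd_Ad_B\kappa^{-1})\big)$ (rounded up). * If $\varepsilon\le2$, its running time is always at most $K'\,N\,n\,(n+d_A+d_B^4)$. -/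

import Mathlib

set_option linter.unusedSectionVars false

open scoped ComplexOrder BigOperators Kronecker

noncomputable section

namespace CausalOrder

/-! Finite-dimensional quantum systems.  A system with a chosen orthonormal basis indexed by `a` has
operator space `Matrix a a ℂ`. -/

section Quantum

variable {a b ι : Type} [Fintype a] [DecidableEq a] [Fintype b] [DecidableEq b] [Fintype ι]

/-- Density operators. -/
structure State (a : Type) [Fintype a] where
  mat : Matrix a a ℂ
  psd : mat.PosSemidef
  trace_eq_one : mat.trace = 1

/-- A POVM with outcomes in `ι`. -/
structure POVM (ι a : Type) [Fintype ι] [Fintype a] [DecidableEq a] where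
  elem : ι → Matrix a a ℂ
  psd : ∀ i, (elem i).PosSemidef
  sum_eq_one : ∑ i, elem i = 1

/-- The map `Φ ⊗ id` on operators of the system together with an ancilla `r`. -/
def ampliate (Φ : Matrix a a ℂ →ₗ[ℂ] Matrix b b ℂ) (r : Type) (X : Matrix (a × r) (a × r) ℂ) :
    Matrix (b × r) (b × r) ℂ :=
  Matrix.of fun p q => Φ (Matrix.of fun s t => X (s, p.2) (t, q.2)) p.1 q.1

/-- Quantum channels: completely positive trace-preserving linear maps. -/
structure Channel (a b : Type) [Fintype a] [Fintype b] where
  toLin : Matrix a a ℂ →ₗ[ℂ] Matrix b b ℂ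
  cp : ∀ (k : ℕ) (X : Matrix (a × Fin k) (a × Fin k) ℂ),
    X.PosSemidef → (ampliate toLin (Fin k) X).PosSemidef
  tp : ∀ X, (toLin X).trace = X.trace

/-- The trace norm `Tr √(X† X)`. -/
def traceNorm (X : Matrix a a ℂ) : ℝ := (cfc Real.sqrt (X.conjTranspose * X)).trace.re

/-- The diamond-norm distance of two channels: the maximum over states `ρ` of the system and an
ancilla of the same dimension of `‖(C ⊗ id) ρ - (D ⊗ id) ρ‖₁`. -/
def diamondDist (C D : Channel a b) : ℝ :=
  ⨆ ρ : State (a × a), traceNorm (ampliate C.toLin a ρ.mat - ampliate D.toLin a ρ.mat)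

/-- `χ₁(ρ) = ‖ρ_{AB} - ρ_A ⊗ ρ_B‖₁` for a bipartite operator. -/
def chi1 (ρ : Matrix (a × b) (a × b) ℂ) : ℝ :=
  traceNorm (ρ - Matrix.kronecker (Matrix.of fun i i' => ∑ j, ρ (i, j) (i', j))
    (Matrix.of fun j j' => ∑ i, ρ (i, j) (i, j')))

theorem Channel.map_psd (C : Channel a b) {X : Matrix a a ℂ} (hX : X.PosSemidef) :
    (C.toLin X).PosSemidef := by
  have h := C.cp 1 (X.submatrix Prod.fst Prod.fst) (hX.submatrix _)
  exact h.submatrix (fun y : b => (y, (0 : Fin 1)))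

/-- The output state of a channel. -/
def Channel.apply (C : Channel a b) (ρ : State a) : State b where
  mat := C.toLin ρ.mat
  psd := C.map_psd ρ.psd
  trace_eq_one := by rw [C.tp, ρ.trace_eq_one]

theorem exists_eq_conjTranspose_mul_self {A : Matrix a a ℂ} (hA : A.PosSemidef) :
    ∃ M : Matrix a a ℂ, A = M.conjTranspose * M := by
  open scoped MatrixOrder Matrix.Norms.L2Operator in
  exact CStarAlgebra.nonneg_iff_eq_star_mul_self.mp hA.nonneg

theorem trace_mul_nonneg {A B : Matrix a a ℂ} (hA : A.PosSemidef) (hB : B.PosSemidef) :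
    0 ≤ (A * B).trace := by
  obtain ⟨M, rfl⟩ := exists_eq_conjTranspose_mul_self hA
  rw [Matrix.mul_assoc, Matrix.trace_mul_comm]
  exact (hB.mul_mul_conjTranspose_same M).trace_nonneg

/-- The distribution with given nonnegative weights that sum to one. -/
def pmfOfWeights (w : ι → ℂ) (h0 : ∀ i, 0 ≤ w i) (h1 : ∑ i, w i = 1) : PMF ι :=
  PMF.ofFintype (fun i => ENNReal.ofReal (w i).re) (by
    rw [← ENNReal.ofReal_sum_of_nonneg fun i _ => (Complex.nonneg_iff.mp (h0 i)).1,
      ← Complex.re_sum, h1, Complex.one_re, ENNReal.ofReal_one])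

/-- Measuring a state with a POVM: outcome `i` has probability `Tr[M_i ρ]`. -/
def measure (M : POVM ι a) (ρ : State a) : PMF ι :=
  pmfOfWeights (fun i => (M.elem i * ρ.mat).trace) (fun i => trace_mul_nonneg (M.psd i) ρ.psd) (by
    rw [← Matrix.trace_sum, ← Finset.sum_mul, M.sum_eq_one, one_mul, ρ.trace_eq_one])

end Quantum

/-! Composite systems: wires `i : Fin n` of dimension `d i`; the joint system has the product basis
`∀ i, Fin (d i)`. -/

section Composite

variable {n : ℕ}

/-- The tensor product `⨂ X_i` of operators on the wires. -/
def tensorOp {d : Fin n → ℕ} (X : ∀ i, Matrix (Fin (d i)) (Fin (d i)) ℂ) :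
    Matrix (∀ i, Fin (d i)) (∀ i, Fin (d i)) ℂ :=
  Matrix.of fun x x' => ∏ i, X i (x i) (x' i)

theorem tensorOp_psd {d : Fin n → ℕ} {X : ∀ i, Matrix (Fin (d i)) (Fin (d i)) ℂ}
    (hX : ∀ i, (X i).PosSemidef) : (tensorOp X).PosSemidef := by
  choose M hM using fun i => exists_eq_conjTranspose_mul_self (hX i)
  have h : tensorOp X = (tensorOp M).conjTranspose * tensorOp M := by
    ext x y
    simp only [tensorOp, Matrix.of_apply, Matrix.mul_apply, Matrix.conjTranspose_apply, hM,
      star_prod, ← Finset.prod_mul_distrib]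
    rw [Finset.prod_univ_sum, Fintype.piFinset_univ]
  rw [h]
  exact Matrix.posSemidef_conjTranspose_mul_self _

theorem tensorOp_trace {d : Fin n → ℕ} (X : ∀ i, Matrix (Fin (d i)) (Fin (d i)) ℂ) :
    (tensorOp X).trace = ∏ i, (X i).trace := by
  simp only [Matrix.trace, Matrix.diag_apply, tensorOp, Matrix.of_apply]
  rw [Finset.prod_univ_sum, Fintype.piFinset_univ]

/-- Product state. -/
def tensorState {d : Fin n → ℕ} (ρ : ∀ i, State (Fin (d i))) : State (∀ i, Fin (d i)) where
  mat := tensorOp fun i => (ρ i).mat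
  psd := tensorOp_psd fun i => (ρ i).psd
  trace_eq_one := by
    rw [tensorOp_trace]; exact Finset.prod_eq_one fun i _ => (ρ i).trace_eq_one

/-- Measuring every wire `j` separately with `M j`. -/
def tensorPOVM {d m : Fin n → ℕ} (M : ∀ j, POVM (Fin (m j)) (Fin (d j))) :
    POVM (∀ j, Fin (m j)) (∀ j, Fin (d j)) where
  elem := fun o => tensorOp fun j => (M j).elem (o j)
  psd := fun o => tensorOp_psd fun j => (M j).psd (o j)
  sum_eq_one := by
    ext x y
    rw [Matrix.sum_apply]
    simp only [tensorOp, Matrix.of_apply]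
    have h := Finset.prod_univ_sum (fun j => (Finset.univ : Finset (Fin (m j))))
      (fun j o => (M j).elem o (x j) (y j))
    rw [Fintype.piFinset_univ] at h
    rw [← h]
    simp only [← Matrix.sum_apply, POVM.sum_eq_one, Matrix.one_apply]
    rw [Finset.prod_ite_zero]
    simp [funext_iff]

/-- The law of independent draws. -/
def independentDraws {m : Fin n → ℕ} (p : ∀ i, PMF (Fin (m i))) : PMF (∀ i, Fin (m i)) :=
  PMF.ofFintype (fun o => ∏ i, p i (o i)) (by
    rw [← Fintype.piFinset_univ, ← Finset.prod_univ_sum]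
    refine Finset.prod_eq_one fun i _ => ?_
    simpa only [tsum_fintype] using (p i).tsum_coe)

variable {dA dB : Fin n → ℕ}

/-- The operator on the memory after the first `k` teeth of a concatenation of teeth `T k`, when
the joint input is the matrix unit `|x⟩⟨x'|` and the matrix entry `(y, y')` of the joint output is
read off.  Tooth `k` acts on the wire `A_{σ k}` and the memory `M_k`, and produces the wire
`B_{π k}` and the memory `M_{k+1}`. -/
def combMemory (σ π : Equiv.Perm (Fin n)) (m : Fin (n + 1) → ℕ)
    (T : ∀ k : Fin n, Channel (Fin (dA (σ k)) × Fin (m k.castSucc))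
      (Fin (dB (π k)) × Fin (m k.succ)))
    (x x' : ∀ i, Fin (dA i)) (y y' : ∀ j, Fin (dB j)) :
    (k : Fin (n + 1)) → Matrix (Fin (m k)) (Fin (m k)) ℂ :=
  Fin.induction 1 fun k W => Matrix.of fun s t =>
    (T k).toLin (Matrix.kronecker (Matrix.single (x (σ k)) (x' (σ k)) 1) W)
      (y (π k), s) (y' (π k), t)

/-- `Comb[(A_{σ 1}, B_{π 1}), …, (A_{σ n}, B_{π n})]`: the channels that are a concatenation of `n`
channels (teeth) connected by memory systems, where the `k`-th tooth has input `A_{σ k}` and output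
`B_{π k}`, and no memory enters the first tooth or leaves the last one. -/
def IsComb (σ π : Equiv.Perm (Fin n)) (C : Channel (∀ i, Fin (dA i)) (∀ j, Fin (dB j))) : Prop :=
  ∃ (m : Fin (n + 1) → ℕ)
    (T : ∀ k : Fin n, Channel (Fin (dA (σ k)) × Fin (m k.castSucc))
      (Fin (dB (π k)) × Fin (m k.succ))),
    m 0 = 1 ∧ m (Fin.last n) = 1 ∧
      ∀ x x' y y', C.toLin (Matrix.single x x' 1) y y' =
        (combMemory σ π m T x x' y y' (Fin.last n)).trace

/-- No memory: `C` is a tensor product of channels from `A_i` to `B_{τ i}` for some permutation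
`τ`. -/
def IsMemoryless (C : Channel (∀ i, Fin (dA i)) (∀ j, Fin (dB j))) : Prop :=
  ∃ (τ : Equiv.Perm (Fin n)) (Ch : ∀ i, Channel (Fin (dA i)) (Fin (dB (τ i)))),
    ∀ (X : ∀ i, Matrix (Fin (dA i)) (Fin (dA i)) ℂ) (y y' : ∀ j, Fin (dB j)),
      C.toLin (tensorOp X) y y' = ∏ i, (Ch i).toLin (X i) (y (τ i)) (y' (τ i))

end Composite

/-! Informationally complete POVMs. -/

section Informational

/-- An informationally complete POVM with `d²` linearly independent elements. -/
structure ICPOVM (d : ℕ) extends POVM (Fin (d ^ 2)) (Fin d) where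
  span_eq_top : Submodule.span ℂ (Set.range elem) = ⊤
  linearIndependent : LinearIndependent ℂ elem

namespace ICPOVM

variable {d : ℕ} (P : ICPOVM d)

/-- `S = ∑ |α⟩⟨⟨P_α|`, where `|X⟩⟩ = ∑ X_{ij} |i⟩|j⟩`. -/
def analysis : Matrix (Fin (d ^ 2)) (Fin d × Fin d) ℂ :=
  Matrix.of fun α ij => star (P.elem α ij.1 ij.2)

/-- The frame operator `F = ∑ |P_α⟩⟩⟨⟨P_α|`. -/
def frame : Matrix (Fin d × Fin d) (Fin d × Fin d) ℂ :=
  ∑ α, Matrix.vecMulVec (fun ij => P.elem α ij.1 ij.2) (fun ij => star (P.elem α ij.1 ij.2))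

theorem frame_isHermitian : P.frame.IsHermitian := by
  ext x y
  simp [frame, Matrix.sum_apply, Matrix.vecMulVec_apply, Matrix.conjTranspose_apply, mul_comm]

/-- The minimum eigenvalue of the frame operator. -/
def minEigenvalue : ℝ := ⨅ k, P.frame_isHermitian.eigenvalues k

/-- The reconstruction matrix `F⁻¹ S†`. -/
def reconstruction : Matrix (Fin d × Fin d) (Fin (d ^ 2)) ℂ :=
  P.frame⁻¹ * P.analysis.conjTranspose

theorem trace_ne_zero (α : Fin (d ^ 2)) : (P.elem α).trace ≠ 0 := fun h =>
  P.linearIndependent.ne_zero α ((P.psd α).trace_eq_zero_iff.mp h)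

/-- The input state `ψ_α = P_αᵀ / Tr[P_α]`. -/
def inputState (α : Fin (d ^ 2)) : State (Fin d) where
  mat := (P.elem α).trace⁻¹ • (P.elem α).transpose
  psd := (P.psd α).transpose.smul (inv_nonneg_of_nonneg (P.psd α).trace_nonneg)
  trace_eq_one := by
    rw [Matrix.trace_smul, Matrix.trace_transpose, smul_eq_mul, inv_mul_cancel₀ (P.trace_ne_zero α)]

/-- The law of the label `α`: probability `Tr[P_α] / d`. -/
def labelLaw [NeZero d] : PMF (Fin (d ^ 2)) :=
  pmfOfWeights (fun α => (P.elem α).trace / (d : ℂ))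
    (fun α => div_nonneg (P.psd α).trace_nonneg (Nat.cast_nonneg d)) (by
      rw [← Finset.sum_div, ← Matrix.trace_sum, P.sum_eq_one, Matrix.trace_one, Fintype.card_fin,
        div_self (Nat.cast_ne_zero.mpr (NeZero.ne d))])

end ICPOVM

end Informational

/-! Deterministic classical computations with a step count: a random access machine with exact
arithmetic, one step for each elementary operation. -/

/-- The result of a computation together with the number of steps. -/
structure Timed (α : Type) where
  val : α
  time : ℕ

namespace Timed

variable {α ι s : Type}

instance : Monad Timed where
  pure a := ⟨a, 0⟩
  bind x f := ⟨(f x.val).val, x.time + (f x.val).time⟩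

/-- A group of boundedly many elementary operations, counted as one step. -/
def op (a : α) : Timed α := ⟨a, 1⟩

/-- Compute all entries of an array, one after the other. -/
def table [Fintype ι] (f : ι → Timed α) : Timed (ι → α) :=
  ⟨fun i => (f i).val, ∑ i, ((f i).time + 1)⟩

/-- Compute all terms and add them up. -/
def sum [Fintype ι] (f : ι → Timed ℂ) : Timed ℂ :=
  ⟨∑ i, (f i).val, ∑ i, ((f i).time + 1)⟩

/-- A `for` loop over a list with loop state in `s`. -/
def forLoop (f : s → ι → Timed s) : s → List ι → Timed s
  | x, [] => pure x
  | x, i :: l => do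
    let i ← op i
    let y ← f x i
    forLoop f y l

/-- A `for` loop that breaks at the first element that passes the test. -/
def findFirst (p : ι → Bool) : List ι → Timed (Option ι)
  | [] => pure none
  | i :: l => do
    let b ← op (p i)
    if b then pure (some i) else findFirst p l

end Timed

/-- Numbers of steps charged for the operations that are not elementary: preparing a given state of
a `d`-dimensional system, measuring a given POVM with `m` outcomes, drawing a label from a given law
on `m` labels, and evaluating the trace norm of an `m × m` matrix. -/
structure CostModel where
  prepare : ℕ → ℕ
  povm : ℕ → ℕ
  draw : ℕ → ℕ
  traceNorm : ℕ → ℕ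

/-- The orders of magnitude `O(d)`, `O(m²)`, `O(log m)` and `O(m⁴)` of these costs. -/
structure CostModel.BoundedBy (cost : CostModel) (c : ℕ) : Prop where
  prepare_le : ∀ d, cost.prepare d ≤ c * d
  povm_le : ∀ m, cost.povm m ≤ c * m ^ 2
  draw_le : ∀ m, cost.draw m ≤ c * (Nat.log 2 m + 1)
  traceNorm_le : ∀ m, cost.traceNorm m ≤ c * m ^ 4

/-! Randomized procedures with black-box access to a channel. -/

/-- Resources used by a run: uses of the black box, and elementary steps. -/
structure Resources where
  queries : ℕ
  steps : ℕ

/-- A randomized procedure: the joint law of its output and of the resources used. -/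
def Proc (α : Type) : Type := PMF (α × Resources)

namespace Proc

variable {α : Type}

/-- The joint law of output and resources. -/
def law (p : Proc α) : PMF (α × Resources) := p

instance : Monad Proc where
  pure a := PMF.pure (a, ⟨0, 0⟩)
  bind x f := PMF.bind x fun r => PMF.map
    (fun r' => (r'.1, ⟨r.2.queries + r'.2.queries, r.2.steps + r'.2.steps⟩)) (f r.1)

/-- Draw from `p` at the given cost. -/
def draw (p : PMF α) (steps : ℕ) : Proc α := PMF.map (fun a => (a, ⟨0, steps⟩)) p

/-- Run a deterministic computation. -/
def compute (t : Timed α) : Proc α := PMF.pure (t.val, ⟨0, t.time⟩)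

/-- One use of the black box: apply `C` to a product of single-wire states and measure each output
wire. -/
def query {n : ℕ} {dA dB m : Fin n → ℕ} (cost : CostModel)
    (C : Channel (∀ i, Fin (dA i)) (∀ j, Fin (dB j)))
    (ρ : ∀ i, State (Fin (dA i))) (M : ∀ j, POVM (Fin (m j)) (Fin (dB j))) :
    Proc (∀ j, Fin (m j)) :=
  PMF.map (fun b => (b, ⟨1, ∑ i, cost.prepare (dA i) + ∑ j, cost.povm (m j)⟩))
    (measure (tensorPOVM M) (C.apply (tensorState ρ)))

end Proc

/-! The algorithm. -/

section Algorithm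

/-- The estimate of `χ₁(ρ_{AB})` from outcomes of the POVM `{P_α ⊗ Q_β}`: tabulate the empirical
frequencies `p`, compute the operator `ρ` with `|ρ⟩⟩ = (F⁻¹ S† ⊗ G⁻¹ R†) |p⟩`, and return `χ₁(ρ)`.
The matrices `F⁻¹ S†` and `G⁻¹ R†` depend only on the POVMs and are tabulated in advance. -/
def estimateChi1 (cost : CostModel) {d e : ℕ} (P : ICPOVM d) (Q : ICPOVM e)
    (data : List (Fin (d ^ 2) × Fin (e ^ 2))) : Timed ℝ := do
  let zero ← Timed.table fun _ : Fin (d ^ 2) × Fin (e ^ 2) => Timed.op (0 : ℝ)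
  let p ← Timed.forLoop (fun p ab => Timed.op (Function.update p ab (p ab + 1 / (data.length : ℝ))))
    zero data
  let r ← Timed.table fun uv : (Fin d × Fin d) × (Fin e × Fin e) =>
    Timed.sum fun ab : Fin (d ^ 2) × Fin (e ^ 2) =>
      Timed.op (P.reconstruction uv.1 ab.1 * Q.reconstruction uv.2 ab.2 * (p ab : ℂ))
  let rA ← Timed.table fun ii : Fin d × Fin d =>
    Timed.sum fun j => Timed.op (r (ii, (j, j)))
  let rB ← Timed.table fun jj : Fin e × Fin e =>
    Timed.sum fun i => Timed.op (r ((i, i), jj))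
  let t ← Timed.table fun uv : (Fin d × Fin d) × (Fin e × Fin e) =>
    Timed.op (r uv - rA uv.1 * rB uv.2)
  let X : Matrix (Fin d × Fin e) (Fin d × Fin e) ℂ :=
    Matrix.of fun x x' => t ((x.1, x'.1), (x.2, x'.2))
  ⟨traceNorm X, cost.traceNorm (d * e)⟩

/-- The estimate is `χ₁` of the reconstructed operator. -/
theorem estimateChi1_val (cost : CostModel) {d e : ℕ} (P : ICPOVM d) (Q : ICPOVM e)
    (data : List (Fin (d ^ 2) × Fin (e ^ 2))) :
    (estimateChi1 cost P Q data).val =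
      chi1 (Matrix.of fun x x' : Fin d × Fin e => ∑ ab : Fin (d ^ 2) × Fin (e ^ 2),
        P.reconstruction (x.1, x'.1) ab.1 * Q.reconstruction (x.2, x'.2) ab.2 *
          ((Timed.forLoop (fun p ab => Timed.op
            (Function.update p ab (p ab + 1 / (data.length : ℝ)))) (fun _ => 0) data).val ab : ℂ)) :=
  rfl

variable {n : ℕ} {dA dB : Fin n → ℕ}

/-- Labels of the input states and measurement outcomes of one round. -/
abbrev Round (dA dB : Fin n → ℕ) : Type := (∀ i, Fin (dA i ^ 2)) × (∀ j, Fin (dB j ^ 2))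

/-- One round: draw the labels independently, apply the channel to the corresponding product state,
and measure every output wire. -/
def playRound [∀ i, NeZero (dA i)] (cost : CostModel)
    (C : Channel (∀ i, Fin (dA i)) (∀ j, Fin (dB j)))
    (P : ∀ i, ICPOVM (dA i)) (Q : ∀ j, ICPOVM (dB j)) : Proc (Round dA dB) := do
  let a ← Proc.draw (independentDraws fun i => (P i).labelLaw) (∑ i, cost.draw (dA i ^ 2))
  let b ← Proc.query cost C (fun i => (P i).inputState (a i)) (fun j => (Q j).toPOVM)
  pure (a, b)

/-- `N` independent rounds. -/
def collect [∀ i, NeZero (dA i)] (cost : CostModel)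
    (C : Channel (∀ i, Fin (dA i)) (∀ j, Fin (dB j)))
    (P : ∀ i, ICPOVM (dA i)) (Q : ∀ j, ICPOVM (dB j)) : ℕ → Proc (List (Round dA dB))
  | 0 => pure []
  | N + 1 => do
    let r ← playRound cost C P Q
    let l ← collect cost C P Q N
    pure (r :: l)

/-- The independence test: entry `(i, j)` is `true` iff the estimate of `χ₁` for the pair
`(A_i, B_j)` is at most the threshold. -/
def independenceTable (cost : CostModel) (P : ∀ i, ICPOVM (dA i)) (Q : ∀ j, ICPOVM (dB j))
    (threshold : ℝ) (data : List (Round dA dB)) : Timed (Fin n × Fin n → Bool) :=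
  Timed.table fun ij => do
    let x ← estimateChi1 cost (P ij.1) (Q ij.2) (data.map fun r => (r.1 ij.1, r.2 ij.2))
    Timed.op (decide (x ≤ threshold))

/-- State of the matching loops: the partial assignment and the arrays of matched inputs and
outputs. -/
structure MatchState (n : ℕ) where
  assign : Fin n → Option (Fin n)
  matchedA : Fin n → Bool
  matchedB : Fin n → Bool

/-- Record that input `i` is assigned output `j`. -/
def MatchState.record (s : MatchState n) (i j : Fin n) : MatchState n where
  assign := Function.update s.assign i (some j)
  matchedA := Function.update s.matchedA i true
  matchedB := Function.update s.matchedB j true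

/-- First loop: each input is assigned the first output for which the independence test fails. -/
def matchCorrelated (ind : Fin n × Fin n → Bool) (s : MatchState n) (i : Fin n) :
    Timed (MatchState n) := do
  let r ← Timed.findFirst (fun j => !ind (i, j)) (List.finRange n)
  match r with
  | some j => Timed.op (s.record i j)
  | none => pure s

/-- Second loop: each unmatched input is assigned the first unmatched output. -/
def matchRest (s : MatchState n) (i : Fin n) : Timed (MatchState n) := do
  let done ← Timed.op (s.matchedA i)
  if done then pure s else do
    let r ← Timed.findFirst (fun j => !s.matchedB j) (List.finRange n)
    match r with
    | some j => Timed.op (s.record i j)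
    | none => pure s

/-- The matching computed from the table of independence tests; `none` marks an input that has
received no output. -/
def matching (ind : Fin n × Fin n → Bool) : Timed (Fin n → Option (Fin n)) := do
  let a ← Timed.table fun _ : Fin n => Timed.op (none : Option (Fin n))
  let mA ← Timed.table fun _ : Fin n => Timed.op false
  let mB ← Timed.table fun _ : Fin n => Timed.op false
  let s ← Timed.forLoop (matchCorrelated ind) ⟨a, mA, mB⟩ (List.finRange n)
  let s ← Timed.forLoop matchRest s (List.finRange n)
  pure s.assign

/-- The whole algorithm with `N` queries and the given threshold. -/
def discoverOrder [∀ i, NeZero (dA i)] (cost : CostModel)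
    (C : Channel (∀ i, Fin (dA i)) (∀ j, Fin (dB j)))
    (P : ∀ i, ICPOVM (dA i)) (Q : ∀ j, ICPOVM (dB j)) (N : ℕ) (threshold : ℝ) :
    Proc (Fin n → Option (Fin n)) := do
  let data ← collect cost C P Q N
  Proc.compute do
    let ind ← independenceTable cost P Q threshold data
    matching ind

/-- The output is a permutation `π` such that `C` is `ε`-close in diamond norm to a comb with order
`(A_1, B_{π 1}), …, (A_n, B_{π n})`. -/
def IsGoodOutput (C : Channel (∀ i, Fin (dA i)) (∀ j, Fin (dB j))) (ε : ℝ)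
    (out : Fin n → Option (Fin n)) : Prop :=
  ∃ π : Equiv.Perm (Fin n), (∀ i, out i = some (π i)) ∧
    ∃ D : Channel (∀ i, Fin (dA i)) (∀ j, Fin (dB j)), IsComb 1 π D ∧ diamondDist C D ≤ ε

/-- The largest dimension of a wire. -/
def maxDim (d : Fin n → ℕ) : ℕ := Finset.univ.sup d

/-- `λ_min`: the least minimum eigenvalue of the frame operators. -/
def lambdaMin (P : ∀ i, ICPOVM (dA i)) (Q : ∀ j, ICPOVM (dB j)) : ℝ :=
  min (⨅ i, (P i).minEigenvalue) (⨅ j, (Q j).minEigenvalue)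

/-- The expression `n² d_A⁶ d_B⁴ λ_min⁻² ε⁻² log(n d_A d_B κ⁻¹)`. -/
def queryScale (P : ∀ i, ICPOVM (dA i)) (Q : ∀ j, ICPOVM (dB j)) (ε κ : ℝ) : ℝ :=
  (n : ℝ) ^ 2 * (maxDim dA : ℝ) ^ 6 * (maxDim dB : ℝ) ^ 4 / (lambdaMin P Q ^ 2 * ε ^ 2) *
    Real.log ((n : ℝ) * maxDim dA * maxDim dB / κ)

end Algorithm

end CausalOrder

end

open CausalOrder

noncomputable section

namespace CausalOrder

/-! ### Trace norm of finite matrices -/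

section TraceNorm

variable {a b : Type} [Fintype a] [DecidableEq a] [Fintype b] [DecidableEq b]

/-! Write `τ` for the unknown permutation, so that the channel is a product of channels `Ch i` from
input `i` to output `τ i`. The law of one round is then a product over `i` of the laws of the pairs
(label at `i`, outcome at `τ i`); this is `toReal_roundLaw`. Off the graph of `τ`, label and outcome
are therefore independent and their covariance vanishes. On the graph, `choiOf_sub_kronecker`
identifies `d` times the operator reconstructed from the covariances, `d` being the dimension of
input `i`, with the Choi matrix of `Ch i` minus that of the channel that discards its input and
prepares `Ch i (1/d)`. So the test on `(i, τ i)` measures how far `Ch i` is from ignoring its input.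

The estimate is controlled through `chi1_reconstruct`. The dual operators have trace one, so partial
traces of a reconstruction are reconstructions of marginals, and `χ₁` becomes the trace norm of a
linear function of the covariance array. The frame bound and Cauchy–Schwarz
(`traceNorm_reconstruct_le`) turn an entrywise error into a trace-norm error. A Chernoff estimate
for empirical frequencies (`iidList_freq_le`) and a union bound make all relevant frequencies
accurate at once with probability at least `1 - κ`.

The rest is deterministic. If every pair off the graph passes the test, only edges of `τ` can fail
it, and the greedy matching extends the failing edges to a permutation `π` that agrees with `τ` on
them (`matching_spec`). Where `π` and `τ` differ the test passed, so `Ch i` is within `ε / n` of a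
constant channel. Replacing those factors by constant channels costs at most `ε` in diamond norm, by
a hybrid argument (`diamondDist_prodChoi_le`). A constant output can be attached to any input, so
the new channel is also a product along `π`, hence a comb with trivial memories
(`exists_isComb_diamondDist_le`).

For the running time, `N` already dominates the fourth power of `d_A d_B`, which is the order of the
cost of one reconstruction with its trace norm (`pow_dims_le`). -/

theorem trace_cfc {X : Matrix a a ℂ} (hX : X.IsHermitian) (f : ℝ → ℝ) :
    (cfc f X).trace = ∑ k, (f (hX.eigenvalues k) : ℂ) := by
  rw [hX.cfc_eq, Matrix.IsHermitian.cfc, Unitary.conjStarAlgAut_apply, Matrix.trace_mul_comm,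
    ← mul_assoc]
  simp [Matrix.trace]

theorem traceNorm_eq_sum_sqrt (X : Matrix a a ℂ) :
    traceNorm X =
      ∑ k, √((Matrix.isHermitian_conjTranspose_mul_self X).eigenvalues k) := by
  rw [traceNorm, trace_cfc (Matrix.isHermitian_conjTranspose_mul_self X)]
  simp

theorem traceNorm_nonneg (X : Matrix a a ℂ) : 0 ≤ traceNorm X := by
  rw [traceNorm_eq_sum_sqrt]
  exact Finset.sum_nonneg fun _ _ => Real.sqrt_nonneg _

/-- The trace norm is at most `√dim` times the Frobenius norm. -/
theorem traceNorm_le_sqrt_card_mul (X : Matrix a a ℂ) :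
    traceNorm X ≤ √(Fintype.card a) * √(∑ i, ∑ j, ‖X i j‖ ^ 2) := by
  have hH := Matrix.isHermitian_conjTranspose_mul_self X
  have hpos := (Matrix.posSemidef_conjTranspose_mul_self X).eigenvalues_nonneg
  have hsum : ∑ k, hH.eigenvalues k = ∑ i, ∑ j, ‖X i j‖ ^ 2 := by
    have h := hH.trace_eq_sum_eigenvalues
    have h2 : (X.conjTranspose * X).trace = ((∑ i, ∑ j, ‖X i j‖ ^ 2 : ℝ) : ℂ) := by
      rw [Finset.sum_comm, Matrix.trace]
      push_cast
      refine Finset.sum_congr rfl fun j _ => ?_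
      rw [Matrix.diag_apply, Matrix.mul_apply]
      refine Finset.sum_congr rfl fun i _ => ?_
      rw [Matrix.conjTranspose_apply]
      exact Complex.conj_mul' _
    rw [h2] at h
    simp only [Complex.coe_algebraMap] at h
    exact_mod_cast h.symm
  rw [traceNorm_eq_sum_sqrt, ← hsum]
  have h := Finset.sum_mul_sq_le_sq_mul_sq Finset.univ (fun _ : a => (1 : ℝ))
    (fun k => √(hH.eigenvalues k))
  rw [← Real.sqrt_mul (by positivity)]
  refine Real.le_sqrt_of_sq_le ?_
  simpa [Real.sq_sqrt (hpos _)] using h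

/-- For Hermitian `X` the square root is taken of `X ^ 2`, and `√(x ^ 2) = |x|` on the spectrum. -/
theorem traceNorm_eq_sum_abs {X : Matrix a a ℂ} (hX : X.IsHermitian) :
    traceNorm X = ∑ k, |hX.eigenvalues k| := by
  have h : cfc Real.sqrt (X.conjTranspose * X) = cfc (fun x : ℝ => |x|) X := by
    have h1 : X.conjTranspose * X = cfc (fun x : ℝ => x ^ 2) X := by
      rw [cfc_pow_id (R := ℝ) X 2 hX.isSelfAdjoint, hX.eq, sq]
    rw [h1, ← cfc_comp' Real.sqrt (fun x : ℝ => x ^ 2) X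
      (by fun_prop) (by fun_prop) hX.isSelfAdjoint]
    simp only [Real.sqrt_sq_eq_abs]
  rw [traceNorm, h, trace_cfc hX]
  simp

/-- Jordan decomposition. -/
theorem exists_posSemidef_sub {X : Matrix a a ℂ} (hX : X.IsHermitian) :
    ∃ P Q : Matrix a a ℂ, P.PosSemidef ∧ Q.PosSemidef ∧ X = P - Q ∧
      P.trace.re + Q.trace.re = traceNorm X := by
  open scoped MatrixOrder in
  refine ⟨cfc (fun x : ℝ => max x 0) X, cfc (fun x : ℝ => max (-x) 0) X,
    Matrix.nonneg_iff_posSemidef.mp (cfc_nonneg fun x _ => le_max_right _ _),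
    Matrix.nonneg_iff_posSemidef.mp (cfc_nonneg fun x _ => le_max_right _ _), ?_, ?_⟩
  · rw [← cfc_sub _ _ X (by fun_prop) (by fun_prop)]
    conv_lhs => rw [← cfc_id' ℝ X hX.isSelfAdjoint]
    refine cfc_congr fun x _ => ?_
    rcases le_total x 0 with h | h <;> simp [h]
  · rw [traceNorm_eq_sum_abs hX, trace_cfc hX, trace_cfc hX, Complex.re_sum, Complex.re_sum,
      ← Finset.sum_add_distrib]
    refine Finset.sum_congr rfl fun k _ => ?_
    rw [Complex.ofReal_re, Complex.ofReal_re]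
    rcases le_total (hX.eigenvalues k) 0 with h | h <;> simp [h, abs_of_nonneg, abs_of_nonpos]

/-- In an eigenbasis of `P - Q` each eigenvalue is a difference of diagonal entries of `P` and `Q`,
which are nonnegative. Its absolute value is at most their sum, and summing the diagonals gives the
traces. -/
theorem traceNorm_sub_le {P Q : Matrix a a ℂ} (hP : P.PosSemidef) (hQ : Q.PosSemidef) :
    traceNorm (P - Q) ≤ P.trace.re + Q.trace.re := by
  have hX : (P - Q).IsHermitian := hP.1.sub hQ.1
  rw [traceNorm_eq_sum_abs hX]
  let U : Matrix a a ℂ := hX.eigenvectorUnitary.1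
  have hU : U = hX.eigenvectorUnitary.1 := rfl
  have hUU : U * U.conjTranspose = 1 := by
    rw [hU, ← Matrix.star_eq_conjTranspose]; simp
  have hd : U.conjTranspose * (P - Q) * U =
      Matrix.diagonal (fun k => ((hX.eigenvalues k : ℝ) : ℂ)) := by
    have h := hX.conjStarAlgAut_star_eigenvectorUnitary
    rw [Unitary.conjStarAlgAut_apply] at h
    simpa [hU, Matrix.star_eq_conjTranspose, Function.comp_def] using h
  have hP' := hP.conjTranspose_mul_mul_same U
  have hQ' := hQ.conjTranspose_mul_mul_same U
  have tr : ∀ Y : Matrix a a ℂ, (U.conjTranspose * Y * U).trace = Y.trace := fun Y => by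
    rw [Matrix.trace_mul_comm, ← mul_assoc, hUU, one_mul]
  rw [← tr P, ← tr Q, Matrix.trace, Matrix.trace, Complex.re_sum, Complex.re_sum,
    ← Finset.sum_add_distrib]
  refine Finset.sum_le_sum fun k _ => ?_
  have hk := congrFun (congrFun hd k) k
  rw [Matrix.mul_sub, Matrix.sub_mul, Matrix.sub_apply, Matrix.diagonal_apply_eq] at hk
  have hk' := congrArg Complex.re hk
  rw [Complex.ofReal_re, Complex.sub_re] at hk'
  have p1 := (Complex.nonneg_iff.mp (hP'.diag_nonneg (i := k))).1
  have q1 := (Complex.nonneg_iff.mp (hQ'.diag_nonneg (i := k))).1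
  rw [← hk']
  simp only [Matrix.diag_apply]
  rw [abs_le]
  constructor <;> linarith

theorem traceNorm_add_le {X Y : Matrix a a ℂ} (hX : X.IsHermitian) (hY : Y.IsHermitian) :
    traceNorm (X + Y) ≤ traceNorm X + traceNorm Y := by
  obtain ⟨P, Q, hP, hQ, rfl, h⟩ := exists_posSemidef_sub hX
  obtain ⟨P', Q', hP', hQ', rfl, h'⟩ := exists_posSemidef_sub hY
  have := traceNorm_sub_le (hP.add hP') (hQ.add hQ')
  rw [Matrix.trace_add, Matrix.trace_add, Complex.add_re, Complex.add_re] at this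
  rw [show P - Q + (P' - Q') = P + P' - (Q + Q') by abel]
  linarith

theorem traceNorm_zero : traceNorm (0 : Matrix a a ℂ) = 0 :=
  le_antisymm (by
    have h := traceNorm_sub_le (P := (0 : Matrix a a ℂ)) (Q := 0) Matrix.PosSemidef.zero
      Matrix.PosSemidef.zero
    simpa using h) (traceNorm_nonneg _)

theorem traceNorm_smul {X : Matrix a a ℂ} (hX : X.IsHermitian) {c : ℝ} (hc : 0 ≤ c) :
    traceNorm ((c : ℂ) • X) ≤ c * traceNorm X := by
  obtain ⟨P, Q, hP, hQ, rfl, h⟩ := exists_posSemidef_sub hX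
  have hc' : (0 : ℂ) ≤ c := by exact_mod_cast hc
  have := traceNorm_sub_le (hP.smul hc') (hQ.smul hc')
  rw [smul_sub]
  refine this.trans ?_
  rw [← h]
  simp [Matrix.trace_smul]
  linarith

end TraceNorm

/-! ### Choi matrices and channels -/

section Choi

variable {a b r : Type} [Fintype a] [DecidableEq a] [Fintype b] [DecidableEq b] [Fintype r]
  [DecidableEq r]

/-- The Choi matrix of a linear map. -/
def choiOf (L : Matrix a a ℂ →ₗ[ℂ] Matrix b b ℂ) : Matrix (a × b) (a × b) ℂ :=
  Matrix.of fun p q => L (Matrix.single p.1 q.1 1) p.2 q.2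

/-- The linear map with a given Choi matrix. -/
def choiMap (J : Matrix (a × b) (a × b) ℂ) : Matrix a a ℂ →ₗ[ℂ] Matrix b b ℂ where
  toFun X := Matrix.of fun y y' => ∑ x, ∑ x', X x x' * J (x, y) (x', y')
  map_add' X Y := by
    ext y y'
    simp [add_mul, Finset.sum_add_distrib]
  map_smul' c X := by
    ext y y'
    simp [mul_assoc, Finset.mul_sum]

theorem choiMap_apply (J : Matrix (a × b) (a × b) ℂ) (X : Matrix a a ℂ) (y y' : b) :
    choiMap J X y y' = ∑ x, ∑ x', X x x' * J (x, y) (x', y') := rfl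

theorem map_apply_eq_sum_single (L : Matrix a a ℂ →ₗ[ℂ] Matrix b b ℂ) (X : Matrix a a ℂ)
    (y y' : b) : L X y y' = ∑ x, ∑ x', X x x' * L (Matrix.single x x' 1) y y' := by
  conv_lhs => rw [Matrix.matrix_eq_sum_single X]
  simp only [map_sum, Matrix.sum_apply]
  refine Finset.sum_congr rfl fun x _ => Finset.sum_congr rfl fun x' _ => ?_
  have h : Matrix.single x x' (X x x') = X x x' • Matrix.single x x' (1 : ℂ) := by
    rw [Matrix.smul_single, smul_eq_mul, mul_one]
  rw [h, map_smul, Matrix.smul_apply, smul_eq_mul]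

theorem choiMap_choiOf (L : Matrix a a ℂ →ₗ[ℂ] Matrix b b ℂ) : choiMap (choiOf L) = L := by
  refine LinearMap.ext fun X => ?_
  ext y y'
  rw [choiMap_apply, map_apply_eq_sum_single]
  rfl

theorem choiMap_single (J : Matrix (a × b) (a × b) ℂ) (x x' : a) (y y' : b) :
    choiMap J (Matrix.single x x' 1) y y' = J (x, y) (x', y') := by
  rw [choiMap_apply, Finset.sum_eq_single x, Finset.sum_eq_single x']
  · simp
  · intro z _ hz
    simp [hz.symm]
  · simp
  · intro z _ hz
    simp [hz.symm]
  · simp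

theorem choiOf_choiMap (J : Matrix (a × b) (a × b) ℂ) : choiOf (choiMap J) = J := by
  ext p q
  exact choiMap_single J p.1 q.1 p.2 q.2

theorem choiOf_psd (C : Channel a b) : (choiOf C.toLin).PosSemidef := by
  let e := Fintype.equivFin a
  -- The unnormalised maximally entangled vector, with the ancilla labelled by `Fin (card a)` as
  -- `Channel.cp` requires.
  let v : a × Fin (Fintype.card a) → ℂ := fun p => if e p.1 = p.2 then 1 else 0
  have h := (C.cp _ _ (Matrix.posSemidef_vecMulVec_self_star v)).submatrix
    (fun p : a × b => (p.2, e p.1))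
  convert h using 1
  ext p q
  simp only [choiOf, Matrix.of_apply, Matrix.submatrix_apply, ampliate]
  have hv : Matrix.single p.1 q.1 (1 : ℂ) = Matrix.of fun s t =>
      Matrix.vecMulVec v (star v) (s, e p.1) (t, e q.1) := ?_
  · rw [hv]
  ext s t
  simp only [Matrix.single_apply, Matrix.of_apply, Matrix.vecMulVec_apply, v, Pi.star_apply,
    EmbeddingLike.apply_eq_iff_eq]
  by_cases h1 : s = p.1 <;> by_cases h2 : t = q.1 <;>
    simp [h1, h2, eq_comm (a := p.1), eq_comm (a := q.1)]

/-- This is trace preservation, tested on matrix units. -/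
theorem choiOf_partialTrace (C : Channel a b) (x x' : a) :
    ∑ y, choiOf C.toLin (x, y) (x', y) = if x = x' then 1 else 0 := by
  have h := C.tp (Matrix.single x x' 1)
  rw [Matrix.trace] at h
  simp only [choiOf, Matrix.of_apply]
  rw [show (∑ y, C.toLin (Matrix.single x x' 1) y y) = (Matrix.single x x' (1 : ℂ)).trace from h]
  split_ifs with hx
  · subst hx; simp
  · exact Matrix.trace_single_eq_of_ne _ _ _ hx

theorem psd_hadamard {A B : Matrix a a ℂ} (hA : A.PosSemidef) (hB : B.PosSemidef) :
    (Matrix.of fun i j => A i j * B i j).PosSemidef :=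
  Matrix.PosSemidef.hadamard (𝕜 := ℂ) hA hB

theorem psd_sum_blocks {K : Matrix (a × b) (a × b) ℂ} (hK : K.PosSemidef) :
    (Matrix.of fun s t => ∑ x, ∑ x', K (x, s) (x', t) : Matrix b b ℂ).PosSemidef := by
  let V : Matrix (a × b) b ℂ := Matrix.of fun p t => if p.2 = t then 1 else 0
  convert hK.conjTranspose_mul_mul_same V using 1
  ext s t
  simp only [Matrix.of_apply, Matrix.mul_apply, Matrix.conjTranspose_apply, V,
    Fintype.sum_prod_type, apply_ite star, star_one, star_zero, mul_ite, ite_mul, mul_one,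
    mul_zero, one_mul, zero_mul, Finset.sum_ite_eq', Finset.mem_univ, if_true]
  rw [Finset.sum_comm]

theorem ampliate_choiMap_apply (J : Matrix (a × b) (a × b) ℂ) (X : Matrix (a × r) (a × r) ℂ)
    (p q : b × r) : ampliate (choiMap J) r X p q =
      ∑ x, ∑ x', X (x, p.2) (x', q.2) * J (x, p.1) (x', q.1) := rfl

/-- Pull `X` and `J` back to the index set `a × (b × r)`: the ampliation is the block sum over `a`
of their entrywise product, which is positive by the Schur product theorem. -/
theorem ampliate_choiMap_psd {J : Matrix (a × b) (a × b) ℂ} (hJ : J.PosSemidef)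
    {X : Matrix (a × r) (a × r) ℂ} (hX : X.PosSemidef) :
    (ampliate (choiMap J) r X).PosSemidef := by
  have h := psd_sum_blocks (psd_hadamard (hX.submatrix fun z : a × (b × r) => (z.1, z.2.2))
    (hJ.submatrix fun z : a × (b × r) => (z.1, z.2.1)))
  exact h

/-- The channel with a given Choi matrix. -/
def Channel.ofChoi (J : Matrix (a × b) (a × b) ℂ) (hJ : J.PosSemidef)
    (hT : ∀ x x', ∑ y, J (x, y) (x', y) = if x = x' then 1 else 0) : Channel a b where
  toLin := choiMap J
  cp _ _ hX := ampliate_choiMap_psd hJ hX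
  tp X := by
    simp only [Matrix.trace, Matrix.diag_apply, choiMap_apply]
    rw [Finset.sum_comm]
    refine Finset.sum_congr rfl fun x _ => ?_
    rw [Finset.sum_comm]
    simp only [← Finset.mul_sum, hT]
    simp

theorem choiOf_ofChoi (J : Matrix (a × b) (a × b) ℂ) (hJ : J.PosSemidef)
    (hT : ∀ x x', ∑ y, J (x, y) (x', y) = if x = x' then 1 else 0) :
    choiOf (Channel.ofChoi J hJ hT).toLin = J := choiOf_choiMap J

theorem psd_sum {ι : Type} (s : Finset ι) {K : ι → Matrix a a ℂ}
    (hK : ∀ i ∈ s, (K i).PosSemidef) : (∑ i ∈ s, K i).PosSemidef := by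
  classical
  induction s using Finset.induction_on with
  | empty => simpa using Matrix.PosSemidef.zero
  | insert i s hi ih =>
    rw [Finset.sum_insert hi]
    exact (hK i (by simp)).add (ih fun k hk => hK k (by simp [hk]))

theorem psd_hadamard_prod {ι : Type} (s : Finset ι) {K : ι → Matrix a a ℂ}
    (hK : ∀ i ∈ s, (K i).PosSemidef) :
    (Matrix.of fun p q => ∏ i ∈ s, K i p q : Matrix a a ℂ).PosSemidef := by
  classical
  induction s using Finset.induction_on with
  | empty =>
    convert Matrix.posSemidef_vecMulVec_self_star (fun _ : a => (1 : ℂ)) using 1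
    ext p q
    simp [Matrix.vecMulVec_apply]
  | insert i s hi ih =>
    simp only [Finset.prod_insert hi]
    exact psd_hadamard (hK i (by simp)) (ih fun k hk => hK k (by simp [hk]))

/-- Each eigenvalue of a positive matrix is at most the sum of all of them. -/
theorem psd_trace_smul_one_sub {B : Matrix a a ℂ} (hB : B.PosSemidef) :
    ((B.trace.re : ℂ) • (1 : Matrix a a ℂ) - B).PosSemidef := by
  have htr : B.trace.re = ∑ k, hB.1.eigenvalues k := by
    rw [hB.1.trace_eq_sum_eigenvalues, Complex.re_sum]
    simp
  have h : cfc (fun x : ℝ => B.trace.re - x) B = (B.trace.re : ℂ) • (1 : Matrix a a ℂ) - B := by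
    rw [cfc_sub _ _ B (by fun_prop) (by fun_prop), cfc_const _ B hB.1.isSelfAdjoint,
      cfc_id' ℝ B hB.1.isSelfAdjoint]
    congr 1
    ext i j
    simp [Matrix.algebraMap_matrix_apply, Matrix.one_apply]
  rw [← h]
  open scoped MatrixOrder in
  refine Matrix.nonneg_iff_posSemidef.mp (cfc_nonneg fun x hx => ?_)
  rw [hB.1.spectrum_real_eq_range_eigenvalues] at hx
  obtain ⟨k, rfl⟩ := hx
  rw [htr, sub_nonneg]
  exact Finset.single_le_sum (fun i _ => hB.eigenvalues_nonneg i) (Finset.mem_univ k)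

/-- The trace of the output depends only on the reduced input state `R` and on the partial trace of
`H` over the output: it equals the pairing of `R` with the transpose of that partial trace. An
operator bound by `c` therefore gives a bound by `c` for every state, whatever the ancilla. -/
theorem trace_ampliate_choiMap_le {H : Matrix (a × b) (a × b) ℂ} {c : ℝ}
    (hH : ((c : ℂ) • (1 : Matrix a a ℂ) -
      Matrix.of fun x x' => ∑ y, H (x, y) (x', y)).PosSemidef) (ρ : State (a × r)) :
    (ampliate (choiMap H) r ρ.mat).trace.re ≤ c := by
  let R : Matrix a a ℂ := ∑ q : r, ρ.mat.submatrix (fun x => (x, q)) (fun x => (x, q))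
  have hR : R.PosSemidef := psd_sum _ fun q _ => ρ.psd.submatrix _
  have htr : R.trace = 1 := by
    rw [← ρ.trace_eq_one]
    simp only [R, Matrix.trace_sum]
    simp only [Matrix.trace, Matrix.diag_apply, Matrix.submatrix_apply, Fintype.sum_prod_type]
    rw [Finset.sum_comm]
  have h := (Complex.nonneg_iff.mp (trace_mul_nonneg hR hH.transpose)).1
  have key : (R * ((c : ℂ) • (1 : Matrix a a ℂ) -
      Matrix.of fun x x' => ∑ y, H (x, y) (x', y)).transpose).trace =
      c - (ampliate (choiMap H) r ρ.mat).trace := by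
    rw [Matrix.transpose_sub, Matrix.mul_sub, Matrix.trace_sub, Matrix.transpose_smul,
      Matrix.transpose_one, Matrix.mul_smul, mul_one, Matrix.trace_smul, htr, smul_eq_mul, mul_one]
    congr 1
    simp only [Matrix.trace, Matrix.diag_apply, Matrix.mul_apply, Matrix.transpose_apply,
      Matrix.of_apply, ampliate_choiMap_apply, R, Matrix.sum_apply, Matrix.submatrix_apply,
      Fintype.sum_prod_type, Finset.sum_mul, Finset.mul_sum]
    calc _ = ∑ x, ∑ x', ∑ y, ∑ q, ρ.mat (x, q) (x', q) * H (x, y) (x', y) := by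
          refine Finset.sum_congr rfl fun x _ => ?_
          rw [Finset.sum_comm]
          refine Finset.sum_congr rfl fun x' _ => ?_
          rw [Finset.sum_comm]
      _ = ∑ x, ∑ y, ∑ q, ∑ x', ρ.mat (x, q) (x', q) * H (x, y) (x', y) := by
          refine Finset.sum_congr rfl fun x _ => ?_
          rw [Finset.sum_comm]
          refine Finset.sum_congr rfl fun y _ => ?_
          rw [Finset.sum_comm]
      _ = _ := by
          rw [Finset.sum_comm]
          refine Finset.sum_congr rfl fun y _ => ?_
          rw [Finset.sum_comm]
  rw [key, Complex.sub_re, Complex.ofReal_re] at h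
  linarith

end Choi

/-! ### Products of channels and the hybrid argument -/

section Product

variable {n : ℕ} {dA dB : Fin n → ℕ}

/-- Distributivity of product over sum, after relabelling the coordinates by `τ`. It factorises
traces, partial traces and probabilities alike. -/
theorem sum_prod_perm {R : Type} [CommSemiring R] {β : Fin n → Type} [∀ j, Fintype (β j)]
    (τ : Equiv.Perm (Fin n)) (g : ∀ i, β (τ i) → R) :
    ∑ z : ∀ j, β j, ∏ i, g i (z (τ i)) = ∏ i, ∑ u, g i u := by
  classical
  rw [Finset.prod_univ_sum, Fintype.piFinset_univ]
  exact Fintype.sum_equiv (Equiv.piCongrLeft β τ).symm _ _ fun z => rfl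

/-- The Choi matrix of a tensor product of maps from `A_i` to `B_{τ i}`. -/
def prodChoi (τ : Equiv.Perm (Fin n))
    (J : ∀ i, Matrix (Fin (dA i) × Fin (dB (τ i))) (Fin (dA i) × Fin (dB (τ i))) ℂ) :
    Matrix ((∀ i, Fin (dA i)) × (∀ j, Fin (dB j))) ((∀ i, Fin (dA i)) × (∀ j, Fin (dB j))) ℂ :=
  Matrix.of fun p q => ∏ i, J i (p.1 i, p.2 (τ i)) (q.1 i, q.2 (τ i))

variable (τ : Equiv.Perm (Fin n))
  {J : ∀ i, Matrix (Fin (dA i) × Fin (dB (τ i))) (Fin (dA i) × Fin (dB (τ i))) ℂ}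

theorem prodChoi_psd (hJ : ∀ i, (J i).PosSemidef) : (prodChoi τ J).PosSemidef :=
  psd_hadamard_prod Finset.univ (K := fun i => (J i).submatrix
    (fun p : (∀ i, Fin (dA i)) × (∀ j, Fin (dB j)) => (p.1 i, p.2 (τ i))) _)
    fun i _ => (hJ i).submatrix _

theorem prodChoi_partialTrace (x x' : ∀ i, Fin (dA i)) :
    ∑ y, prodChoi τ J (x, y) (x', y) = ∏ i, ∑ u, J i (x i, u) (x' i, u) :=
  sum_prod_perm (β := fun j => Fin (dB j)) τ fun i u => J i (x i, u) (x' i, u)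

theorem prod_delta (x x' : ∀ i, Fin (dA i)) :
    ∏ i, (if x i = x' i then (1 : ℂ) else 0) = if x = x' then 1 else 0 := by
  rw [Finset.prod_ite_zero]
  simp [funext_iff]

theorem single_eq_tensorOp (x x' : ∀ i, Fin (dA i)) :
    Matrix.single x x' (1 : ℂ) = tensorOp fun i => Matrix.single (x i) (x' i) 1 := by
  ext s t
  simp only [tensorOp, Matrix.of_apply, Matrix.single_apply]
  rw [Finset.prod_ite_zero]
  simp [funext_iff, forall_and]

theorem choiOf_eq_prodChoi {C : Channel (∀ i, Fin (dA i)) (∀ j, Fin (dB j))}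
    {Ch : ∀ i, Channel (Fin (dA i)) (Fin (dB (τ i)))}
    (hC : ∀ (X : ∀ i, Matrix (Fin (dA i)) (Fin (dA i)) ℂ) (y y' : ∀ j, Fin (dB j)),
      C.toLin (tensorOp X) y y' = ∏ i, (Ch i).toLin (X i) (y (τ i)) (y' (τ i))) :
    choiOf C.toLin = prodChoi τ fun i => choiOf (Ch i).toLin := by
  ext p q
  simp only [choiOf, Matrix.of_apply, single_eq_tensorOp, hC, prodChoi]

theorem prod_ite_lt_eq (i : Fin n) (f g h : Fin n → ℂ) :
    ∏ k, (if k < i then f k else if k = i then g k else h k) =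
      g i * (∏ k with k < i, f k) * ∏ k with i < k, h k := by
  rw [Finset.prod_ite, mul_comm (g i), mul_assoc]
  congr 1
  rw [Finset.prod_ite]
  congr 1
  · have : ({x ∈ {x | ¬x < i} | x = i} : Finset (Fin n)) = {i} := by ext k; simp; grind
    rw [this, Finset.prod_singleton]
  · refine Finset.prod_congr ?_ fun _ _ => rfl
    ext k; simp; grind

/-- The telescoping sum behind the hybrid argument: in the `i`-th term the factors before `i` have
been exchanged and those after `i` have not. -/
theorem prod_sub_prod_eq (c d : Fin n → ℂ) :
    ∏ i, c i - ∏ i, d i =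
      ∑ i, (c i - d i) * (∏ k with k < i, d k) * ∏ k with i < k, c k := by
  have h := Finset.prod_sub_ordered Finset.univ c (fun i => c i - d i)
  simp only [sub_sub_cancel] at h
  rw [h]; ring

/-- A tensor product of PSD operators, all but one of which are Choi matrices of channels, acts on
states with the trace of the remaining one as an upper bound. -/
theorem trace_ampliate_prodChoi_le (hJ : ∀ i, (J i).PosSemidef) (i : Fin n)
    (hT : ∀ k, k ≠ i → ∀ x x', ∑ y, J k (x, y) (x', y) = if x = x' then 1 else 0)
    {r : Type} [Fintype r] [DecidableEq r] (ρ : State ((∀ i, Fin (dA i)) × r)) :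
    (ampliate (choiMap (prodChoi τ J)) r ρ.mat).trace.re ≤ (J i).trace.re := by
  refine trace_ampliate_choiMap_le ?_ ρ
  let B : ∀ k, Matrix (Fin (dA k)) (Fin (dA k)) ℂ := fun k =>
    ∑ y, (J k).submatrix (fun x => (x, y)) (fun x => (x, y))
  have hB : ∀ k, (B k).PosSemidef := fun k => psd_sum _ fun y _ => (hJ k).submatrix _
  have htr : ∀ k, (B k).trace = (J k).trace := fun k => by
    simp only [B, Matrix.trace_sum]
    simp only [Matrix.trace, Matrix.diag_apply, Matrix.submatrix_apply, Fintype.sum_prod_type]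
    rw [Finset.sum_comm]
  -- Tracing out the outputs leaves the identity at each `k ≠ i`, so the difference to be shown
  -- positive is itself a tensor product, with factor `Tr(J i) · 1 - B i` at `i` and identities
  -- elsewhere.
  convert tensorOp_psd (X := fun k => if k = i then
    ((J k).trace.re : ℂ) • (1 : Matrix (Fin (dA k)) (Fin (dA k)) ℂ) - B k else 1) ?_ using 1
  · ext x x'
    rw [Matrix.sub_apply, Matrix.smul_apply, Matrix.of_apply, prodChoi_partialTrace,
      Matrix.one_apply, ← prod_delta, tensorOp, Matrix.of_apply, smul_eq_mul,
      ← Finset.mul_prod_erase _ _ (Finset.mem_univ i),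
      ← Finset.mul_prod_erase _ (fun k => ∑ u, J k (x k, u) (x' k, u)) (Finset.mem_univ i),
      ← Finset.mul_prod_erase _ (fun k => (if k = i then
        ((J k).trace.re : ℂ) • (1 : Matrix (Fin (dA k)) (Fin (dA k)) ℂ) - B k else 1) (x k) (x' k))
        (Finset.mem_univ i)]
    have h1 : ∏ k ∈ Finset.univ.erase i, ∑ u, J k (x k, u) (x' k, u) =
        ∏ k ∈ Finset.univ.erase i, (if x k = x' k then (1 : ℂ) else 0) :=
      Finset.prod_congr rfl fun k hk => hT k (Finset.ne_of_mem_erase hk) _ _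
    have h2 : ∏ k ∈ Finset.univ.erase i, (if k = i then
        ((J k).trace.re : ℂ) • (1 : Matrix (Fin (dA k)) (Fin (dA k)) ℂ) - B k else 1) (x k) (x' k) =
        ∏ k ∈ Finset.univ.erase i, (if x k = x' k then (1 : ℂ) else 0) :=
      Finset.prod_congr rfl fun k hk => by
        rw [if_neg (Finset.ne_of_mem_erase hk), Matrix.one_apply]
    rw [h1, h2, if_pos rfl, Matrix.sub_apply, Matrix.smul_apply, Matrix.one_apply, smul_eq_mul]
    simp only [B, Matrix.sum_apply, Matrix.submatrix_apply]
    ring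
  · intro k
    split_ifs with hk
    · rw [← htr]; exact psd_trace_smul_one_sub (hB k)
    · exact Matrix.PosSemidef.one

theorem ampliate_add_sub {a b : Type} [Fintype a] [DecidableEq a] [Fintype b] [DecidableEq b]
    {r : Type} {ι : Type} [Fintype ι] {C D : Matrix (a × b) (a × b) ℂ}
    {P Q : ι → Matrix (a × b) (a × b) ℂ} (h : C - D = ∑ i, (P i - Q i))
    (X : Matrix (a × r) (a × r) ℂ) :
    ampliate (choiMap C) r X - ampliate (choiMap D) r X =
      ∑ i, ampliate (choiMap (P i)) r X - ∑ i, ampliate (choiMap (Q i)) r X := by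
  ext p q
  simp only [Matrix.sub_apply, Matrix.sum_apply, ampliate_choiMap_apply]
  rw [← Finset.sum_sub_distrib]
  have h' : ∀ s t, C s t - D s t = ∑ i, (P i s t - Q i s t) := fun s t => by
    have := congrFun (congrFun h s) t
    simpa [Matrix.sum_apply] using this
  simp only [← Finset.sum_sub_distrib, ← mul_sub, h']
  simp only [Finset.mul_sum]
  rw [Finset.sum_comm]
  rw [Finset.sum_comm]
  conv_rhs => rw [Finset.sum_comm]
  refine Finset.sum_congr rfl fun x _ => ?_
  rw [Finset.sum_comm]

/-- Exchange the factors one at a time. The difference at position `i` splits into positive parts `p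
i` and `q i`, and the other factors preserve the trace, so this exchange contributes at most `Tr (p
i) + Tr (q i)`, the trace norm of the difference of unnormalised Choi matrices. -/
theorem diamondDist_prodChoi_le {C D : Channel (∀ i, Fin (dA i)) (∀ j, Fin (dB j))}
    {c d : ∀ i, Channel (Fin (dA i)) (Fin (dB (τ i)))}
    (hC : choiOf C.toLin = prodChoi τ fun i => choiOf (c i).toLin)
    (hD : choiOf D.toLin = prodChoi τ fun i => choiOf (d i).toLin) :
    diamondDist C D ≤ ∑ i, traceNorm (choiOf (c i).toLin - choiOf (d i).toLin) := by
  refine Real.iSup_le (fun ρ => ?_) (Finset.sum_nonneg fun _ _ => traceNorm_nonneg _)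
  choose p q hp hq hpq htr using fun i =>
    exists_posSemidef_sub ((choiOf_psd (c i)).1.sub (choiOf_psd (d i)).1)
  -- The hybrid: `d` before position `i`, the inserted operator at `i`, and `c` after it.
  let G : (∀ i, Matrix (Fin (dA i) × Fin (dB (τ i))) (Fin (dA i) × Fin (dB (τ i))) ℂ) →
      Fin n → ∀ i, Matrix (Fin (dA i) × Fin (dB (τ i))) (Fin (dA i) × Fin (dB (τ i))) ℂ :=
    fun p i k => if k < i then choiOf (d k).toLin else if k = i then p k else choiOf (c k).toLin
  have hG : ∀ p, (∀ i, (p i).PosSemidef) → ∀ i k, (G p i k).PosSemidef := by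
    intro p hp i k
    simp only [G]
    split_ifs
    exacts [choiOf_psd _, hp _, choiOf_psd _]
  have hGT : ∀ p i k, k ≠ i → ∀ x x', ∑ y, G p i k (x, y) (x', y) = if x = x' then 1 else 0 := by
    intro p i k hk x x'
    simp only [G, if_neg hk]
    split_ifs with h1 h2 h2
    · rw [choiOf_partialTrace, if_pos h2]
    · rw [choiOf_partialTrace, if_neg h2]
    · rw [choiOf_partialTrace, if_pos h2]
    · rw [choiOf_partialTrace, if_neg h2]
  have hGi : ∀ p i, G p i i = p i := fun p i => by simp [G]
  have hGe : ∀ p i s t, prodChoi τ (G p i) s t =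
      p i (s.1 i, s.2 (τ i)) (t.1 i, t.2 (τ i)) *
        (∏ k with k < i, choiOf (d k).toLin (s.1 k, s.2 (τ k)) (t.1 k, t.2 (τ k))) *
        ∏ k with i < k, choiOf (c k).toLin (s.1 k, s.2 (τ k)) (t.1 k, t.2 (τ k)) := by
    intro p i s t
    rw [← prod_ite_lt_eq i
      (fun k => choiOf (d k).toLin (s.1 k, s.2 (τ k)) (t.1 k, t.2 (τ k)))
      (fun k => p k (s.1 k, s.2 (τ k)) (t.1 k, t.2 (τ k)))
      (fun k => choiOf (c k).toLin (s.1 k, s.2 (τ k)) (t.1 k, t.2 (τ k)))]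
    rw [prodChoi, Matrix.of_apply]
    refine Finset.prod_congr rfl fun k _ => ?_
    simp only [G]
    split_ifs <;> rfl
  have hsum : choiOf C.toLin - choiOf D.toLin =
      ∑ i, (prodChoi τ (G p i) - prodChoi τ (G q i)) := by
    rw [hC, hD]
    ext s t
    rw [Matrix.sub_apply, Matrix.sum_apply, prodChoi, prodChoi, Matrix.of_apply, Matrix.of_apply,
      prod_sub_prod_eq]
    refine Finset.sum_congr rfl fun i _ => ?_
    have h := congrFun (congrFun (hpq i) (s.1 i, s.2 (τ i))) (t.1 i, t.2 (τ i))
    rw [Matrix.sub_apply, Matrix.sub_apply] at h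
    rw [Matrix.sub_apply, hGe, hGe, h]
    ring
  have hmain := ampliate_add_sub hsum ρ.mat
  rw [choiMap_choiOf, choiMap_choiOf] at hmain
  rw [hmain]
  -- All positive parts and all negative parts are collected first, so one application replaces a
  -- triangle inequality over `i`.
  refine (traceNorm_sub_le
    (psd_sum _ fun i _ => ampliate_choiMap_psd (prodChoi_psd τ (hG p hp i)) ρ.psd)
    (psd_sum _ fun i _ => ampliate_choiMap_psd (prodChoi_psd τ (hG q hq i)) ρ.psd)).trans ?_
  rw [Matrix.trace_sum, Matrix.trace_sum, Complex.re_sum, Complex.re_sum, ← Finset.sum_add_distrib]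
  refine Finset.sum_le_sum fun i _ => ?_
  rw [← htr i]
  have h1 := trace_ampliate_prodChoi_le τ (hG p hp i) i (hGT p i) ρ
  have h2 := trace_ampliate_prodChoi_le τ (hG q hq i) i (hGT q i) ρ
  rw [hGi] at h1 h2
  exact add_le_add h1 h2

end Product

/-! ### Combs from tensor products and constant channels -/

section Comb

variable {n : ℕ} {dA dB : Fin n → ℕ}

/-- A channel with a trivial memory attached to its input and its output. -/
def Channel.withTrivialMemory {a b : Type} [Fintype a] [DecidableEq a] [Fintype b] [DecidableEq b]
    (E : Channel a b) : Channel (a × Fin 1) (b × Fin 1) :=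
  Channel.ofChoi ((choiOf E.toLin).submatrix
    (fun p : (a × Fin 1) × (b × Fin 1) => (p.1.1, p.2.1)) fun p => (p.1.1, p.2.1))
    ((choiOf_psd E).submatrix _) (by
      rintro ⟨x, s⟩ ⟨x', s'⟩
      obtain rfl := Subsingleton.elim s s'
      simp only [Matrix.submatrix_apply, Fintype.sum_prod_type, Finset.univ_unique,
        Finset.sum_singleton, choiOf_partialTrace, Prod.mk.injEq, and_true])

theorem Channel.withTrivialMemory_kronecker {a b : Type} [Fintype a] [DecidableEq a] [Fintype b]
    [DecidableEq b] (E : Channel a b) (x x' : a) (W : Matrix (Fin 1) (Fin 1) ℂ) (y y' : b)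
    (s t : Fin 1) :
    E.withTrivialMemory.toLin (Matrix.kronecker (Matrix.single x x' 1) W) (y, s) (y', t) =
      W 0 0 * E.toLin (Matrix.single x x' 1) y y' := by
  rw [Channel.withTrivialMemory, Channel.ofChoi, choiMap_apply]
  simp only [Fintype.sum_prod_type, Finset.univ_unique, Finset.sum_singleton, Fin.default_eq_zero,
    Matrix.submatrix_apply, Matrix.kronecker, Matrix.kroneckerMap_apply]
  rw [Finset.sum_eq_single x, Finset.sum_eq_single x']
  · simp [choiOf]
  · intro z _ hz
    simp [hz.symm]
  · simp
  · intro z _ hz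
    simp [hz.symm]
  · simp

theorem isComb_of_tensor (π : Equiv.Perm (Fin n)) {D : Channel (∀ i, Fin (dA i)) (∀ j, Fin (dB j))}
    (E : ∀ k, Channel (Fin (dA k)) (Fin (dB (π k))))
    (hD : ∀ x x' y y', D.toLin (Matrix.single x x' 1) y y' =
      ∏ k, (E k).toLin (Matrix.single (x k) (x' k) 1) (y (π k)) (y' (π k))) :
    IsComb 1 π D := by
  refine ⟨fun _ => 1, fun k => (E k).withTrivialMemory, rfl, rfl, fun x x' y y' => ?_⟩
  -- With one-dimensional memories, the memory operator after the first `k` teeth is a scalar: the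
  -- product of the matrix entries contributed by those teeth.
  have key : ∀ k : Fin (n + 1), ∀ s t, combMemory (dA := dA) (dB := dB) 1 π (fun _ => 1)
      (fun k => (E k).withTrivialMemory) x x' y y' k s t =
      ∏ l with l.castSucc < k,
        (E l).toLin (Matrix.single (x l) (x' l) 1) (y (π l)) (y' (π l)) := by
    intro k
    induction k using Fin.induction with
    | zero =>
      intro s t
      obtain rfl := Subsingleton.elim s t
      simp [combMemory]
    | succ k ih =>
      intro s t
      have h1 : combMemory (dA := dA) (dB := dB) 1 π (fun _ => 1)
          (fun k => (E k).withTrivialMemory) x x' y y' k.succ s t =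
          (E k).withTrivialMemory.toLin (Matrix.kronecker (Matrix.single (x k) (x' k) 1)
            (combMemory (dA := dA) (dB := dB) 1 π (fun _ => 1)
              (fun k => (E k).withTrivialMemory) x x' y y' k.castSucc)) (y (π k), s)
            (y' (π k), t) := rfl
      have h2 : (Finset.univ.filter fun l : Fin n => l.castSucc < k.succ) =
          insert k (Finset.univ.filter fun l : Fin n => l.castSucc < k.castSucc) := by
        ext l
        simp [le_iff_eq_or_lt, Fin.castSucc_lt_succ_iff]
      rw [h1, Channel.withTrivialMemory_kronecker, ih 0 0, h2, Finset.prod_insert (by simp),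
        mul_comm]
  rw [hD, Matrix.trace]
  simp only [Finset.univ_unique, Finset.sum_singleton, Matrix.diag_apply, key]
  refine (Finset.prod_congr ?_ fun _ _ => rfl)
  ext l
  simp [Fin.castSucc_lt_last]

/-- The channel that discards its input and prepares a fixed state. -/
def Channel.replace {a b : Type} [Fintype a] [DecidableEq a] [Fintype b] [DecidableEq b]
    (σ : State b) : Channel a b :=
  Channel.ofChoi (Matrix.kronecker 1 σ.mat) (Matrix.PosSemidef.one.kronecker σ.psd) (by
    intro x x'
    have hk : ∀ y, Matrix.kronecker (1 : Matrix a a ℂ) σ.mat (x, y) (x', y) =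
      (1 : Matrix a a ℂ) x x' * σ.mat y y := fun y => rfl
    have h := σ.trace_eq_one
    simp only [Matrix.trace, Matrix.diag_apply] at h
    rw [Finset.sum_congr rfl fun y _ => hk y, ← Finset.mul_sum, h, mul_one, Matrix.one_apply])

theorem choiOf_replace {a b : Type} [Fintype a] [DecidableEq a] [Fintype b] [DecidableEq b]
    (σ : State b) : choiOf (Channel.replace σ : Channel a b).toLin = Matrix.kronecker 1 σ.mat :=
  choiOf_ofChoi _ _ _

theorem choiOf_cast {a : Type} [Fintype a] [DecidableEq a] {j j' : Fin n} (h : j = j')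
    (E : Channel a (Fin (dB j))) (x x' : a) (y y' : ∀ j, Fin (dB j)) :
    choiOf (h ▸ E : Channel a (Fin (dB j'))).toLin (x, y j') (x', y' j') =
      choiOf E.toLin (x, y j) (x', y' j) := by
  subst h; rfl

/-- Two permutations that agree on a set of indices send its complement to the same set of outputs.
The proof replaces `s` by `1` at the outputs of agreement and compares full products. -/
theorem prod_comp_perm_eq_of_agree (τ π : Equiv.Perm (Fin n)) (s : Fin n → ℂ) :
    ∏ i with π i ≠ τ i, s (τ i) = ∏ i with π i ≠ τ i, s (π i) := by
  let s' : Fin n → ℂ := fun j => if π (τ.symm j) = j then 1 else s j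
  have h1 : ∏ i, s' (τ i) = ∏ i with π i ≠ τ i, s (τ i) := by
    rw [Finset.prod_filter]
    refine Finset.prod_congr rfl fun i _ => ?_
    simp only [s', Equiv.symm_apply_apply, ne_eq, ite_not]
  have h2 : ∏ i, s' (π i) = ∏ i with π i ≠ τ i, s (π i) := by
    rw [Finset.prod_filter]
    refine Finset.prod_congr rfl fun i _ => ?_
    have : π (τ.symm (π i)) = π i ↔ π i = τ i := by
      rw [π.injective.eq_iff, Equiv.symm_apply_eq]
    simp only [s', this, ne_eq, ite_not]
  rw [← h1, ← h2, Equiv.prod_comp τ s', Equiv.prod_comp π s']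

/-- Replacing by fixed states the factors of a tensor product of channels at which `π` and `τ`
differ gives a comb with order `π`. -/
theorem exists_isComb_diamondDist_le (τ π : Equiv.Perm (Fin n))
    {C : Channel (∀ i, Fin (dA i)) (∀ j, Fin (dB j))}
    {Ch : ∀ i, Channel (Fin (dA i)) (Fin (dB (τ i)))}
    (hC : choiOf C.toLin = prodChoi τ fun i => choiOf (Ch i).toLin)
    (s : ∀ i, State (Fin (dB (τ i)))) :
    ∃ D : Channel (∀ i, Fin (dA i)) (∀ j, Fin (dB j)), IsComb 1 π D ∧
      diamondDist C D ≤ ∑ i with π i ≠ τ i,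
        traceNorm (choiOf (Ch i).toLin - Matrix.kronecker 1 (s i).mat) := by
  obtain ⟨σ, hσ⟩ : ∃ σ : ∀ j, State (Fin (dB j)), ∀ i, σ (τ i) = s i :=
    ⟨Equiv.piCongrLeft (fun j => State (Fin (dB j))) τ s, fun i =>
      Equiv.piCongrLeft_apply_apply _ _ _ _⟩
  -- `d` and `e` present the same channel as a product along `τ` and along `π`: they coincide where
  -- the permutations agree, and elsewhere both are constant, so only the set of prepared outputs
  -- matters. `d` serves the distance bound and `e` the comb property.
  let d : ∀ i, Channel (Fin (dA i)) (Fin (dB (τ i))) := fun i =>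
    if π i = τ i then Ch i else Channel.replace (σ (τ i))
  let e : ∀ i, Channel (Fin (dA i)) (Fin (dB (π i))) := fun i =>
    if h : τ i = π i then h ▸ Ch i else Channel.replace (σ (π i))
  let D : Channel (∀ i, Fin (dA i)) (∀ j, Fin (dB j)) :=
    Channel.ofChoi (prodChoi τ fun i => choiOf (d i).toLin) (prodChoi_psd τ fun i => choiOf_psd _)
      (fun x x' => by
        rw [prodChoi_partialTrace, ← prod_delta]
        exact Finset.prod_congr rfl fun i _ => choiOf_partialTrace _ _ _)
  have hD : choiOf D.toLin = prodChoi τ fun i => choiOf (d i).toLin := choiOf_ofChoi _ _ _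
  refine ⟨D, isComb_of_tensor π e fun x x' y y' => ?_, ?_⟩
  · have h1 : D.toLin (Matrix.single x x' 1) y y' = choiOf D.toLin (x, y) (x', y') := rfl
    have h2 : ∀ k, (e k).toLin (Matrix.single (x k) (x' k) 1) (y (π k)) (y' (π k)) =
      choiOf (e k).toLin (x k, y (π k)) (x' k, y' (π k)) := fun k => rfl
    simp only [h1, h2, hD, prodChoi, Matrix.of_apply]
    rw [← Finset.prod_filter_mul_prod_filter_not Finset.univ (fun i => π i ≠ τ i),
      ← Finset.prod_filter_mul_prod_filter_not Finset.univ (fun i => π i ≠ τ i)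
        (fun k => choiOf (e k).toLin (x k, y (π k)) (x' k, y' (π k)))]
    congr 1
    · have hd : ∀ i ∈ Finset.univ.filter (fun i => π i ≠ τ i),
          choiOf (d i).toLin (x i, y (τ i)) (x' i, y' (τ i)) =
            (if x i = x' i then 1 else 0) * (σ (τ i)).mat (y (τ i)) (y' (τ i)) := fun i hi => by
        have : d i = Channel.replace (σ (τ i)) := if_neg (Finset.mem_filter.mp hi).2
        rw [this, choiOf_replace, Matrix.kronecker, Matrix.kroneckerMap_apply, Matrix.one_apply]
      have he : ∀ i ∈ Finset.univ.filter (fun i => π i ≠ τ i),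
          choiOf (e i).toLin (x i, y (π i)) (x' i, y' (π i)) =
            (if x i = x' i then 1 else 0) * (σ (π i)).mat (y (π i)) (y' (π i)) := fun i hi => by
        have : e i = Channel.replace (σ (π i)) :=
          dif_neg fun h => (Finset.mem_filter.mp hi).2 h.symm
        rw [this, choiOf_replace, Matrix.kronecker, Matrix.kroneckerMap_apply, Matrix.one_apply]
      rw [Finset.prod_congr rfl hd, Finset.prod_congr rfl he, Finset.prod_mul_distrib,
        Finset.prod_mul_distrib,
        prod_comp_perm_eq_of_agree τ π (fun j => (σ j).mat (y j) (y' j))]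
    · refine Finset.prod_congr rfl fun i hi => ?_
      have hi' : π i = τ i := not_not.mp (Finset.mem_filter.mp hi).2
      have hd : d i = Ch i := if_pos hi'
      have he : e i = hi'.symm ▸ Ch i := dif_pos hi'.symm
      rw [hd, he, choiOf_cast]
  · refine (diamondDist_prodChoi_le τ hC hD).trans (le_of_eq ?_)
    rw [Finset.sum_filter]
    refine Finset.sum_congr rfl fun i _ => ?_
    by_cases h : π i = τ i
    · simp [d, h, traceNorm_zero]
    · simp only [d, h, if_false, ne_eq, not_false_iff, if_true, choiOf_replace, hσ]

end Comb

/-! ### Frame bounds and dual operators of informationally complete POVMs -/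

namespace ICPOVM

variable {d e : ℕ} (P : ICPOVM d) (Q : ICPOVM e)

theorem frame_eq : P.frame = P.analysis.conjTranspose * P.analysis := by
  ext x y
  simp [frame, analysis, Matrix.sum_apply, Matrix.vecMulVec_apply, Matrix.mul_apply]

theorem elem_swap (α : Fin (d ^ 2)) (i j : Fin d) : star (P.elem α i j) = P.elem α j i :=
  (P.psd α).1.apply j i

/-- The vector is orthogonal to every POVM element. These span, so it is orthogonal to itself. -/
theorem eq_zero_of_analysis_mulVec {x : Fin d × Fin d → ℂ} (hx : P.analysis.mulVec x = 0) :
    x = 0 := by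
  have h : ∀ M : Matrix (Fin d) (Fin d) ℂ, ∑ ij : Fin d × Fin d, star (M ij.1 ij.2) * x ij = 0 := by
    intro M
    have hM : M ∈ Submodule.span ℂ (Set.range P.elem) := P.span_eq_top ▸ Submodule.mem_top
    induction hM using Submodule.span_induction with
    | mem M hM =>
      obtain ⟨α, rfl⟩ := hM
      exact congrFun hx α
    | zero => simp
    | add M N _ _ hM hN =>
      simp only [Matrix.add_apply, star_add, add_mul, Finset.sum_add_distrib, hM, hN, add_zero]
    | smul c M _ hM =>
      simp only [Matrix.smul_apply, smul_eq_mul, star_mul', mul_assoc, ← Finset.mul_sum, hM,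
        mul_zero]
  have h1 := h (Matrix.of fun i j => x (i, j))
  have h2 : ((∑ ij, ‖x ij‖ ^ 2 : ℝ) : ℂ) = 0 := by
    rw [← h1]
    push_cast
    exact Finset.sum_congr rfl fun ij _ => (Complex.conj_mul' _).symm
  have h3 := Complex.ofReal_eq_zero.mp h2
  rw [Finset.sum_eq_zero_iff_of_nonneg fun _ _ => by positivity] at h3
  funext ij
  simpa using h3 ij (Finset.mem_univ _)

theorem frame_posDef : P.frame.PosDef := by
  rw [frame_eq]
  refine Matrix.PosDef.conjTranspose_mul_self _ fun x y hxy => ?_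
  have : P.analysis.mulVec (x - y) = 0 := by
    rw [Matrix.mulVec_sub, sub_eq_zero]; exact hxy
  exact sub_eq_zero.mp (P.eq_zero_of_analysis_mulVec this)

theorem minEigenvalue_pos [NeZero d] : 0 < P.minEigenvalue := by
  obtain ⟨k, hk⟩ := exists_eq_ciInf_of_finite (f := P.frame_isHermitian.eigenvalues)
  rw [minEigenvalue, ← hk]
  exact P.frame_posDef.eigenvalues_pos k

/-- This is `F - λ ≥ 0` read as a quadratic form, with `F = S† S`. -/
theorem minEigenvalue_mul_le (x : Fin d × Fin d → ℂ) :
    P.minEigenvalue * ∑ ij, ‖x ij‖ ^ 2 ≤ ∑ α, ‖P.analysis.mulVec x α‖ ^ 2 := by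
  have hpsd : (P.frame - (P.minEigenvalue : ℂ) • 1).PosSemidef := by
    have h : cfc (fun x : ℝ => x - P.minEigenvalue) P.frame =
        P.frame - (P.minEigenvalue : ℂ) • 1 := by
      have hsa := P.frame_isHermitian.isSelfAdjoint
      rw [cfc_sub _ _ P.frame (by fun_prop) (by fun_prop), cfc_const _ P.frame hsa,
        cfc_id' ℝ P.frame hsa]
      congr 1
      ext i j
      simp [Matrix.algebraMap_matrix_apply, Matrix.one_apply]
    rw [← h]
    open scoped MatrixOrder in
    refine Matrix.nonneg_iff_posSemidef.mp (cfc_nonneg fun x hx => ?_)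
    rw [P.frame_isHermitian.spectrum_real_eq_range_eigenvalues] at hx
    obtain ⟨k, rfl⟩ := hx
    rw [sub_nonneg]
    exact ciInf_le (Set.finite_range _).bddBelow k
  have h := (Complex.nonneg_iff.mp (hpsd.dotProduct_mulVec_nonneg x)).1
  have nsq : ∀ {ι : Type} [Fintype ι] (v : ι → ℂ),
      star v ⬝ᵥ v = ((∑ i, ‖v i‖ ^ 2 : ℝ) : ℂ) := fun v => by
    push_cast
    exact Finset.sum_congr rfl fun i _ => Complex.conj_mul' _
  have h2 : star x ⬝ᵥ (P.frame - (P.minEigenvalue : ℂ) • 1).mulVec x =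
      ((∑ α, ‖P.analysis.mulVec x α‖ ^ 2 - P.minEigenvalue * ∑ ij, ‖x ij‖ ^ 2 : ℝ) : ℂ) := by
    rw [Matrix.sub_mulVec, Matrix.smul_mulVec, Matrix.one_mulVec, dotProduct_sub,
      dotProduct_smul, nsq x, frame_eq, ← Matrix.mulVec_mulVec, Matrix.dotProduct_mulVec,
      Matrix.vecMul_conjTranspose, star_star, nsq]
    push_cast
    rfl
  rw [h2, Complex.ofReal_re] at h
  linarith

/-- Test the frame bound on the matrix unit at `(0, 0)`: the entries `P_α 0 0` lie in `[0, 1]` and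
sum to one, so their squares sum to at most one. The bound enters the running-time estimate only. -/
theorem minEigenvalue_le_one [NeZero d] : P.minEigenvalue ≤ 1 := by
  let o : Fin d × Fin d := (0, 0)
  have h := P.minEigenvalue_mul_le (Pi.single o 1)
  have h1 : ∑ ij, ‖(Pi.single o 1 : Fin d × Fin d → ℂ) ij‖ ^ 2 = 1 := by
    rw [Finset.sum_eq_single o]
    · simp
    · intro z _ hz; simp [hz]
    · simp
  rw [h1, mul_one] at h
  refine h.trans ?_
  have hs : ∑ α, (P.elem α 0 0).re = 1 := by
    have := congrFun (congrFun P.sum_eq_one 0) 0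
    rw [Matrix.sum_apply, Matrix.one_apply_eq] at this
    rw [← Complex.re_sum, this, Complex.one_re]
  have h0 : ∀ α, 0 ≤ (P.elem α 0 0).re ∧ (0 = (P.elem α 0 0).im) := fun α =>
    Complex.nonneg_iff.mp (P.psd α).diag_nonneg
  have hle : ∀ α, (P.elem α 0 0).re ≤ 1 := fun α => by
    rw [← hs]
    exact Finset.single_le_sum (f := fun α => (P.elem α 0 0).re) (fun i _ => (h0 i).1)
      (Finset.mem_univ α)
  rw [← hs]
  refine Finset.sum_le_sum fun α _ => ?_
  rw [Matrix.mulVec_single_one, Matrix.col_apply, analysis, Matrix.of_apply, norm_star,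
    ← Complex.normSq_eq_norm_sq, Complex.normSq_apply, ← (h0 α).2]
  nlinarith [(h0 α).1, hle α]

theorem reconstruction_mul_analysis : P.reconstruction * P.analysis = 1 := by
  rw [reconstruction, Matrix.mul_assoc, ← frame_eq]
  exact Matrix.nonsing_inv_mul _ ((Matrix.isUnit_iff_isUnit_det _).mp P.frame_posDef.isUnit)

/-- With exactly `d ^ 2` elements `S` is square, so its left inverse is also a right inverse. -/
theorem analysis_mul_reconstruction : P.analysis * P.reconstruction = 1 :=
  (Matrix.mul_eq_one_comm_of_card_eq _ _ _ (by
    rw [Fintype.card_prod, Fintype.card_fin, Fintype.card_fin, sq])).mp P.reconstruction_mul_analysis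

theorem sum_norm_sq_reconstruction_le [NeZero d] (v : Fin (d ^ 2) → ℂ) :
    ∑ ij, ‖P.reconstruction.mulVec v ij‖ ^ 2 ≤ P.minEigenvalue⁻¹ * ∑ α, ‖v α‖ ^ 2 := by
  have h := P.minEigenvalue_mul_le (P.reconstruction.mulVec v)
  rw [Matrix.mulVec_mulVec, analysis_mul_reconstruction, Matrix.one_mulVec] at h
  rwa [le_inv_mul_iff₀ P.minEigenvalue_pos]

/-- Since the elements sum to the identity, the row sum of `S` is the trace functional. Composing
with the right inverse of `S` shows that every dual operator has trace one, which makes partial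
traces of reconstructions match marginals. -/
theorem sum_reconstruction_diag (α : Fin (d ^ 2)) : ∑ j, P.reconstruction (j, j) α = 1 := by
  have h : ∑ β, (P.analysis * P.reconstruction) β α = 1 := by
    rw [analysis_mul_reconstruction]
    simp [Matrix.one_apply]
  rw [← h]
  simp only [Matrix.mul_apply]
  rw [Finset.sum_comm]
  simp only [← Finset.sum_mul]
  have hs : ∀ ij : Fin d × Fin d, ∑ β, P.analysis β ij = if ij.1 = ij.2 then 1 else 0 := fun ij => by
    simp only [analysis, Matrix.of_apply, ← star_sum, ← Matrix.sum_apply, P.sum_eq_one,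
      Matrix.one_apply, apply_ite star, star_one, star_zero]
  simp only [hs, Fintype.sum_prod_type, ite_mul, one_mul, zero_mul, Finset.sum_ite_eq,
    Finset.mem_univ, if_true]

/-- The dual operators are Hermitian: their adjoints also form a right inverse `T` of `S`, and that
inverse is unique. -/
theorem reconstruction_swap (i j : Fin d) (α : Fin (d ^ 2)) :
    star (P.reconstruction (i, j) α) = P.reconstruction (j, i) α := by
  let T : Matrix (Fin d × Fin d) (Fin (d ^ 2)) ℂ :=
    Matrix.of fun ij α => star (P.reconstruction (ij.2, ij.1) α)
  have hT : P.analysis * T = 1 := by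
    ext β γ
    have h := congrArg star (congrFun (congrFun P.analysis_mul_reconstruction β) γ)
    rw [Matrix.mul_apply, star_sum] at h
    have h1 : star ((1 : Matrix (Fin (d ^ 2)) (Fin (d ^ 2)) ℂ) β γ) =
        (1 : Matrix (Fin (d ^ 2)) (Fin (d ^ 2)) ℂ) β γ := by
      rw [Matrix.one_apply]; split_ifs <;> simp
    rw [h1] at h
    rw [← h, Matrix.mul_apply, ← (Equiv.prodComm _ _).sum_comp]
    refine Finset.sum_congr rfl fun ij _ => ?_
    simp only [T, analysis, Matrix.of_apply, star_mul', Equiv.prodComm_apply,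
      Prod.fst_swap, Prod.snd_swap, elem_swap]
  have : T = P.reconstruction := by
    rw [← Matrix.one_mul T, ← P.reconstruction_mul_analysis, Matrix.mul_assoc, hT, Matrix.mul_one]
  rw [← congrFun (congrFun this (j, i)) α]
  rfl

end ICPOVM

/-! ### Bipartite reconstruction and its stability -/

section Reconstruct

variable {d e : ℕ} (P : ICPOVM d) (Q : ICPOVM e)

/-- The bipartite operator reconstructed from the expectation values of `P_α ⊗ Q_β`. -/
def reconstruct (v : Fin (d ^ 2) × Fin (e ^ 2) → ℂ) :
    Matrix (Fin d × Fin e) (Fin d × Fin e) ℂ :=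
  Matrix.of fun x x' => ∑ ab, P.reconstruction (x.1, x'.1) ab.1 *
    Q.reconstruction (x.2, x'.2) ab.2 * v ab

theorem reconstruct_add (v w : Fin (d ^ 2) × Fin (e ^ 2) → ℂ) :
    reconstruct P Q (v + w) = reconstruct P Q v + reconstruct P Q w := by
  ext x x'
  simp [reconstruct, mul_add, Finset.sum_add_distrib]

theorem reconstruct_sub (v w : Fin (d ^ 2) × Fin (e ^ 2) → ℂ) :
    reconstruct P Q (v - w) = reconstruct P Q v - reconstruct P Q w := by
  ext x x'
  simp [reconstruct, mul_sub, Finset.sum_sub_distrib]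

theorem reconstruct_smul (c : ℂ) (v : Fin (d ^ 2) × Fin (e ^ 2) → ℂ) :
    reconstruct P Q (c • v) = c • reconstruct P Q v := by
  ext x x'
  simp only [reconstruct, Matrix.of_apply, Matrix.smul_apply, Pi.smul_apply, smul_eq_mul,
    Finset.mul_sum]
  exact Finset.sum_congr rfl fun _ _ => by ring

theorem reconstruct_isHermitian (v : Fin (d ^ 2) × Fin (e ^ 2) → ℝ) :
    (reconstruct P Q fun ab => (v ab : ℂ)).IsHermitian := by
  ext x x'
  simp only [Matrix.conjTranspose_apply, reconstruct, Matrix.of_apply, star_sum, star_mul',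
    ICPOVM.reconstruction_swap, RCLike.star_def, Complex.conj_ofReal]

theorem sum_norm_sq_reconstruct_le [NeZero d] [NeZero e] (v : Fin (d ^ 2) × Fin (e ^ 2) → ℂ) :
    ∑ x, ∑ x', ‖reconstruct P Q v x x'‖ ^ 2 ≤
      P.minEigenvalue⁻¹ * Q.minEigenvalue⁻¹ * ∑ ab, ‖v ab‖ ^ 2 := by
  -- Reconstruct on the second factor only. The bound for one system then applies twice, to `P` at
  -- each fixed entry of the second factor and to `Q` at each fixed label of the first.
  let z : Fin (d ^ 2) → Fin e × Fin e → ℂ := fun α =>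
    Q.reconstruction.mulVec fun β => v (α, β)
  have hz : ∀ x x', reconstruct P Q v x x' =
      P.reconstruction.mulVec (fun α => z α (x.2, x'.2)) (x.1, x'.1) := by
    intro x x'
    simp only [reconstruct, Matrix.of_apply, Matrix.mulVec, dotProduct, z, Fintype.sum_prod_type,
      Finset.mul_sum]
    exact Finset.sum_congr rfl fun _ _ => Finset.sum_congr rfl fun _ _ => by ring
  calc ∑ x, ∑ x', ‖reconstruct P Q v x x'‖ ^ 2
      = ∑ kl : Fin e × Fin e, ∑ ij : Fin d × Fin d,
          ‖P.reconstruction.mulVec (fun α => z α kl) ij‖ ^ 2 := by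
        simp only [hz, Fintype.sum_prod_type]
        rw [Finset.sum_comm]
        refine Finset.sum_congr rfl fun k _ => ?_
        rw [Finset.sum_comm' (t' := Finset.univ) (s' := fun _ => Finset.univ) (by simp)]
        rw [Finset.sum_comm]
        rw [Finset.sum_congr rfl fun i _ => Finset.sum_comm]
        rw [Finset.sum_comm]
    _ ≤ ∑ kl : Fin e × Fin e, P.minEigenvalue⁻¹ * ∑ α, ‖z α kl‖ ^ 2 :=
        Finset.sum_le_sum fun kl _ => P.sum_norm_sq_reconstruction_le _
    _ = P.minEigenvalue⁻¹ * ∑ α, ∑ kl, ‖z α kl‖ ^ 2 := by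
        rw [← Finset.mul_sum, Finset.sum_comm]
    _ ≤ P.minEigenvalue⁻¹ * ∑ α, Q.minEigenvalue⁻¹ * ∑ β, ‖v (α, β)‖ ^ 2 :=
        mul_le_mul_of_nonneg_left
          (Finset.sum_le_sum fun α _ => Q.sum_norm_sq_reconstruction_le _)
          (inv_nonneg.mpr P.minEigenvalue_pos.le)
    _ = _ := by
        rw [← Finset.mul_sum, Fintype.sum_prod_type, mul_assoc]

/-- The product of the marginals subtracted from an array. -/
def covariance {ι κ : Type} [Fintype ι] [Fintype κ] (p : ι × κ → ℝ) : ι × κ → ℝ :=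
  fun ab => p ab - (∑ b, p (ab.1, b)) * ∑ a, p (a, ab.2)

/-- The dual operators have trace one, so each partial trace reconstructs a marginal of `p`. The
quadratic term of `χ₁` thereby moves into the array, and what remains is linear in the covariance.
-/
theorem chi1_reconstruct (p : Fin (d ^ 2) × Fin (e ^ 2) → ℝ) :
    chi1 (reconstruct P Q fun ab => (p ab : ℂ)) =
      traceNorm (reconstruct P Q fun ab => (covariance p ab : ℂ)) := by
  have hA : ∀ i i', ∑ j, reconstruct P Q (fun ab => (p ab : ℂ)) (i, j) (i', j) =
      ∑ a, P.reconstruction (i, i') a * ∑ b, (p (a, b) : ℂ) := by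
    intro i i'
    simp only [reconstruct, Matrix.of_apply]
    rw [Finset.sum_comm]
    simp only [← Finset.sum_mul, ← Finset.mul_sum, Q.sum_reconstruction_diag, mul_one]
    simp only [Fintype.sum_prod_type, Finset.mul_sum]
  have hB : ∀ j j', ∑ i, reconstruct P Q (fun ab => (p ab : ℂ)) (i, j) (i, j') =
      ∑ b, Q.reconstruction (j, j') b * ∑ a, (p (a, b) : ℂ) := by
    intro i i'
    simp only [reconstruct, Matrix.of_apply]
    rw [Finset.sum_comm]
    simp only [← Finset.sum_mul, P.sum_reconstruction_diag, one_mul]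
    simp only [Fintype.sum_prod_type, Finset.mul_sum]
    rw [Finset.sum_comm]
  rw [chi1]
  congr 1
  ext x x'
  rw [Matrix.sub_apply, Matrix.kronecker, Matrix.kroneckerMap_apply, Matrix.of_apply,
    Matrix.of_apply, hA, hB]
  simp only [reconstruct, Matrix.of_apply, covariance]
  rw [Finset.sum_mul_sum, ← Fintype.sum_prod_type', ← Finset.sum_sub_distrib]
  refine Finset.sum_congr rfl fun ab _ => ?_
  push_cast
  ring

theorem reconstruct_eq {J : Matrix (Fin d × Fin e) (Fin d × Fin e) ℂ}
    {v : Fin (d ^ 2) × Fin (e ^ 2) → ℂ}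
    (h : ∀ ab, v ab = ∑ ii : Fin d × Fin d, ∑ jj : Fin e × Fin e,
      P.analysis ab.1 ii * Q.analysis ab.2 jj * J (ii.1, jj.1) (ii.2, jj.2)) :
    reconstruct P Q v = J := by
  ext x x'
  have h1 : ∀ ii, ∑ α, P.reconstruction (x.1, x'.1) α * P.analysis α ii =
      (1 : Matrix (Fin d × Fin d) (Fin d × Fin d) ℂ) (x.1, x'.1) ii := fun ii => by
    rw [← P.reconstruction_mul_analysis, Matrix.mul_apply]
  have h2 : ∀ jj, ∑ β, Q.reconstruction (x.2, x'.2) β * Q.analysis β jj =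
      (1 : Matrix (Fin e × Fin e) (Fin e × Fin e) ℂ) (x.2, x'.2) jj := fun jj => by
    rw [← Q.reconstruction_mul_analysis, Matrix.mul_apply]
  calc reconstruct P Q v x x' = ∑ ab : Fin (d ^ 2) × Fin (e ^ 2), ∑ ii : Fin d × Fin d,
        ∑ jj : Fin e × Fin e,
        (P.reconstruction (x.1, x'.1) ab.1 * P.analysis ab.1 ii) *
        (Q.reconstruction (x.2, x'.2) ab.2 * Q.analysis ab.2 jj) * J (ii.1, jj.1) (ii.2, jj.2) := by
        simp only [reconstruct, Matrix.of_apply, h, Finset.mul_sum]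
        refine Finset.sum_congr rfl fun _ _ => Finset.sum_congr rfl fun _ _ =>
          Finset.sum_congr rfl fun _ _ => by ring
    _ = ∑ ii : Fin d × Fin d, ∑ jj : Fin e × Fin e,
        (∑ α, P.reconstruction (x.1, x'.1) α * P.analysis α ii) *
        (∑ β, Q.reconstruction (x.2, x'.2) β * Q.analysis β jj) * J (ii.1, jj.1) (ii.2, jj.2) := by
        rw [Finset.sum_comm]
        refine Finset.sum_congr rfl fun ii _ => ?_
        rw [Finset.sum_comm]
        refine Finset.sum_congr rfl fun jj _ => ?_
        rw [Finset.sum_mul_sum, ← Fintype.sum_prod_type', Finset.sum_mul]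
    _ = J x x' := by
        simp only [h1, h2]
        rw [Finset.sum_eq_single (x.1, x'.1), Finset.sum_eq_single (x.2, x'.2)]
        · simp
        · intro z _ hz
          rw [Matrix.one_apply_ne hz.symm]; ring
        · simp
        · intro z _ hz
          refine Finset.sum_eq_zero fun _ _ => ?_
          rw [Matrix.one_apply_ne hz.symm]; ring
        · simp

/-- The Choi matrix of a channel is reconstructed from the numbers `Tr[Q_β C(P_αᵀ)]`. -/
theorem reconstruct_eq_choiOf (L : Matrix (Fin d) (Fin d) ℂ →ₗ[ℂ] Matrix (Fin e) (Fin e) ℂ) :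
    reconstruct P Q (fun ab => (Q.elem ab.2 * L (P.elem ab.1).transpose).trace) = choiOf L := by
  refine reconstruct_eq P Q fun ab => ?_
  simp only [Matrix.trace, Matrix.diag_apply, Matrix.mul_apply, ICPOVM.analysis, Matrix.of_apply,
    ICPOVM.elem_swap, choiOf]
  simp only [map_apply_eq_sum_single L (P.elem ab.1).transpose, Matrix.transpose_apply,
    Finset.mul_sum, Fintype.sum_prod_type]
  calc _ = ∑ y', ∑ x, ∑ y, ∑ x', Q.elem ab.2 y' y *
        (P.elem ab.1 x' x * L (Matrix.single x x' 1) y y') := by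
        refine Finset.sum_congr rfl fun y' _ => ?_
        rw [Finset.sum_comm]
    _ = ∑ x, ∑ y', ∑ x', ∑ y, Q.elem ab.2 y' y *
        (P.elem ab.1 x' x * L (Matrix.single x x' 1) y y') := by
        rw [Finset.sum_comm]
        refine Finset.sum_congr rfl fun x _ => Finset.sum_congr rfl fun y' _ => ?_
        rw [Finset.sum_comm]
    _ = _ := by
        refine Finset.sum_congr rfl fun x _ => ?_
        rw [Finset.sum_comm]
        refine Finset.sum_congr rfl fun x' _ => ?_
        rw [Finset.sum_comm]
        refine Finset.sum_congr rfl fun y _ => Finset.sum_congr rfl fun y' _ => ?_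
        ring

/-- An array of `d² e²` entries of size `t` has Euclidean norm at most `d e t`. Reconstruction
multiplies this by at most `1 / l`, and passing from Frobenius to trace norm costs `√(d e)`. -/
theorem traceNorm_reconstruct_le [NeZero d] [NeZero e] (v : Fin (d ^ 2) × Fin (e ^ 2) → ℂ) {t : ℝ}
    (ht : 0 ≤ t) (hv : ∀ ab, ‖v ab‖ ≤ t) {l : ℝ} (hl : 0 < l) (hP : l ≤ P.minEigenvalue)
    (hQ : l ≤ Q.minEigenvalue) :
    traceNorm (reconstruct P Q v) ≤ √(d * e) * (d * e) * t / l := by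
  refine (traceNorm_le_sqrt_card_mul _).trans ?_
  have h1 : ∑ ab, ‖v ab‖ ^ 2 ≤ ((d * e) * t) ^ 2 := by
    refine (Finset.sum_le_card_nsmul Finset.univ _ (t ^ 2) fun ab _ =>
      pow_le_pow_left₀ (norm_nonneg _) (hv ab) 2).trans (le_of_eq ?_)
    simp
    ring
  have h2 : P.minEigenvalue⁻¹ * Q.minEigenvalue⁻¹ ≤ (l⁻¹) ^ 2 := by
    rw [sq]
    have := P.minEigenvalue_pos
    have := Q.minEigenvalue_pos
    gcongr
  have h3 : √(∑ x, ∑ x', ‖reconstruct P Q v x x'‖ ^ 2) ≤ l⁻¹ * ((d * e) * t) := by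
    refine Real.sqrt_le_iff.mpr ⟨by positivity, ?_⟩
    rw [mul_pow]
    refine (sum_norm_sq_reconstruct_le P Q v).trans ?_
    exact mul_le_mul h2 h1 (Finset.sum_nonneg fun _ _ => by positivity) (by positivity)
  calc _ ≤ √(Fintype.card (Fin d × Fin e)) * (l⁻¹ * ((d * e) * t)) := by gcongr
    _ = _ := by
      rw [Fintype.card_prod, Fintype.card_fin, Fintype.card_fin]
      push_cast
      ring

end Reconstruct

/-! ### Values and step counts of timed computations -/

namespace Timed

variable {α β ι s : Type}

theorem bind_val (x : Timed α) (f : α → Timed β) : (x >>= f).val = (f x.val).val := rfl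

theorem bind_time (x : Timed α) (f : α → Timed β) :
    (x >>= f).time = x.time + (f x.val).time := rfl

theorem pure_val (x : α) : (pure x : Timed α).val = x := rfl

theorem pure_time (x : α) : (pure x : Timed α).time = 0 := rfl

theorem op_val (x : α) : (op x).val = x := rfl

theorem op_time (x : α) : (op x).time = 1 := rfl

theorem table_time [Fintype ι] (f : ι → Timed α) : (table f).time = ∑ i, ((f i).time + 1) := rfl

theorem sum_time [Fintype ι] (f : ι → Timed ℂ) : (sum f).time = ∑ i, ((f i).time + 1) := rfl

theorem forLoop_cons_val (f : s → ι → Timed s) (x : s) (i : ι) (l : List ι) :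
    (forLoop f x (i :: l)).val = (forLoop f (f x i).val l).val := rfl

theorem forLoop_time_le {f : s → ι → Timed s} {c : ℕ} (h : ∀ x i, (f x i).time ≤ c) (x : s)
    (l : List ι) : (forLoop f x l).time ≤ l.length * (c + 1) := by
  induction l generalizing x with
  | nil => simp [forLoop, pure_time]
  | cons i l ih =>
    have h1 : (forLoop f x (i :: l)).time =
        1 + ((f x i).time + (forLoop f (f x i).val l).time) := rfl
    have h2 := h x i
    have h3 := ih (f x i).val
    rw [h1, List.length_cons, Nat.add_mul]
    omega

theorem findFirst_val (p : ι → Bool) (l : List ι) : (findFirst p l).val = l.find? p := by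
  induction l with
  | nil => rfl
  | cons i l ih =>
    rw [findFirst, bind_val, op_val]
    by_cases h : p i
    · rw [if_pos h, pure_val, List.find?_cons_of_pos h]
    · rw [if_neg h, ih, List.find?_cons_of_neg h]

theorem findFirst_time_le (p : ι → Bool) (l : List ι) : (findFirst p l).time ≤ l.length := by
  induction l with
  | nil => exact le_rfl
  | cons i l ih =>
    rw [findFirst, bind_time, op_time, op_val, List.length_cons]
    by_cases h : p i
    · rw [if_pos h, pure_time]; omega
    · rw [if_neg h]; omega

end Timed

/-! ### Correctness and cost of the greedy matching -/

section Matching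

variable {n : ℕ}

/-- The arrays of matched inputs and outputs agree with the assignment, which is injective. -/
structure MatchState.Valid (s : MatchState n) : Prop where
  matchedA_iff : ∀ i, s.matchedA i = true ↔ ∃ j, s.assign i = some j
  matchedB_iff : ∀ j, s.matchedB j = true ↔ ∃ i, s.assign i = some j
  injective : ∀ i i' j, s.assign i = some j → s.assign i' = some j → i = i'

theorem MatchState.Valid.record {s : MatchState n} (hs : s.Valid) {i j : Fin n}
    (hi : s.assign i = none) (hj : ¬ ∃ i, s.assign i = some j) : (s.record i j).Valid := by
  constructor
  · intro k
    by_cases h : k = i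
    · subst h; simp [MatchState.record]
    · simp [MatchState.record, Function.update_of_ne h, hs.matchedA_iff]
  · intro k
    by_cases h : k = j
    · subst h
      simp only [MatchState.record, Function.update_self, true_iff]
      exact ⟨i, Function.update_self _ _ _⟩
    · simp only [MatchState.record, Function.update_of_ne h, hs.matchedB_iff]
      refine exists_congr fun l => ?_
      by_cases hl : l = i
      · subst hl; simp [hi, Ne.symm h]
      · rw [Function.update_of_ne hl]
  · intro k k' l hk hk'
    simp only [MatchState.record] at hk hk'
    by_cases h : k = i <;> by_cases h' : k' = i
    · rw [h, h']
    · subst h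
      rw [Function.update_self, Option.some.injEq] at hk
      rw [Function.update_of_ne h'] at hk'
      exact absurd ⟨k', hk ▸ hk'⟩ hj
    · subst h'
      rw [Function.update_self, Option.some.injEq] at hk'
      rw [Function.update_of_ne h] at hk
      exact absurd ⟨k, hk' ▸ hk⟩ hj
    · rw [Function.update_of_ne h] at hk
      rw [Function.update_of_ne h'] at hk'
      exact hs.injective _ _ _ hk hk'

theorem MatchState.record_assign_of_some {s : MatchState n} {i j k l : Fin n}
    (hi : s.assign i = none) (hk : s.assign k = some l) : (s.record i j).assign k = some l := by
  have : k ≠ i := fun h => by rw [h, hi] at hk; simp at hk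
  rw [MatchState.record]
  simpa [Function.update_of_ne this] using hk

theorem matchCorrelated_val (ind : Fin n × Fin n → Bool) (s : MatchState n) (i : Fin n) :
    (matchCorrelated ind s i).val =
      match (List.finRange n).find? (fun j => !ind (i, j)) with
      | some j => s.record i j
      | none => s := by
  rw [matchCorrelated, Timed.bind_val, Timed.findFirst_val]
  cases (List.finRange n).find? (fun j => !ind (i, j)) <;> rfl

theorem matchRest_val (s : MatchState n) (i : Fin n) :
    (matchRest s i).val = if s.matchedA i then s else
      match (List.finRange n).find? (fun j => !s.matchedB j) with
      | some j => s.record i j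
      | none => s := by
  rw [matchRest, Timed.bind_val, Timed.op_val]
  split
  · rfl
  · rw [Timed.bind_val, Timed.findFirst_val]
    cases (List.finRange n).find? (fun j => !s.matchedB j) <;> rfl

/-- The invariant is that every recorded edge lies on the graph of `τ`. The first failing output for
`i` can only be `τ i`, and by injectivity of `τ` no other input has taken it. -/
theorem matchCorrelated_loop (τ : Equiv.Perm (Fin n)) {ind : Fin n × Fin n → Bool}
    (h : ∀ i j, j ≠ τ i → ind (i, j) = true) (l : List (Fin n)) (s : MatchState n)
    (hl : l.Nodup) (hs : s.Valid) (hτ : ∀ i j, s.assign i = some j → j = τ i)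
    (h0 : ∀ i ∈ l, s.assign i = none) :
    (Timed.forLoop (matchCorrelated ind) s l).val.Valid ∧
      (∀ i j, s.assign i = some j →
        (Timed.forLoop (matchCorrelated ind) s l).val.assign i = some j) ∧
      ∀ i ∈ l, ind (i, τ i) = false →
        (Timed.forLoop (matchCorrelated ind) s l).val.assign i = some (τ i) := by
  induction l generalizing s with
  | nil => exact ⟨hs, fun _ _ h => h, by simp⟩
  | cons i l ih =>
    rw [Timed.forLoop_cons_val, matchCorrelated_val]
    obtain ⟨hi, hl⟩ := List.nodup_cons.mp hl
    have hi0 := h0 i (by simp)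
    rcases hf : (List.finRange n).find? (fun j => !ind (i, j)) with _ | j
    · obtain ⟨h1, h2, h3⟩ := ih s hl hs hτ fun k hk => h0 k (by simp [hk])
      refine ⟨h1, h2, fun k hk hind => ?_⟩
      rcases List.mem_cons.mp hk with rfl | hk
      · have := List.find?_eq_none.mp hf (τ k) (List.mem_finRange _)
        simp [hind] at this
      · exact h3 k hk hind
    · have hj : j = τ i := by
        by_contra hne
        have := List.find?_some hf
        simp [h i j hne] at this
      subst hj
      have hfree : ¬ ∃ k, s.assign k = some (τ i) := by
        rintro ⟨k, hk⟩
        have := τ.injective (hτ _ _ hk)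
        rw [← this, hi0] at hk
        simp at hk
      obtain ⟨h1, h2, h3⟩ := ih (s.record i (τ i)) hl (hs.record hi0 hfree) (by
          intro k m hk
          by_cases hki : k = i
          · subst hki
            simpa [MatchState.record, eq_comm] using hk
          · exact hτ k m (by simpa [MatchState.record, Function.update_of_ne hki] using hk))
        (by
          intro k hk
          have hki : k ≠ i := fun h => hi (h ▸ hk)
          simpa [MatchState.record, Function.update_of_ne hki] using h0 k (by simp [hk]))
      refine ⟨h1, fun k m hk => h2 k m (MatchState.record_assign_of_some hi0 hk),
        fun k hk hind => ?_⟩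
      rcases List.mem_cons.mp hk with rfl | hk
      · exact h2 _ _ (by simp [MatchState.record])
      · exact h3 k hk hind

theorem matchRest_loop (l : List (Fin n)) (s : MatchState n) (hs : s.Valid) :
    (Timed.forLoop matchRest s l).val.Valid ∧
      (∀ i j, s.assign i = some j → (Timed.forLoop matchRest s l).val.assign i = some j) ∧
      ∀ i ∈ l, ∃ j, (Timed.forLoop matchRest s l).val.assign i = some j := by
  induction l generalizing s with
  | nil => exact ⟨hs, fun _ _ h => h, by simp⟩
  | cons i l ih =>
    rw [Timed.forLoop_cons_val, matchRest_val]
    split_ifs with hA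
    · obtain ⟨h1, h2, h3⟩ := ih s hs
      refine ⟨h1, h2, fun k hk => ?_⟩
      rcases List.mem_cons.mp hk with rfl | hk
      · obtain ⟨j, hj⟩ := (hs.matchedA_iff k).mp hA
        exact ⟨j, h2 _ _ hj⟩
      · exact h3 k hk
    · have hi0 : s.assign i = none := by
        rw [hs.matchedA_iff] at hA
        by_contra hne
        exact hA (Option.ne_none_iff_exists'.mp hne)
      rcases hf : (List.finRange n).find? (fun j => !s.matchedB j) with _ | j
      · exfalso
        have hall : ∀ j, ∃ k, s.assign k = some j := fun j => by
          have := List.find?_eq_none.mp hf j (List.mem_finRange _)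
          exact (hs.matchedB_iff j).mp (by simpa using this)
        choose g hg using hall
        have hinj : Function.Injective g := fun j j' hjj => by
          have := hg j
          rw [hjj, hg j'] at this
          exact (Option.some.inj this).symm
        obtain ⟨j, hj⟩ := Finite.surjective_of_injective hinj i
        have := hg j
        rw [hj, hi0] at this
        simp at this
      · have hfree : ¬ ∃ k, s.assign k = some j := by
          have := List.find?_some hf
          rw [← hs.matchedB_iff]
          simpa using this
        obtain ⟨h1, h2, h3⟩ := ih (s.record i j) (hs.record hi0 hfree)
        refine ⟨h1, fun k m hk => h2 k m (MatchState.record_assign_of_some hi0 hk),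
          fun k hk => ?_⟩
        rcases List.mem_cons.mp hk with rfl | hk
        · exact ⟨j, h2 _ _ (by simp [MatchState.record])⟩
        · exact h3 k hk

/-- If all pairs outside the graph of a permutation `τ` pass the independence test, the matching is
a permutation that agrees with `τ` wherever the test fails. -/
theorem matching_spec (τ : Equiv.Perm (Fin n)) {ind : Fin n × Fin n → Bool}
    (h : ∀ i j, j ≠ τ i → ind (i, j) = true) :
    ∃ π : Equiv.Perm (Fin n), (∀ i, (matching ind).val i = some (π i)) ∧
      ∀ i, ind (i, τ i) = false → π i = τ i := by
  let s0 : MatchState n := ⟨fun _ => none, fun _ => false, fun _ => false⟩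
  have h0 : s0.Valid := ⟨by simp [s0], by simp [s0], by simp [s0]⟩
  obtain ⟨v1, -, c1⟩ := matchCorrelated_loop τ h (List.finRange n) s0 (List.nodup_finRange n) h0
    (by simp [s0]) (by simp [s0])
  obtain ⟨v2, e2, t2⟩ := matchRest_loop (List.finRange n) _ v1
  have hval : (matching ind).val = (Timed.forLoop matchRest
    (Timed.forLoop (matchCorrelated ind) s0 (List.finRange n)).val (List.finRange n)).val.assign :=
    rfl
  rw [← hval] at e2 t2
  choose f hf using fun i => t2 i (List.mem_finRange i)
  have hinj : Function.Injective f := fun i i' hii => by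
    refine v2.injective i i' (f i) ?_ ?_
    · rw [← hval]; exact hf i
    · rw [← hval, hii]; exact hf i'
  refine ⟨Equiv.ofBijective f (Finite.injective_iff_bijective.mp hinj), hf, fun i hi => ?_⟩
  have := e2 i (τ i) (c1 i (List.mem_finRange i) hi)
  rw [hf i] at this
  exact Option.some.inj this

theorem matching_time_le (ind : Fin n × Fin n → Bool) : (matching ind).time ≤ 13 * n ^ 2 := by
  have h1 : ∀ s i, (matchCorrelated ind s i).time ≤ n + 1 := by
    intro s i
    have := Timed.findFirst_time_le (fun j => !ind (i, j)) (List.finRange n)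
    rw [List.length_finRange] at this
    rw [matchCorrelated, Timed.bind_time]
    split
    · rw [Timed.op_time]; omega
    · rw [Timed.pure_time]; omega
  have h2 : ∀ (s : MatchState n) i, (matchRest s i).time ≤ n + 2 := by
    intro s i
    have := Timed.findFirst_time_le (fun j => !s.matchedB j) (List.finRange n)
    rw [List.length_finRange] at this
    rw [matchRest, Timed.bind_time, Timed.op_time, Timed.op_val]
    split
    · rw [Timed.pure_time]; omega
    · rw [Timed.bind_time]
      split
      · rw [Timed.op_time]; omega
      · rw [Timed.pure_time]; omega
  simp only [matching, Timed.bind_time, Timed.table_time, Timed.op_time, Timed.pure_time,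
    Finset.sum_const, Finset.card_univ, Fintype.card_fin, smul_eq_mul]
  have h3 := Timed.forLoop_time_le h1
    ⟨(Timed.table fun _ : Fin n => Timed.op (none : Option (Fin n))).val,
      (Timed.table fun _ : Fin n => Timed.op false).val,
      (Timed.table fun _ : Fin n => Timed.op false).val⟩ (List.finRange n)
  have h4 := Timed.forLoop_time_le h2 (Timed.forLoop (matchCorrelated ind)
    ⟨(Timed.table fun _ : Fin n => Timed.op (none : Option (Fin n))).val,
      (Timed.table fun _ : Fin n => Timed.op false).val,
      (Timed.table fun _ : Fin n => Timed.op false).val⟩ (List.finRange n)).val (List.finRange n)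
  rw [List.length_finRange] at h3 h4
  -- The exact count of table and loop bounds is `2 n² + 11 n`.
  have h5 : n ≤ n ^ 2 := Nat.le_self_pow (by norm_num) n
  nlinarith

end Matching

/-! ### Step counts of the classical part and of a round -/

section Time

theorem estimateChi1_time_le {cost : CostModel} {c : ℕ} (hc : cost.BoundedBy c) {d e : ℕ}
    [NeZero d] [NeZero e] (P : ICPOVM d) (Q : ICPOVM e)
    (data : List (Fin (d ^ 2) × Fin (e ^ 2))) :
    (estimateChi1 cost P Q data).time ≤ 2 * data.length + (13 + c) * (d * e) ^ 4 := by
  have hloop := Timed.forLoop_time_le (f := fun (p : Fin (d ^ 2) × Fin (e ^ 2) → ℝ) ab =>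
    Timed.op (Function.update p ab (p ab + 1 / (data.length : ℝ)))) (c := 1) (fun _ _ => le_rfl)
    (Timed.table fun _ : Fin (d ^ 2) × Fin (e ^ 2) => Timed.op (0 : ℝ)).val data
  have hcost := hc.traceNorm_le (d * e)
  simp only [estimateChi1, Timed.bind_time, Timed.table_time, Timed.sum_time, Timed.op_time,
    Finset.sum_const, Finset.card_univ, Fintype.card_prod, Fintype.card_fin, smul_eq_mul]
  have hd : 1 ≤ d := NeZero.one_le
  have he : 1 ≤ e := NeZero.one_le
  have hde : 1 ≤ d * e := Nat.mul_pos hd he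
  have h2 : d ^ 2 * e ^ 2 ≤ (d * e) ^ 4 := by
    rw [← mul_pow]; exact Nat.pow_le_pow_right hde (by norm_num)
  have h4 : d ^ 2 * e ^ 2 * (d ^ 2 * e ^ 2) = (d * e) ^ 4 := by ring
  have hA : d * d * e ≤ d ^ 2 * e ^ 2 := by
    calc d * d * e = d ^ 2 * (e * 1) := by ring
      _ ≤ d ^ 2 * (e * e) := by gcongr
      _ = _ := by ring
  have hA' : d * d ≤ d ^ 2 * e ^ 2 := by
    calc d * d = d ^ 2 * 1 := by ring
      _ ≤ d ^ 2 * e ^ 2 := by gcongr; exact Nat.one_le_pow _ _ he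
  have hB : e * e * d ≤ d ^ 2 * e ^ 2 := by
    calc e * e * d = e ^ 2 * (d * 1) := by ring
      _ ≤ e ^ 2 * (d * d) := by gcongr
      _ = _ := by ring
  have hB' : e * e ≤ d ^ 2 * e ^ 2 := by
    calc e * e = 1 * e ^ 2 := by ring
      _ ≤ d ^ 2 * e ^ 2 := by gcongr; exact Nat.one_le_pow _ _ hd
  have e1 : d * d * (e * e) = d ^ 2 * e ^ 2 := by ring
  have e2 : d * d * (e * e) * (d ^ 2 * e ^ 2 * (1 + 1) + 1) =
    2 * (d * e) ^ 4 + d ^ 2 * e ^ 2 := by ring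
  -- The reconstruction table contributes `2 (d e)⁴`. All other tables together contribute at most
  -- `11 d² e²`, whence the constant `13`.
  rw [e2, e1]
  nlinarith

theorem discover_time_le {cost : CostModel} {c : ℕ} (hc : cost.BoundedBy c) {n : ℕ}
    {dA dB : Fin n → ℕ} [∀ i, NeZero (dA i)] [∀ j, NeZero (dB j)] (P : ∀ i, ICPOVM (dA i))
    (Q : ∀ j, ICPOVM (dB j)) (threshold : ℝ) (data : List (Round dA dB)) :
    (do
      let ind ← independenceTable cost P Q threshold data
      matching ind : Timed (Fin n → Option (Fin n))).time ≤
      n ^ 2 * (2 * data.length + (13 + c) * (maxDim dA * maxDim dB) ^ 4 + 15) := by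
  rw [Timed.bind_time, independenceTable, Timed.table_time]
  have h1 := matching_time_le (Timed.table fun ij : Fin n × Fin n => do
    let x ← estimateChi1 cost (P ij.1) (Q ij.2) (data.map fun r => (r.1 ij.1, r.2 ij.2))
    Timed.op (decide (x ≤ threshold))).val
  have h2 : ∀ ij : Fin n × Fin n, ij ∈ Finset.univ → ((do
      let x ← estimateChi1 cost (P ij.1) (Q ij.2) (data.map fun r => (r.1 ij.1, r.2 ij.2))
      Timed.op (decide (x ≤ threshold)) : Timed Bool).time + 1) ≤
      2 * data.length + (13 + c) * (maxDim dA * maxDim dB) ^ 4 + 2 := by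
    intro ij _
    rw [Timed.bind_time, Timed.op_time]
    have h3 := estimateChi1_time_le hc (P ij.1) (Q ij.2)
      (data.map fun r => (r.1 ij.1, r.2 ij.2))
    rw [List.length_map] at h3
    have h4 : dA ij.1 * dB ij.2 ≤ maxDim dA * maxDim dB :=
      Nat.mul_le_mul (Finset.le_sup (f := dA) (Finset.mem_univ _))
        (Finset.le_sup (f := dB) (Finset.mem_univ _))
    have h5 := Nat.mul_le_mul_left (13 + c) (Nat.pow_le_pow_left h4 4)
    omega
  have h3 := Finset.sum_le_card_nsmul _ _ _ h2
  rw [Finset.card_univ, Fintype.card_prod, Fintype.card_fin, smul_eq_mul] at h3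
  have h4 := Nat.add_le_add h3 h1
  refine h4.trans (le_of_eq ?_)
  ring

/-- Steps of one round. -/
def roundSteps {n : ℕ} (cost : CostModel) (dA dB : Fin n → ℕ) : ℕ :=
  ∑ i, cost.draw (dA i ^ 2) + (∑ i, cost.prepare (dA i) + ∑ j, cost.povm (dB j ^ 2))

theorem roundSteps_le {cost : CostModel} {c : ℕ} (hc : cost.BoundedBy c) {n : ℕ}
    (dA dB : Fin n → ℕ) [∀ i, NeZero (dA i)] :
    roundSteps cost dA dB ≤ 4 * c * n * (maxDim dA + maxDim dB ^ 4) := by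
  have hA : ∀ i, dA i ≤ maxDim dA := fun i => Finset.le_sup (f := dA) (Finset.mem_univ _)
  have hB : ∀ i, dB i ≤ maxDim dB := fun i => Finset.le_sup (f := dB) (Finset.mem_univ _)
  have h1 : ∀ i ∈ Finset.univ, cost.draw (dA i ^ 2) ≤ 3 * c * maxDim dA := fun i _ => by
    have h := hc.draw_le (dA i ^ 2)
    -- The crude estimate `d ≤ 2 ^ d` suffices, since state preparation is already charged linearly
    -- in `d`.
    have hlog : Nat.log 2 (dA i ^ 2) ≤ 2 * dA i := by
      calc Nat.log 2 (dA i ^ 2) ≤ Nat.log 2 (2 ^ (dA i * 2)) := by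
            apply Nat.log_mono_right
            rw [pow_mul]
            exact Nat.pow_le_pow_left (Nat.lt_two_pow_self).le 2
        _ = 2 * dA i := by rw [Nat.log_pow (by norm_num), mul_comm]
    have hd : 1 ≤ dA i := NeZero.one_le
    calc _ ≤ c * (Nat.log 2 (dA i ^ 2) + 1) := h
      _ ≤ c * (3 * maxDim dA) := Nat.mul_le_mul_left _ (by have := hA i; omega)
      _ = _ := by ring
  have h2 : ∀ i ∈ Finset.univ, cost.prepare (dA i) ≤ c * maxDim dA := fun i _ =>
    (hc.prepare_le _).trans (Nat.mul_le_mul_left _ (hA i))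
  have h3 : ∀ j ∈ Finset.univ, cost.povm (dB j ^ 2) ≤ c * maxDim dB ^ 4 := fun j _ => by
    refine (hc.povm_le _).trans (Nat.mul_le_mul_left _ ?_)
    rw [← pow_mul]
    exact Nat.pow_le_pow_left (hB j) _
  have s1 := Finset.sum_le_card_nsmul _ _ _ h1
  have s2 := Finset.sum_le_card_nsmul _ _ _ h2
  have s3 := Finset.sum_le_card_nsmul _ _ _ h3
  rw [Finset.card_univ, Fintype.card_fin, smul_eq_mul] at s1 s2 s3
  rw [roundSteps]
  nlinarith [Nat.zero_le (c * n * maxDim dB ^ 4)]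

end Time

/-! ### Chernoff bounds for empirical frequencies -/

section Concentration

variable {α β : Type}

/-- The law of a list of `N` independent samples. -/
def iidList (q : PMF α) : ℕ → PMF (List α)
  | 0 => PMF.pure []
  | N + 1 => q.bind fun r => (iidList q N).map (r :: ·)

/-- Expectations are written as sums in `ENNReal`, so that the order of summation may be exchanged
without any summability condition. -/
theorem tsum_bind_mul (p : PMF α) (f : α → PMF β) (g : β → ENNReal) :
    ∑' b, (p.bind f) b * g b = ∑' a, p a * ∑' b, f a b * g b := by
  simp only [PMF.bind_apply, ← ENNReal.tsum_mul_right, ← ENNReal.tsum_mul_left]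
  rw [ENNReal.tsum_comm]
  simp only [mul_assoc]

theorem tsum_pure_mul (a : α) (g : α → ENNReal) : ∑' b, (PMF.pure a) b * g b = g a := by
  rw [tsum_eq_single a]
  · simp
  · intro b hb
    simp [hb]

theorem tsum_map_mul (p : PMF α) (f : α → β) (g : β → ENNReal) :
    ∑' b, (p.map f) b * g b = ∑' a, p a * g (f a) := by
  rw [PMF.map, tsum_bind_mul]
  simp only [Function.comp_apply, tsum_pure_mul]

/-- Markov's inequality, in the form used for the exponential moment. -/
theorem toOuterMeasure_le_tsum (p : PMF α) {s : Set α} {g : α → ENNReal}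
    (h : ∀ x ∈ s, 1 ≤ g x) : p.toOuterMeasure s ≤ ∑' x, p x * g x := by
  rw [PMF.toOuterMeasure_apply]
  refine ENNReal.tsum_le_tsum fun x => ?_
  by_cases hx : x ∈ s
  · rw [Set.indicator_of_mem hx]
    calc p x = p x * 1 := (mul_one _).symm
      _ ≤ p x * g x := by gcongr; exact h x hx
  · rw [Set.indicator_of_notMem hx]
    exact zero_le

theorem toOuterMeasure_add_compl (p : PMF α) (s : Set α) :
    p.toOuterMeasure s + p.toOuterMeasure sᶜ = 1 := by
  rw [PMF.toOuterMeasure_apply, PMF.toOuterMeasure_apply, ← ENNReal.tsum_add, ← p.tsum_coe]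
  refine tsum_congr fun x => ?_
  exact congrFun (Set.indicator_self_add_compl s p) x

theorem toOuterMeasure_le_one (p : PMF α) (s : Set α) : p.toOuterMeasure s ≤ 1 := by
  rw [← toOuterMeasure_add_compl p s]
  exact le_self_add

/-- The moment generating function of a centred Bernoulli variable. Apply `exp x ≤ 1 + x + x ^ 2`
for `|x| ≤ 1` to both values; the linear terms cancel because the mean is zero. -/
theorem exp_mixture_le {m s : ℝ} (h0 : 0 ≤ m) (h1 : m ≤ 1) (hs : |s| ≤ 1) :
    m * Real.exp (s * (1 - m)) + (1 - m) * Real.exp (s * (0 - m)) ≤ Real.exp (s ^ 2) := by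
  have key : ∀ x : ℝ, |x| ≤ 1 → Real.exp (s * x) ≤ 1 + s * x + s ^ 2 := by
    intro x hx
    have hsx : |s * x| ≤ 1 := by
      rw [abs_mul]; exact mul_le_one₀ hs (abs_nonneg _) hx
    have h := (abs_le.mp (Real.abs_exp_sub_one_sub_id_le hsx)).2
    have h2 : (s * x) ^ 2 ≤ s ^ 2 := by
      rw [mul_pow]
      have : x ^ 2 ≤ 1 := by rw [← sq_abs]; exact pow_le_one₀ (abs_nonneg _) hx
      nlinarith [sq_nonneg s]
    linarith
  have e1 := key (1 - m) (by rw [abs_le]; constructor <;> linarith)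
  have e2 := key (0 - m) (by rw [abs_le]; constructor <;> linarith)
  have e3 := Real.add_one_le_exp (s ^ 2)
  nlinarith [mul_le_mul_of_nonneg_left e1 h0, mul_le_mul_of_nonneg_left e2 (sub_nonneg.mpr h1)]

variable (q : PMF α) (E : α → Bool)

/-- The probability of an event, as a real number. -/
def prob : ℝ := (q.toOuterMeasure {x | E x = true}).toReal

theorem prob_nonneg : 0 ≤ prob q E := ENNReal.toReal_nonneg

theorem prob_le_one : prob q E ≤ 1 :=
  ENNReal.toReal_le_of_le_ofReal zero_le_one (by simpa using toOuterMeasure_le_one q _)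

theorem tsum_exp_indicator_le {s : ℝ} (hs : |s| ≤ 1) :
    ∑' x, q x * ENNReal.ofReal (Real.exp (s * ((if E x then 1 else 0) - prob q E))) ≤
      ENNReal.ofReal (Real.exp (s ^ 2)) := by
  have h1 : q.toOuterMeasure {x | E x = true} = ENNReal.ofReal (prob q E) :=
    (ENNReal.ofReal_toReal (ne_top_of_le_ne_top ENNReal.one_ne_top
      (toOuterMeasure_le_one q _))).symm
  have h2 : q.toOuterMeasure {x | E x = true}ᶜ = ENNReal.ofReal (1 - prob q E) := by
    have h := toOuterMeasure_add_compl q {x | E x = true}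
    rw [ENNReal.ofReal_sub _ (prob_nonneg q E), ← h1, ENNReal.ofReal_one, ← h,
      ENNReal.add_sub_cancel_left (ne_top_of_le_ne_top ENNReal.one_ne_top
      (toOuterMeasure_le_one q _))]
  have h3 : ∑' x, q x * ENNReal.ofReal (Real.exp (s * ((if E x then 1 else 0) - prob q E))) =
      q.toOuterMeasure {x | E x = true} * ENNReal.ofReal (Real.exp (s * (1 - prob q E))) +
      q.toOuterMeasure {x | E x = true}ᶜ * ENNReal.ofReal (Real.exp (s * (0 - prob q E))) := by
    rw [PMF.toOuterMeasure_apply, PMF.toOuterMeasure_apply, ← ENNReal.tsum_mul_right,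
      ← ENNReal.tsum_mul_right, ← ENNReal.tsum_add]
    refine tsum_congr fun x => ?_
    by_cases hx : E x = true
    · simp [Set.indicator, hx]
    · simp [Set.indicator, hx]
  have p0 := prob_nonneg q E
  have p1 := prob_le_one q E
  rw [h3, h1, h2, ← ENNReal.ofReal_mul p0, ← ENNReal.ofReal_mul (sub_nonneg.mpr p1),
    ← ENNReal.ofReal_add (by positivity) (mul_nonneg (sub_nonneg.mpr p1) (Real.exp_nonneg _))]
  exact ENNReal.ofReal_le_ofReal (exp_mixture_le p0 p1 hs)

theorem iidList_mgf_le {s : ℝ} (hs : |s| ≤ 1) (N : ℕ) :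
    ∑' l, iidList q N l * ENNReal.ofReal (Real.exp (s * (l.countP E - N * prob q E))) ≤
      ENNReal.ofReal (Real.exp (N * s ^ 2)) := by
  induction N with
  | zero => simp [iidList]
  | succ N ih =>
    have hstep : ∀ (r : α) (l : List α),
        ENNReal.ofReal (Real.exp (s * ((r :: l).countP E - (N + 1 : ℕ) * prob q E))) =
          ENNReal.ofReal (Real.exp (s * (l.countP E - N * prob q E))) *
          ENNReal.ofReal (Real.exp (s * ((if E r then 1 else 0) - prob q E))) := by
      intro r l
      rw [← ENNReal.ofReal_mul (Real.exp_nonneg _), ← Real.exp_add, List.countP_cons]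
      congr 2
      push_cast
      ring
    simp only [iidList, tsum_bind_mul, tsum_map_mul, hstep]
    simp only [← mul_assoc, ENNReal.tsum_mul_right]
    calc _ ≤ ∑' r, q r * ENNReal.ofReal (Real.exp (N * s ^ 2)) *
          ENNReal.ofReal (Real.exp (s * ((if E r then 1 else 0) - prob q E))) := by
          refine ENNReal.tsum_le_tsum fun r => ?_
          rw [mul_assoc, mul_assoc]
          gcongr
      _ = ENNReal.ofReal (Real.exp (N * s ^ 2)) *
          ∑' r, q r * ENNReal.ofReal (Real.exp (s * ((if E r then 1 else 0) - prob q E))) := by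
          rw [← ENNReal.tsum_mul_left]
          refine tsum_congr fun r => ?_
          ring
      _ ≤ ENNReal.ofReal (Real.exp (N * s ^ 2)) * ENNReal.ofReal (Real.exp (s ^ 2)) := by
          gcongr
          exact tsum_exp_indicator_le q E hs
      _ = _ := by
          rw [← ENNReal.ofReal_mul (Real.exp_nonneg _), ← Real.exp_add]
          congr 2
          push_cast
          ring

theorem length_of_mem_support_iidList {N : ℕ} {l : List α} (h : l ∈ (iidList q N).support) :
    l.length = N := by
  induction N generalizing l with
  | zero =>
    simp only [iidList, PMF.support_pure, Set.mem_singleton_iff] at h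
    rw [h, List.length_nil]
  | succ N ih =>
    simp only [iidList, PMF.mem_support_bind_iff, PMF.support_map, Set.mem_image] at h
    obtain ⟨r, -, l', hl', rfl⟩ := h
    rw [List.length_cons, ih hl']

/-- Chernoff's bound for both tails, the sign of `s` selecting the tail. The choice `|s| = t / 2`
minimises `N s ^ 2 - |s| N t`, with value `-N t ^ 2 / 4`. -/
theorem iidList_tail_le {N : ℕ} {t s : ℝ} (hs : |s| ≤ 1) (hst : |s| = t / 2) :
    (iidList q N).toOuterMeasure {l | |s| * (N * t) ≤ s * (l.countP E - N * prob q E)} ≤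
      ENNReal.ofReal (Real.exp (-(N * t ^ 2 / 4))) := by
  calc _ ≤ ∑' l, iidList q N l * (ENNReal.ofReal (Real.exp (s * (l.countP E - N * prob q E))) *
        ENNReal.ofReal (Real.exp (-(|s| * (N * t))))) := by
        refine toOuterMeasure_le_tsum _ fun l hl => ?_
        rw [← ENNReal.ofReal_mul (Real.exp_nonneg _), ← Real.exp_add, ← ENNReal.ofReal_one]
        refine ENNReal.ofReal_le_ofReal (Real.one_le_exp ?_)
        have : |s| * (N * t) ≤ s * (l.countP E - N * prob q E) := hl
        linarith
    _ = (∑' l, iidList q N l * ENNReal.ofReal (Real.exp (s * (l.countP E - N * prob q E)))) *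
        ENNReal.ofReal (Real.exp (-(|s| * (N * t)))) := by
        rw [← ENNReal.tsum_mul_right]
        exact tsum_congr fun l => by ring
    _ ≤ ENNReal.ofReal (Real.exp (N * s ^ 2)) * ENNReal.ofReal (Real.exp (-(|s| * (N * t)))) := by
        gcongr
        exact iidList_mgf_le q E hs N
    _ = _ := by
        rw [← ENNReal.ofReal_mul (Real.exp_nonneg _), ← Real.exp_add, ← sq_abs s, hst]
        congr 2
        ring

/-- The empirical frequency of an event. -/
def freq (l : List α) : ℝ := l.countP E / l.length

theorem freq_nonneg (l : List α) : 0 ≤ freq E l := by rw [freq]; positivity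

theorem freq_le_one (l : List α) : freq E l ≤ 1 := by
  rw [freq]
  exact div_le_one_of_le₀ (by exact_mod_cast List.countP_le_length) (Nat.cast_nonneg _)

/-- Concentration of empirical frequencies. -/
theorem iidList_freq_le {N : ℕ} (hN : 0 < N) {t : ℝ} (ht : 0 ≤ t) :
    (iidList q N).toOuterMeasure {l | t < |freq E l - prob q E|} ≤
      ENNReal.ofReal (2 * Real.exp (-(N * t ^ 2 / 4))) := by
  rcases le_total t 1 with ht1 | ht1
  · have hN' : (0 : ℝ) < N := by exact_mod_cast hN
    have a1 : |t / 2| = t / 2 := abs_of_nonneg (by linarith)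
    have a2 : |-(t / 2)| = t / 2 := by rw [abs_neg, a1]
    -- `freq` divides by the length of the list, which equals `N` only on the support of the law.
    have hsub : {l | t < |freq E l - prob q E|} ∩ (iidList q N).support ⊆
        {l | |t / 2| * (N * t) ≤ (t / 2) * (l.countP E - N * prob q E)} ∪
        {l | |-(t / 2)| * (N * t) ≤ (-(t / 2)) * (l.countP E - N * prob q E)} := by
      rintro l ⟨hl, hsupp⟩
      have hlen := length_of_mem_support_iidList q hsupp
      have hl' : t < |freq E l - prob q E| := hl
      have e : freq E l - prob q E = (l.countP E - N * prob q E) / N := by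
        rw [freq, hlen]; field_simp
      rw [e, abs_div, abs_of_pos hN', lt_div_iff₀ hN'] at hl'
      simp only [Set.mem_union, Set.mem_ofPred_eq, a1, a2]
      rcases le_total 0 ((l.countP E : ℝ) - N * prob q E) with h | h
      · left
        rw [abs_of_nonneg h] at hl'
        exact mul_le_mul_of_nonneg_left (by linarith) (by linarith)
      · right
        rw [abs_of_nonpos h] at hl'
        have := mul_le_mul_of_nonneg_left (a := t / 2) (by linarith :
          (N : ℝ) * t ≤ -((l.countP E : ℝ) - N * prob q E)) (by linarith)
        linarith
    calc _ = (iidList q N).toOuterMeasure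
          ({l | t < |freq E l - prob q E|} ∩ (iidList q N).support) :=
          ((iidList q N).toOuterMeasure_apply_inter_support _).symm
      _ ≤ _ := (iidList q N).toOuterMeasure.mono hsub
      _ ≤ _ := MeasureTheory.measure_union_le _ _
      _ ≤ ENNReal.ofReal (Real.exp (-(N * t ^ 2 / 4))) +
          ENNReal.ofReal (Real.exp (-(N * t ^ 2 / 4))) :=
          add_le_add (iidList_tail_le q E (by rw [a1]; linarith) a1)
            (iidList_tail_le q E (by rw [a2]; linarith) a2)
      _ = _ := by
          rw [← ENNReal.ofReal_add (Real.exp_nonneg _) (Real.exp_nonneg _), two_mul]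
  -- A frequency and a probability both lie in `[0, 1]`, so they cannot differ by more than one.
  · have : {l | t < |freq E l - prob q E|} = ∅ := by
      ext l
      simp only [Set.mem_ofPred_eq, Set.mem_empty_iff_false, iff_false, not_lt]
      refine le_trans ?_ ht1
      rw [abs_le]
      constructor <;> linarith [freq_nonneg E l, freq_le_one E l, prob_nonneg q E, prob_le_one q E]
    rw [this]
    simp

end Concentration

/-! ### Output law and resources of the procedure -/

section Laws

variable {α β : Type}

theorem Proc.law_bind (x : Proc α) (f : α → Proc β) : (x >>= f).law =
    x.law.bind fun r => (f r.1).law.map fun r' =>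
      (r'.1, ⟨r.2.queries + r'.2.queries, r.2.steps + r'.2.steps⟩) := rfl

theorem Proc.law_pure (a : α) : (pure a : Proc α).law = PMF.pure (a, ⟨0, 0⟩) := rfl

/-- The continuation sees only the output of the first procedure and never its resource count, so
resources can be forgotten before composing. -/
theorem Proc.map_fst_bind (x : Proc α) (f : α → Proc β) :
    (x >>= f).law.map Prod.fst = (x.law.map Prod.fst).bind fun a => (f a).law.map Prod.fst := by
  rw [Proc.law_bind, PMF.map_bind, PMF.bind_map]
  congr 1
  funext r
  rw [PMF.map_comp]
  rfl

theorem Proc.map_fst_pure (a : α) : (pure a : Proc α).law.map Prod.fst = PMF.pure a := by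
  rw [Proc.law_pure, PMF.pure_map]

/-- The resource bounds concern every possible run, so they are followed on supports instead of in
probability. -/
theorem Proc.exists_of_mem_support_bind {x : Proc α} {f : α → Proc β} {r : β × Resources}
    (h : r ∈ (x >>= f).law.support) :
    ∃ a ∈ x.law.support, ∃ b ∈ (f a.1).law.support, r.1 = b.1 ∧
      r.2.queries = a.2.queries + b.2.queries ∧ r.2.steps = a.2.steps + b.2.steps := by
  rw [Proc.law_bind, PMF.mem_support_bind_iff] at h
  obtain ⟨a, ha, h⟩ := h
  rw [PMF.support_map] at h
  obtain ⟨b, hb, rfl⟩ := h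
  exact ⟨a, ha, b, hb, rfl, rfl, rfl⟩

theorem Proc.eq_of_mem_support_pure {a : α} {r : α × Resources}
    (h : r ∈ (pure a : Proc α).law.support) : r = (a, ⟨0, 0⟩) := by
  rwa [Proc.law_pure, PMF.support_pure, Set.mem_singleton_iff] at h

variable {n : ℕ} {dA dB : Fin n → ℕ} [∀ i, NeZero (dA i)] (cost : CostModel)
  (C : Channel (∀ i, Fin (dA i)) (∀ j, Fin (dB j))) (P : ∀ i, ICPOVM (dA i))
  (Q : ∀ j, ICPOVM (dB j))

/-- The law of the labels and outcomes of one round. -/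
def roundLaw : PMF (Round dA dB) :=
  (independentDraws fun i => (P i).labelLaw).bind fun a =>
    (measure (tensorPOVM fun j => (Q j).toPOVM)
      (C.apply (tensorState fun i => (P i).inputState (a i)))).map fun b => (a, b)

theorem playRound_map_fst :
    (playRound cost C P Q).law.map Prod.fst = roundLaw C P Q := by
  rw [playRound, Proc.map_fst_bind, roundLaw]
  have h1 : (Proc.draw (independentDraws fun i => (P i).labelLaw)
      (∑ i, cost.draw (dA i ^ 2))).law.map Prod.fst =
      independentDraws fun i => (P i).labelLaw := by
    rw [Proc.law, Proc.draw, PMF.map_comp]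
    exact PMF.map_id _
  rw [h1]
  congr 1
  funext a
  rw [Proc.map_fst_bind]
  have h2 : (Proc.query cost C (fun i => (P i).inputState (a i))
      (fun j => (Q j).toPOVM)).law.map Prod.fst = measure (tensorPOVM fun j => (Q j).toPOVM)
      (C.apply (tensorState fun i => (P i).inputState (a i))) := by
    rw [Proc.law, Proc.query, PMF.map_comp]
    exact PMF.map_id _
  rw [h2]
  simp only [Proc.map_fst_pure]
  rfl

theorem collect_map_fst (N : ℕ) :
    (collect cost C P Q N).law.map Prod.fst = iidList (roundLaw C P Q) N := by
  induction N with
  | zero => exact Proc.map_fst_pure _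
  | succ N ih =>
    rw [collect, Proc.map_fst_bind, playRound_map_fst, iidList]
    congr 1
    funext r
    rw [Proc.map_fst_bind, ih]
    simp only [Proc.map_fst_pure]
    rfl

/-- The classical part of the algorithm. -/
def processData (threshold : ℝ) (data : List (Round dA dB)) : Timed (Fin n → Option (Fin n)) := do
  let ind ← independenceTable cost P Q threshold data
  matching ind

theorem discoverOrder_map_fst (N : ℕ) (threshold : ℝ) :
    (discoverOrder cost C P Q N threshold).law.map Prod.fst =
      (iidList (roundLaw C P Q) N).map fun data => (processData cost P Q threshold data).val := by
  rw [discoverOrder, Proc.map_fst_bind, collect_map_fst]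
  have h : ∀ data : List (Round dA dB), (Proc.compute (do
      let ind ← independenceTable cost P Q threshold data
      matching ind)).law.map Prod.fst = PMF.pure (processData cost P Q threshold data).val :=
    fun data => PMF.pure_map _ _
  simp only [h]
  rfl

theorem playRound_resources {r : Round dA dB × Resources}
    (h : r ∈ (playRound cost C P Q).law.support) :
    r.2.queries = 1 ∧ r.2.steps = roundSteps cost dA dB := by
  rw [playRound] at h
  obtain ⟨a, ha, b, hb, -, hq, hs⟩ := Proc.exists_of_mem_support_bind h
  obtain ⟨c, hc, e, he, -, hq', hs'⟩ := Proc.exists_of_mem_support_bind hb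
  have he := Proc.eq_of_mem_support_pure he
  rw [Proc.law, Proc.draw, PMF.support_map] at ha
  obtain ⟨a', -, rfl⟩ := ha
  rw [Proc.law, Proc.query, PMF.support_map] at hc
  obtain ⟨c', -, rfl⟩ := hc
  subst he
  rw [hq, hs, hq', hs']
  exact ⟨rfl, rfl⟩

theorem collect_resources {N : ℕ} {r : List (Round dA dB) × Resources}
    (h : r ∈ (collect cost C P Q N).law.support) :
    r.1.length = N ∧ r.2.queries = N ∧ r.2.steps = N * roundSteps cost dA dB := by
  induction N generalizing r with
  | zero =>
    obtain rfl := Proc.eq_of_mem_support_pure h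
    simp
  | succ N ih =>
    rw [collect] at h
    obtain ⟨a, ha, b, hb, h1, hq, hs⟩ := Proc.exists_of_mem_support_bind h
    obtain ⟨c, hc, e, he, h1', hq', hs'⟩ := Proc.exists_of_mem_support_bind hb
    have he := Proc.eq_of_mem_support_pure he
    obtain ⟨i1, i2, i3⟩ := ih hc
    obtain ⟨j1, j2⟩ := playRound_resources cost C P Q ha
    subst he
    rw [h1, h1', hq, hs, hq', hs', i2, i3, j1, j2, List.length_cons, i1]
    refine ⟨rfl, by simp; omega, ?_⟩
    simp
    ring

theorem discoverOrder_resources {N : ℕ} {threshold : ℝ}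
    {r : (Fin n → Option (Fin n)) × Resources}
    (h : r ∈ (discoverOrder cost C P Q N threshold).law.support) :
    r.2.queries = N ∧ ∃ data : List (Round dA dB), data.length = N ∧
      r.2.steps = N * roundSteps cost dA dB + (processData cost P Q threshold data).time := by
  rw [discoverOrder] at h
  obtain ⟨a, ha, b, hb, -, hq, hs⟩ := Proc.exists_of_mem_support_bind h
  obtain ⟨i1, i2, i3⟩ := collect_resources cost C P Q ha
  rw [Proc.law, Proc.compute, PMF.support_pure, Set.mem_singleton_iff] at hb
  subst hb
  refine ⟨by rw [hq, i2]; rfl, a.1, i1, ?_⟩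
  rw [hs, i3]
  rfl

end Laws

theorem prob_eq_sum {α : Type} [Fintype α] (q : PMF α) (E : α → Bool) :
    prob q E = ∑ x, (q x).toReal * if E x then 1 else 0 := by
  rw [prob, PMF.toOuterMeasure_apply_fintype, ENNReal.toReal_sum]
  · refine Finset.sum_congr rfl fun x _ => ?_
    by_cases hx : E x = true <;> simp [Set.indicator, hx]
  · intro x _
    exact ne_top_of_le_ne_top (q.apply_ne_top x) (Set.indicator_le_self _ _ _)

/-! ### Label and outcome statistics of a single channel -/

section SinglePair

variable {d e : ℕ} [NeZero d] [NeZero e] (P : ICPOVM d) (Q : ICPOVM e)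
  (E : Channel (Fin d) (Fin e))

/-- The joint probability of label `α` and outcome `β` for a single channel. -/
def jointProb (α : Fin (d ^ 2)) (β : Fin (e ^ 2)) : ℝ :=
  (P.labelLaw α).toReal * (measure Q.toPOVM (E.apply (P.inputState α)) β).toReal

theorem sum_toReal_eq_one {ι : Type} [Fintype ι] (p : PMF ι) : ∑ i, (p i).toReal = 1 := by
  rw [← ENNReal.toReal_sum fun i _ => p.apply_ne_top i, ← tsum_fintype (L := .unconditional _),
    p.tsum_coe, ENNReal.toReal_one]

theorem sum_jointProb_right (α : Fin (d ^ 2)) :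
    ∑ β, jointProb P Q E α β = (P.labelLaw α).toReal := by
  simp only [jointProb, ← Finset.mul_sum, sum_toReal_eq_one, mul_one]

theorem sum_jointProb : ∑ α, ∑ β, jointProb P Q E α β = 1 := by
  simp only [sum_jointProb_right, sum_toReal_eq_one]

theorem toReal_pmfOfWeights {ι : Type} [Fintype ι] (w : ι → ℂ) (h0 : ∀ i, 0 ≤ w i)
    (h1 : ∑ i, w i = 1) (i : ι) : (((pmfOfWeights w h0 h1) i).toReal : ℂ) = w i := by
  have h := Complex.nonneg_iff.mp (h0 i)
  rw [pmfOfWeights, PMF.ofFintype_apply, ENNReal.toReal_ofReal h.1]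
  exact Complex.ext rfl h.2

theorem toReal_labelLaw (α : Fin (d ^ 2)) :
    ((P.labelLaw α).toReal : ℂ) = (P.elem α).trace / d := toReal_pmfOfWeights _ _ _ _

theorem toReal_measure {ι a : Type} [Fintype ι] [Fintype a] [DecidableEq a] (M : POVM ι a)
    (ρ : State a) (i : ι) : ((measure M ρ i).toReal : ℂ) = (M.elem i * ρ.mat).trace :=
  toReal_pmfOfWeights _ _ _ _

/-- The label probability `Tr[P_α] / d` cancels the normalisation of the input state, so the joint
law is linear in `P_α`. -/
theorem jointProb_eq (α : Fin (d ^ 2)) (β : Fin (e ^ 2)) :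
    (jointProb P Q E α β : ℂ) = (Q.elem β * E.toLin (P.elem α).transpose).trace / d := by
  rw [jointProb, Complex.ofReal_mul, toReal_labelLaw, toReal_measure]
  have h : (E.apply (P.inputState α)).mat =
      (P.elem α).trace⁻¹ • E.toLin (P.elem α).transpose := map_smul _ _ _
  rw [h, Matrix.mul_smul, Matrix.trace_smul, smul_eq_mul]
  have := P.trace_ne_zero α
  field_simp

/-- The maximally mixed state. -/
def maximallyMixed (d : ℕ) [NeZero d] : State (Fin d) where
  mat := (d : ℂ)⁻¹ • 1
  psd := Matrix.PosSemidef.one.smul (inv_nonneg_of_nonneg (Nat.cast_nonneg d))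
  trace_eq_one := by
    rw [Matrix.trace_smul, Matrix.trace_one, Fintype.card_fin, smul_eq_mul,
      inv_mul_cancel₀ (Nat.cast_ne_zero.mpr (NeZero.ne d))]

theorem choiMap_kronecker_one (σ : Matrix (Fin e) (Fin e) ℂ) (X : Matrix (Fin d) (Fin d) ℂ) :
    choiMap (Matrix.kronecker 1 σ) X = X.trace • σ := by
  ext y y'
  have hk : ∀ x x', Matrix.kronecker (1 : Matrix (Fin d) (Fin d) ℂ) σ (x, y) (x', y') =
    (1 : Matrix (Fin d) (Fin d) ℂ) x x' * σ y y' := fun _ _ => rfl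
  simp only [choiMap_apply, hk, Matrix.one_apply, ite_mul, one_mul, zero_mul, mul_ite, mul_zero,
    Finset.sum_ite_eq, Finset.mem_univ, if_true, Matrix.smul_apply, smul_eq_mul, Matrix.trace,
    Matrix.diag_apply, Finset.sum_mul]

/-- The difference of the Choi matrices of a channel and of the channel that discards its input is
reconstructed from the covariances of labels and outcomes. -/
theorem choiOf_sub_kronecker :
    choiOf E.toLin - Matrix.kronecker 1 (E.apply (maximallyMixed d)).mat =
      ((d : ℝ) : ℂ) • reconstruct P Q fun ab =>
        (covariance (fun ab => jointProb P Q E ab.1 ab.2) ab : ℂ) := by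
  have hd : (d : ℂ) ≠ 0 := Nat.cast_ne_zero.mpr (NeZero.ne d)
  -- Both Choi matrices are reconstructed from their own expectation values, so the identity reduces
  -- to one of arrays: the values for `E` are `d` times the joint law, and those for the constant
  -- channel are `d` times the product of its marginals.
  rw [← reconstruct_eq_choiOf P Q E.toLin,
    ← choiOf_choiMap (Matrix.kronecker 1 (E.apply (maximallyMixed d)).mat),
    ← reconstruct_eq_choiOf P Q, ← reconstruct_sub, ← reconstruct_smul]
  congr 1
  funext ab
  have h1 : ∑ β, (jointProb P Q E ab.1 β : ℂ) = (P.elem ab.1).trace / d := by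
    rw [← toReal_labelLaw, ← sum_jointProb_right P Q E]
    push_cast
    rfl
  have h2 : ∑ α, (jointProb P Q E α ab.2 : ℂ) = (Q.elem ab.2 * E.toLin 1).trace / d := by
    simp only [jointProb_eq]
    rw [← Finset.sum_div, ← Matrix.trace_sum, ← Matrix.mul_sum, ← map_sum,
      ← Matrix.transpose_sum, P.sum_eq_one, Matrix.transpose_one]
  have h3 : (E.apply (maximallyMixed d)).mat = (d : ℂ)⁻¹ • E.toLin 1 := map_smul _ _ _
  simp only [Pi.sub_apply, Pi.smul_apply, covariance, smul_eq_mul]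
  push_cast
  rw [h1, h2, jointProb_eq, choiMap_kronecker_one, h3, Matrix.mul_smul, Matrix.trace_smul,
    Matrix.mul_smul, Matrix.trace_smul, Matrix.trace_transpose]
  simp only [smul_eq_mul]
  field_simp

end SinglePair

/-! ### Factorisation of the law of one round -/

section RoundLaw

variable {n : ℕ} {dA dB : Fin n → ℕ} [∀ i, NeZero (dA i)] [∀ j, NeZero (dB j)]
  {C : Channel (∀ i, Fin (dA i)) (∀ j, Fin (dB j))} (P : ∀ i, ICPOVM (dA i))
  (Q : ∀ j, ICPOVM (dB j)) (τ : Equiv.Perm (Fin n))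
  {Ch : ∀ i, Channel (Fin (dA i)) (Fin (dB (τ i)))}

theorem trace_tensorOp_mul (M : ∀ j, Matrix (Fin (dB j)) (Fin (dB j)) ℂ)
    (Z : ∀ i, Matrix (Fin (dB (τ i))) (Fin (dB (τ i))) ℂ)
    {Y : Matrix (∀ j, Fin (dB j)) (∀ j, Fin (dB j)) ℂ}
    (hY : ∀ y y', Y y y' = ∏ i, Z i (y (τ i)) (y' (τ i))) :
    (tensorOp M * Y).trace = ∏ i, (M (τ i) * Z i).trace := by
  simp only [Matrix.trace, Matrix.diag_apply, Matrix.mul_apply, tensorOp, Matrix.of_apply, hY]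
  rw [← sum_prod_perm (β := fun j => Fin (dB j)) τ
    (fun i y => ∑ y', M (τ i) y y' * Z i y' y)]
  refine Finset.sum_congr rfl fun y _ => ?_
  rw [← sum_prod_perm (β := fun j => Fin (dB j)) τ
    (fun i y' => M (τ i) (y (τ i)) y' * Z i y' (y (τ i)))]
  refine Finset.sum_congr rfl fun y' _ => ?_
  rw [Finset.prod_mul_distrib, Equiv.prod_comp τ fun j => M j (y j) (y' j)]

/-- Independent labels, product inputs, a product channel and separate measurements: Born's rule
factorises along `τ`, one factor for each input with its true output. -/
theorem toReal_roundLaw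
    (hC : ∀ (X : ∀ i, Matrix (Fin (dA i)) (Fin (dA i)) ℂ) (y y' : ∀ j, Fin (dB j)),
      C.toLin (tensorOp X) y y' = ∏ i, (Ch i).toLin (X i) (y (τ i)) (y' (τ i)))
    (r : Round dA dB) :
    (roundLaw C P Q r).toReal =
      ∏ i, jointProb (P i) (Q (τ i)) (Ch i) (r.1 i) (r.2 (τ i)) := by
  obtain ⟨a, b⟩ := r
  have h1 : roundLaw C P Q (a, b) = independentDraws (fun i => (P i).labelLaw) a *
      measure (tensorPOVM fun j => (Q j).toPOVM)
        (C.apply (tensorState fun i => (P i).inputState (a i))) b := by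
    rw [roundLaw, PMF.bind_apply, tsum_eq_single a]
    · congr 1
      rw [PMF.map_apply, tsum_eq_single b]
      · simp
      · intro b' hb'
        simp [hb'.symm]
    · intro a' ha'
      rw [PMF.map_apply, ENNReal.tsum_eq_zero.mpr, mul_zero]
      intro b'
      simp [ha'.symm]
  have h2 : (measure (tensorPOVM fun j => (Q j).toPOVM)
      (C.apply (tensorState fun i => (P i).inputState (a i))) b).toReal =
      ∏ i, (measure (Q (τ i)).toPOVM ((Ch i).apply ((P i).inputState (a i))) (b (τ i))).toReal := by
    apply Complex.ofReal_injective
    push_cast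
    simp only [toReal_measure]
    exact trace_tensorOp_mul τ (fun j => (Q j).elem (b j)) _ fun y y' => hC _ y y'
  have h3 : (independentDraws (fun i => (P i).labelLaw) a).toReal =
      ∏ i, ((P i).labelLaw (a i)).toReal := by
    rw [independentDraws, PMF.ofFintype_apply, ENNReal.toReal_prod]
  rw [h1, ENNReal.toReal_mul, h2, h3, ← Finset.prod_mul_distrib]
  rfl

theorem sum_round_prod (g : ∀ i, Fin (dA i ^ 2) → Fin (dB (τ i) ^ 2) → ℝ) :
    ∑ r : Round dA dB, ∏ i, g i (r.1 i) (r.2 (τ i)) = ∏ i, ∑ α, ∑ β, g i α β := by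
  rw [Fintype.sum_prod_type]
  have h : ∀ a : ∀ i, Fin (dA i ^ 2), ∑ b : ∀ j, Fin (dB j ^ 2), ∏ i, g i (a i) (b (τ i)) =
      ∏ i, ∑ β, g i (a i) β := fun a =>
    sum_prod_perm (β := fun j => Fin (dB j ^ 2)) τ fun i β => g i (a i) β
  simp only [h]
  exact sum_prod_perm (β := fun i => Fin (dA i ^ 2)) 1 fun i α => ∑ β, g i α β

/-- Writing the output as `τ k` lets the pairs on and off the graph be treated together. Factors
other than `i` and `k` carry weight one and sum to one. -/
theorem prob_roundLaw_pair
    (hC : ∀ (X : ∀ i, Matrix (Fin (dA i)) (Fin (dA i)) ℂ) (y y' : ∀ j, Fin (dB j)),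
      C.toLin (tensorOp X) y y' = ∏ i, (Ch i).toLin (X i) (y (τ i)) (y' (τ i)))
    (i k : Fin n) (U : Fin (dA i ^ 2) → Bool) (V : Fin (dB (τ k) ^ 2) → Bool) :
    prob (roundLaw C P Q) (fun r => U (r.1 i) && V (r.2 (τ k))) =
      ∏ l, ∑ α, ∑ β, jointProb (P l) (Q (τ l)) (Ch l) α β *
        (Function.update (β := fun l => Fin (dA l ^ 2) → ℝ) (fun _ _ => 1) i
          (fun α => if U α then 1 else 0) l α *
        Function.update (β := fun l => Fin (dB (τ l) ^ 2) → ℝ) (fun _ _ => 1) k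
          (fun β => if V β then 1 else 0) l β) := by
  rw [prob_eq_sum, ← sum_round_prod]
  refine Finset.sum_congr rfl fun r _ => ?_
  rw [toReal_roundLaw P Q τ hC, Finset.prod_mul_distrib, Finset.prod_mul_distrib]
  congr 1
  rw [Finset.prod_eq_single i, Finset.prod_eq_single k]
  · simp only [Function.update_self, Bool.and_eq_true, ite_and]
    split_ifs <;> simp
  · intro l _ hl; rw [Function.update_of_ne hl]
  · simp
  · intro l _ hl; rw [Function.update_of_ne hl]
  · simp

theorem prob_roundLaw_same
    (hC : ∀ (X : ∀ i, Matrix (Fin (dA i)) (Fin (dA i)) ℂ) (y y' : ∀ j, Fin (dB j)),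
      C.toLin (tensorOp X) y y' = ∏ i, (Ch i).toLin (X i) (y (τ i)) (y' (τ i)))
    (i : Fin n) (α : Fin (dA i ^ 2)) (β : Fin (dB (τ i) ^ 2)) :
    prob (roundLaw C P Q) (fun r => decide (r.1 i = α) && decide (r.2 (τ i) = β)) =
      jointProb (P i) (Q (τ i)) (Ch i) α β := by
  rw [prob_roundLaw_pair P Q τ hC i i (fun x => decide (x = α)) (fun y => decide (y = β)),
    Finset.prod_eq_single i]
  · simp only [Function.update_self, decide_eq_true_eq]
    rw [Finset.sum_eq_single α, Finset.sum_eq_single β]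
    · simp
    · intro b _ hb; simp [hb]
    · simp
    · intro b _ hb; simp [hb]
    · simp
  · intro l _ hl
    simp only [Function.update_of_ne hl, mul_one]
    exact sum_jointProb _ _ _
  · simp

theorem prob_roundLaw_ne
    (hC : ∀ (X : ∀ i, Matrix (Fin (dA i)) (Fin (dA i)) ℂ) (y y' : ∀ j, Fin (dB j)),
      C.toLin (tensorOp X) y y' = ∏ i, (Ch i).toLin (X i) (y (τ i)) (y' (τ i)))
    {i k : Fin n} (hik : i ≠ k) (α : Fin (dA i ^ 2)) (β : Fin (dB (τ k) ^ 2)) :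
    prob (roundLaw C P Q) (fun r => decide (r.1 i = α) && decide (r.2 (τ k) = β)) =
      (∑ b, jointProb (P i) (Q (τ i)) (Ch i) α b) *
        ∑ a, jointProb (P k) (Q (τ k)) (Ch k) a β := by
  rw [prob_roundLaw_pair P Q τ hC i k (fun x => decide (x = α)) (fun y => decide (y = β)),
    Finset.prod_eq_mul i k hik]
  · congr 1
    · simp only [Function.update_self, Function.update_of_ne hik, decide_eq_true_eq, mul_one]
      rw [Finset.sum_eq_single α]
      · simp
      · intro b _ hb; simp [hb]
      · simp
    · simp only [Function.update_self, Function.update_of_ne hik.symm, decide_eq_true_eq, one_mul]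
      refine Finset.sum_congr rfl fun a _ => ?_
      rw [Finset.sum_eq_single β]
      · simp
      · intro b _ hb; simp [hb]
      · simp
  · intro l _ hl
    simp only [Function.update_of_ne hl.1, Function.update_of_ne hl.2, mul_one]
    exact sum_jointProb _ _ _
  · simp
  · simp

/-- The joint law of the label of input `i` and the outcome at output `j`. -/
def pairProb (C : Channel (∀ i, Fin (dA i)) (∀ j, Fin (dB j))) (i j : Fin n)
    (ab : Fin (dA i ^ 2) × Fin (dB j ^ 2)) : ℝ :=
  prob (roundLaw C P Q) fun r => decide (r.1 i = ab.1) && decide (r.2 j = ab.2)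

theorem covariance_pairProb_ne
    (hC : ∀ (X : ∀ i, Matrix (Fin (dA i)) (Fin (dA i)) ℂ) (y y' : ∀ j, Fin (dB j)),
      C.toLin (tensorOp X) y y' = ∏ i, (Ch i).toLin (X i) (y (τ i)) (y' (τ i)))
    {i j : Fin n} (hij : j ≠ τ i) : covariance (pairProb P Q C i j) = 0 := by
  obtain ⟨k, rfl⟩ := τ.surjective j
  have hik : i ≠ k := fun h => hij (by rw [h])
  funext ab
  simp only [covariance, pairProb, prob_roundLaw_ne P Q τ hC hik, ← Finset.mul_sum,
    ← Finset.sum_mul, Pi.zero_apply]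
  rw [sum_jointProb, Finset.sum_comm, sum_jointProb]
  ring

theorem pairProb_same
    (hC : ∀ (X : ∀ i, Matrix (Fin (dA i)) (Fin (dA i)) ℂ) (y y' : ∀ j, Fin (dB j)),
      C.toLin (tensorOp X) y y' = ∏ i, (Ch i).toLin (X i) (y (τ i)) (y' (τ i)))
    (i : Fin n) : pairProb P Q C i (τ i) =
      fun ab => jointProb (P i) (Q (τ i)) (Ch i) ab.1 ab.2 :=
  funext fun ab => prob_roundLaw_same P Q τ hC i ab.1 ab.2

end RoundLaw

/-! ### Marginals, perturbation of covariances, and the tally -/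

section Marginals

variable {α ι κ : Type} [Fintype ι] [DecidableEq ι] [Fintype κ]

theorem sum_countP_and (E : α → Bool) (f : α → ι) (l : List α) :
    ∑ b, l.countP (fun r => E r && decide (f r = b)) = l.countP E := by
  induction l with
  | nil => simp
  | cons r l ih =>
    simp only [List.countP_cons, Finset.sum_add_distrib, ih, Bool.and_eq_true, decide_eq_true_eq]
    congr 1
    by_cases h : E r = true <;> simp [h]

theorem sum_freq_and (E : α → Bool) (f : α → ι) (l : List α) :
    ∑ b, freq (fun r => E r && decide (f r = b)) l = freq E l := by
  simp only [freq, ← Finset.sum_div]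
  rw [← sum_countP_and E f l]
  push_cast
  rfl

theorem sum_prob_and [Fintype α] (q : PMF α) (E : α → Bool) (f : α → ι) :
    ∑ b, prob q (fun r => E r && decide (f r = b)) = prob q E := by
  simp only [prob_eq_sum]
  rw [Finset.sum_comm]
  refine Finset.sum_congr rfl fun r _ => ?_
  rw [← Finset.mul_sum]
  congr 1
  by_cases h : E r = true <;> simp [h]

theorem abs_covariance_sub_le {p p' : ι × κ → ℝ} {t : ℝ} (h : ∀ ab, |p ab - p' ab| ≤ t)
    (hA : ∀ a, |∑ b, p (a, b) - ∑ b, p' (a, b)| ≤ t)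
    (hB : ∀ b, |∑ a, p (a, b) - ∑ a, p' (a, b)| ≤ t)
    (hA1 : ∀ a, |∑ b, p' (a, b)| ≤ 1) (hB1 : ∀ b, |∑ a, p (a, b)| ≤ 1) (ab : ι × κ) :
    |covariance p ab - covariance p' ab| ≤ 3 * t := by
  -- The products of marginals are compared by changing one factor at a time, which gives two errors
  -- of size `t` beside that of the joint entry.
  have e : covariance p ab - covariance p' ab = (p ab - p' ab) -
      ((∑ b, p (ab.1, b) - ∑ b, p' (ab.1, b)) * ∑ a, p (a, ab.2) +
        (∑ b, p' (ab.1, b)) * (∑ a, p (a, ab.2) - ∑ a, p' (a, ab.2))) := by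
    simp only [covariance]
    ring
  have ht : 0 ≤ t := (abs_nonneg _).trans (h ab)
  have h1 : |(∑ b, p (ab.1, b) - ∑ b, p' (ab.1, b)) * ∑ a, p (a, ab.2)| ≤ t := by
    rw [abs_mul]
    calc _ ≤ t * 1 := mul_le_mul (hA _) (hB1 _) (abs_nonneg _) ht
      _ = t := mul_one t
  have h2 : |(∑ b, p' (ab.1, b)) * (∑ a, p (a, ab.2) - ∑ a, p' (a, ab.2))| ≤ t := by
    rw [abs_mul]
    calc _ ≤ 1 * t := mul_le_mul (hA1 _) (hB _) (abs_nonneg _) zero_le_one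
      _ = t := one_mul t
  rw [e]
  calc _ ≤ _ := abs_sub _ _
    _ ≤ t + (t + t) := add_le_add (h ab) ((abs_add_le _ _).trans (add_le_add h1 h2))
    _ = 3 * t := by ring

theorem forLoop_tally_val [DecidableEq α] (c : ℝ) (p : α → ℝ) (l : List α) (x : α) :
    (Timed.forLoop (fun p a => Timed.op (Function.update p a (p a + c))) p l).val x =
      p x + l.countP (fun a => decide (a = x)) * c := by
  induction l generalizing p with
  | nil => simp [Timed.forLoop, Timed.pure_val]
  | cons a l ih =>
    rw [Timed.forLoop_cons_val, ih, Timed.op_val, List.countP_cons]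
    by_cases h : a = x
    · subst h
      simp
      ring
    · simp [h, Function.update_of_ne (Ne.symm h)]

end Marginals

/-! ### Accuracy of the empirical covariances -/

section Estimate

variable {n : ℕ} {dA dB : Fin n → ℕ} [∀ i, NeZero (dA i)] [∀ j, NeZero (dB j)]
  (C : Channel (∀ i, Fin (dA i)) (∀ j, Fin (dB j))) (P : ∀ i, ICPOVM (dA i))
  (Q : ∀ j, ICPOVM (dB j))

/-- The empirical frequencies of the label of input `i` and the outcome at output `j`. -/
def pairFreq (data : List (Round dA dB)) (i j : Fin n)
    (ab : Fin (dA i ^ 2) × Fin (dB j ^ 2)) : ℝ :=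
  freq (fun r => decide (r.1 i = ab.1) && decide (r.2 j = ab.2)) data

theorem estimateChi1_eq (cost : CostModel) (data : List (Round dA dB)) (i j : Fin n) :
    (estimateChi1 cost (P i) (Q j) (data.map fun r => (r.1 i, r.2 j))).val =
      traceNorm (reconstruct (P i) (Q j) fun ab =>
        (covariance (pairFreq data i j) ab : ℂ)) := by
  rw [estimateChi1_val, ← chi1_reconstruct]
  simp only [forLoop_tally_val, List.countP_map, List.length_map]
  rw [reconstruct]
  congr 3
  funext x x'
  refine Finset.sum_congr rfl fun ab _ => ?_
  congr 2
  rw [pairFreq, freq, zero_add, mul_one_div]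
  congr 3
  funext r
  simp [Prod.ext_iff]

/-- The labels of the events that fix the label of one input, the outcome at one output, both, or
none. -/
abbrev PairEvent (dA dB : Fin n → ℕ) : Type :=
  Σ ij : Fin n × Fin n, Option (Fin (dA ij.1 ^ 2)) × Option (Fin (dB ij.2 ^ 2))

/-- The event with a given label. -/
def PairEvent.holds (k : PairEvent dA dB) (r : Round dA dB) : Bool :=
  (k.2.1.elim true fun α => decide (r.1 k.1.1 = α)) &&
    k.2.2.elim true fun β => decide (r.2 k.1.2 = β)

theorem card_pairEvent_le :
    (Fintype.card (PairEvent dA dB) : ℝ) ≤ 4 * n ^ 2 * (maxDim dA : ℝ) ^ 2 * (maxDim dB : ℝ) ^ 2 := by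
  have h : Fintype.card (PairEvent dA dB) ≤ n * n * (4 * (maxDim dA ^ 2 * maxDim dB ^ 2)) := by
    rw [Fintype.card_sigma]
    refine (Finset.sum_le_card_nsmul _ _ (4 * (maxDim dA ^ 2 * maxDim dB ^ 2))
      fun ij _ => ?_).trans (le_of_eq ?_)
    · rw [Fintype.card_prod, Fintype.card_option, Fintype.card_option, Fintype.card_fin,
        Fintype.card_fin]
      have hA : dA ij.1 ^ 2 ≤ maxDim dA ^ 2 :=
        Nat.pow_le_pow_left (Finset.le_sup (f := dA) (Finset.mem_univ _)) 2
      have hB : dB ij.2 ^ 2 ≤ maxDim dB ^ 2 :=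
        Nat.pow_le_pow_left (Finset.le_sup (f := dB) (Finset.mem_univ _)) 2
      have hA1 : 1 ≤ dA ij.1 ^ 2 := Nat.one_le_pow _ _ (NeZero.pos _)
      have hB1 : 1 ≤ dB ij.2 ^ 2 := Nat.one_le_pow _ _ (NeZero.pos _)
      calc _ ≤ (2 * maxDim dA ^ 2) * (2 * maxDim dB ^ 2) :=
            Nat.mul_le_mul (by omega) (by omega)
        _ = _ := by ring
    · rw [Finset.card_univ, Fintype.card_prod, Fintype.card_fin, smul_eq_mul]
  calc (Fintype.card (PairEvent dA dB) : ℝ)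
      ≤ ((n * n * (4 * (maxDim dA ^ 2 * maxDim dB ^ 2)) : ℕ) : ℝ) := by exact_mod_cast h
    _ = _ := by push_cast; ring

/-- All frequencies of labels and outcomes are within `t` of the probabilities. -/
def Representative (t : ℝ) (data : List (Round dA dB)) : Prop :=
  ∀ k : PairEvent dA dB, |freq k.holds data - prob (roundLaw C P Q) k.holds| ≤ t

theorem not_representative_le {N : ℕ} (hN : 0 < N) {t : ℝ} (ht : 0 ≤ t) :
    (iidList (roundLaw C P Q) N).toOuterMeasure {data | ¬ Representative C P Q t data} ≤
      ENNReal.ofReal (4 * n ^ 2 * (maxDim dA : ℝ) ^ 2 * (maxDim dB : ℝ) ^ 2 *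
        (2 * Real.exp (-(N * t ^ 2 / 4)))) := by
  have hset : {data | ¬ Representative C P Q t data} = ⋃ k : PairEvent dA dB,
      {data | t < |freq k.holds data - prob (roundLaw C P Q) k.holds|} := by
    ext data
    simp [Representative]
  rw [hset]
  refine (MeasureTheory.measure_iUnion_fintype_le _ _).trans ?_
  refine (Finset.sum_le_card_nsmul _ _ _ fun k _ => iidList_freq_le _ _ hN ht).trans ?_
  rw [Finset.card_univ, nsmul_eq_mul, ← ENNReal.ofReal_natCast,
    ← ENNReal.ofReal_mul (Nat.cast_nonneg _)]
  refine ENNReal.ofReal_le_ofReal ?_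
  have := card_pairEvent_le (dA := dA) (dB := dB)
  gcongr

variable {C P Q}

/-- The events include those that fix only a label or only an outcome, so the marginals are
controlled directly. Summing the errors of joint entries instead would introduce a factor depending
on the dimensions. -/
theorem Representative.abs_covariance_sub_le {t : ℝ} {data : List (Round dA dB)}
    (h : Representative C P Q t data) (i j : Fin n) (ab : Fin (dA i ^ 2) × Fin (dB j ^ 2)) :
    |covariance (pairFreq data i j) ab - covariance (pairProb P Q C i j) ab| ≤ 3 * t := by
  have fA : ∀ a, ∑ b, pairFreq data i j (a, b) = freq (fun r => decide (r.1 i = a)) data :=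
    fun a => sum_freq_and (fun r : Round dA dB => decide (r.1 i = a)) (fun r => r.2 j) data
  have fB : ∀ b, ∑ a, pairFreq data i j (a, b) = freq (fun r => decide (r.2 j = b)) data := by
    intro b
    rw [← sum_freq_and (fun r : Round dA dB => decide (r.2 j = b)) (fun r => r.1 i) data]
    simp only [pairFreq, Bool.and_comm]
  have pA : ∀ a, ∑ b, pairProb P Q C i j (a, b) =
      prob (roundLaw C P Q) (fun r => decide (r.1 i = a)) :=
    fun a => sum_prob_and _ (fun r : Round dA dB => decide (r.1 i = a)) (fun r => r.2 j)
  have pB : ∀ b, ∑ a, pairProb P Q C i j (a, b) =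
      prob (roundLaw C P Q) (fun r => decide (r.2 j = b)) := by
    intro b
    rw [← sum_prob_and _ (fun r : Round dA dB => decide (r.2 j = b)) (fun r => r.1 i)]
    simp only [pairProb, Bool.and_comm]
  refine CausalOrder.abs_covariance_sub_le ?_ ?_ ?_ ?_ ?_ ab
  · intro ab
    exact h ⟨(i, j), some ab.1, some ab.2⟩
  · intro a
    rw [fA, pA]
    have e : PairEvent.holds (dA := dA) (dB := dB) ⟨(i, j), some a, none⟩ =
        fun r => decide (r.1 i = a) := funext fun r => Bool.and_true _
    rw [← e]
    exact h _
  · intro b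
    rw [fB, pB]
    exact h ⟨(i, j), none, some b⟩
  · intro a
    rw [pA, abs_of_nonneg (prob_nonneg _ _)]
    exact prob_le_one _ _
  · intro b
    rw [fB, abs_of_nonneg (freq_nonneg _ _)]
    exact freq_le_one _ _

end Estimate

/-! ### From representative data to a good permutation -/

section Correctness

variable {n : ℕ} {dA dB : Fin n → ℕ} [∀ i, NeZero (dA i)] [∀ j, NeZero (dB j)]
  {C : Channel (∀ i, Fin (dA i)) (∀ j, Fin (dB j))} (P : ∀ i, ICPOVM (dA i))
  (Q : ∀ j, ICPOVM (dB j)) (τ : Equiv.Perm (Fin n))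
  {Ch : ∀ i, Channel (Fin (dA i)) (Fin (dB (τ i)))}

/-- The deterministic core. Disagreement of `π` and `τ` at `i` means that the test on `(i, τ i)`
passed, so the factor there is nearly constant; at most `n` factors are replaced, each at cost `ε /
n`. The second condition is asked only for `n ≥ 2` because permutations of one point cannot
disagree. -/
theorem isGoodOutput_of_estimates (hn : 0 < n)
    (hC : ∀ (X : ∀ i, Matrix (Fin (dA i)) (Fin (dA i)) ℂ) (y y' : ∀ j, Fin (dB j)),
      C.toLin (tensorOp X) y y' = ∏ i, (Ch i).toLin (X i) (y (τ i)) (y' (τ i)))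
    (cost : CostModel) {ε threshold : ℝ} (hε : 0 ≤ ε) (data : List (Round dA dB))
    (h1 : ∀ i j, j ≠ τ i →
      (estimateChi1 cost (P i) (Q j) (data.map fun r => (r.1 i, r.2 j))).val ≤ threshold)
    (h2 : 2 ≤ n → ∀ i,
      (estimateChi1 cost (P i) (Q (τ i)) (data.map fun r => (r.1 i, r.2 (τ i)))).val ≤ threshold →
      traceNorm (choiOf (Ch i).toLin -
        Matrix.kronecker 1 ((Ch i).apply (maximallyMixed (dA i))).mat) ≤ ε / n) :
    IsGoodOutput C ε (processData cost P Q threshold data).val := by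
  have hind : ∀ i j, (independenceTable cost P Q threshold data).val (i, j) =
      decide ((estimateChi1 cost (P i) (Q j)
        (data.map fun r => (r.1 i, r.2 j))).val ≤ threshold) := fun i j => rfl
  obtain ⟨π, hπ, hτ⟩ := matching_spec τ
    (ind := (independenceTable cost P Q threshold data).val)
    fun i j hij => by rw [hind]; exact decide_eq_true (h1 i j hij)
  obtain ⟨D, hD, hdist⟩ := exists_isComb_diamondDist_le τ π (choiOf_eq_prodChoi τ hC)
    fun i => (Ch i).apply (maximallyMixed (dA i))
  refine ⟨π, hπ, D, hD, hdist.trans ?_⟩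
  have hn' : (0 : ℝ) < n := by exact_mod_cast hn
  calc _ ≤ ∑ i with π i ≠ τ i, ε / n := by
        refine Finset.sum_le_sum fun i hi => ?_
        have hi : π i ≠ τ i := (Finset.mem_filter.mp hi).2
        refine h2 ?_ i ?_
        · by_contra hlt
          have : Subsingleton (Fin n) := Fin.subsingleton_iff_le_one.mpr (by omega)
          exact hi (Subsingleton.elim _ _)
        · have : (independenceTable cost P Q threshold data).val (i, τ i) = true := by
            by_contra hf
            exact hi (hτ i (by simpa using hf))
          rw [hind] at this
          exact of_decide_eq_true this
    _ ≤ ∑ i : Fin n, ε / n :=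
        Finset.sum_le_sum_of_subset_of_nonneg (Finset.filter_subset _ _) fun _ _ _ => by positivity
    _ = ε := by
        rw [Finset.sum_const, Finset.card_univ, Fintype.card_fin, nsmul_eq_mul]
        field_simp

theorem lambdaMin_le_left (i : Fin n) : lambdaMin P Q ≤ (P i).minEigenvalue :=
  (min_le_left _ _).trans (ciInf_le (Set.finite_range _).bddBelow i)

theorem lambdaMin_le_right (j : Fin n) : lambdaMin P Q ≤ (Q j).minEigenvalue :=
  (min_le_right _ _).trans (ciInf_le (Set.finite_range _).bddBelow j)

theorem lambdaMin_pos (hn : 0 < n) : 0 < lambdaMin P Q := by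
  have : Nonempty (Fin n) := ⟨⟨0, hn⟩⟩
  obtain ⟨i, hi⟩ := exists_eq_ciInf_of_finite (f := fun i => (P i).minEigenvalue)
  obtain ⟨j, hj⟩ := exists_eq_ciInf_of_finite (f := fun j => (Q j).minEigenvalue)
  rw [lambdaMin, ← hi, ← hj]
  exact lt_min (P i).minEigenvalue_pos (Q j).minEigenvalue_pos

theorem lambdaMin_le_one (hn : 0 < n) : lambdaMin P Q ≤ 1 :=
  (lambdaMin_le_left P Q ⟨0, hn⟩).trans (P _).minEigenvalue_le_one

theorem le_maxDim (d : Fin n → ℕ) (i : Fin n) : d i ≤ maxDim d :=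
  Finset.le_sup (f := d) (Finset.mem_univ _)

theorem one_le_maxDim (hn : 0 < n) (d : Fin n → ℕ) [∀ i, NeZero (d i)] : 1 ≤ maxDim d :=
  (NeZero.one_le (n := d ⟨0, hn⟩)).trans (le_maxDim d _)

/-- The accuracy of the frequencies that suffices for the independence tests. -/
def accuracy (P : ∀ i, ICPOVM (dA i)) (Q : ∀ j, ICPOVM (dB j)) (ε : ℝ) : ℝ :=
  ε * lambdaMin P Q /
    (6 * n * maxDim dA * (√(maxDim dA * maxDim dB) * (maxDim dA * maxDim dB)))

/-- `accuracy` is the solution for `t` of the equation between the stability bound with entrywise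
error `3 t`, taken at the maximal dimensions, and the threshold. -/
theorem traceNorm_reconstruct_le_threshold (hn : 0 < n) {ε : ℝ} (hε : 0 < ε) (i j : Fin n)
    (v : Fin (dA i ^ 2) × Fin (dB j ^ 2) → ℂ) (hv : ∀ ab, ‖v ab‖ ≤ 3 * accuracy P Q ε) :
    traceNorm (reconstruct (P i) (Q j) v) ≤ ε / (2 * n * maxDim dA) := by
  have hl := lambdaMin_pos P Q hn
  have hA : (1 : ℝ) ≤ maxDim dA := by exact_mod_cast one_le_maxDim hn dA
  have hB : (1 : ℝ) ≤ maxDim dB := by exact_mod_cast one_le_maxDim hn dB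
  have hAi : (dA i : ℝ) ≤ maxDim dA := by exact_mod_cast le_maxDim dA i
  have hBj : (dB j : ℝ) ≤ maxDim dB := by exact_mod_cast le_maxDim dB j
  have hn' : (0 : ℝ) < n := by exact_mod_cast hn
  have hs : 0 < √((maxDim dA : ℝ) * maxDim dB) := Real.sqrt_pos.mpr (by positivity)
  have ht : 0 ≤ accuracy P Q ε := by rw [accuracy]; positivity
  refine (traceNorm_reconstruct_le (P i) (Q j) v (by positivity) hv hl (lambdaMin_le_left P Q i)
    (lambdaMin_le_right P Q j)).trans ?_
  calc _ ≤ √((maxDim dA : ℝ) * maxDim dB) * (maxDim dA * maxDim dB) * (3 * accuracy P Q ε) /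
        lambdaMin P Q := by gcongr
    _ = _ := by
      rw [accuracy]
      field_simp
      norm_num

theorem Representative.isGoodOutput (hn : 0 < n)
    (hC : ∀ (X : ∀ i, Matrix (Fin (dA i)) (Fin (dA i)) ℂ) (y y' : ∀ j, Fin (dB j)),
      C.toLin (tensorOp X) y y' = ∏ i, (Ch i).toLin (X i) (y (τ i)) (y' (τ i)))
    (cost : CostModel) {ε : ℝ} (hε : 0 < ε) {data : List (Round dA dB)}
    (h : Representative C P Q (accuracy P Q ε) data) :
    IsGoodOutput C ε (processData cost P Q (ε / (2 * n * maxDim dA)) data).val := by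
  refine isGoodOutput_of_estimates P Q τ hn hC cost hε.le data (fun i j hij => ?_)
    fun _ i hest => ?_
  · rw [estimateChi1_eq]
    refine traceNorm_reconstruct_le_threshold P Q hn hε i j _ fun ab => ?_
    have := h.abs_covariance_sub_le i j ab
    rw [covariance_pairProb_ne P Q τ hC hij, Pi.zero_apply, sub_zero] at this
    rwa [Complex.norm_real]
  · rw [estimateChi1_eq] at hest
    -- The threshold and the estimation error are each `ε / (2 n d_A)`. The factor `d` of the Choi
    -- matrix, at most `d_A`, turns their sum into `ε / n`.
    rw [choiOf_sub_kronecker (P i) (Q (τ i))]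
    refine (traceNorm_smul (reconstruct_isHermitian _ _ _) (Nat.cast_nonneg _)).trans ?_
    have hdiff : traceNorm (reconstruct (P i) (Q (τ i)) fun ab =>
        ((covariance (pairProb P Q C i (τ i)) ab -
          covariance (pairFreq data i (τ i)) ab : ℝ) : ℂ)) ≤ ε / (2 * n * maxDim dA) := by
      refine traceNorm_reconstruct_le_threshold P Q hn hε i (τ i) _ fun ab => ?_
      rw [Complex.norm_real, Real.norm_eq_abs, abs_sub_comm]
      exact h.abs_covariance_sub_le i (τ i) ab
    have hadd := traceNorm_add_le
      (reconstruct_isHermitian (P i) (Q (τ i)) (covariance (pairFreq data i (τ i))))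
      (reconstruct_isHermitian (P i) (Q (τ i)) fun ab =>
        covariance (pairProb P Q C i (τ i)) ab - covariance (pairFreq data i (τ i)) ab)
    rw [← reconstruct_add] at hadd
    have hsum : ((fun ab => (covariance (pairFreq data i (τ i)) ab : ℂ)) + fun ab =>
        ((covariance (pairProb P Q C i (τ i)) ab -
          covariance (pairFreq data i (τ i)) ab : ℝ) : ℂ)) =
        fun ab => (covariance (fun ab => jointProb (P i) (Q (τ i)) (Ch i) ab.1 ab.2) ab : ℂ) := by
      funext ab
      rw [← pairProb_same P Q τ hC i]
      simp
    rw [hsum] at hadd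
    have hA : (1 : ℝ) ≤ maxDim dA := by exact_mod_cast one_le_maxDim hn dA
    have hAi : (dA i : ℝ) ≤ maxDim dA := by exact_mod_cast le_maxDim dA i
    have hn' : (0 : ℝ) < n := by exact_mod_cast hn
    calc _ ≤ (maxDim dA : ℝ) * (ε / (2 * n * maxDim dA) + ε / (2 * n * maxDim dA)) :=
          mul_le_mul hAi (by linarith) (traceNorm_nonneg _) (by positivity)
      _ = ε / n := by field_simp; norm_num

theorem failure_bound (hn : 2 ≤ n) {ε κ : ℝ} (hε : 0 < ε) (hκ : 0 < κ) (hκ1 : κ < 1) {N : ℕ}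
    (hN : 720 * queryScale P Q ε κ ≤ N) :
    4 * n ^ 2 * (maxDim dA : ℝ) ^ 2 * (maxDim dB : ℝ) ^ 2 *
      (2 * Real.exp (-(N * accuracy P Q ε ^ 2 / 4))) ≤ κ := by
  have hn0 : 0 < n := by omega
  have hl := lambdaMin_pos P Q hn0
  have hA : (1 : ℝ) ≤ maxDim dA := by exact_mod_cast one_le_maxDim hn0 dA
  have hB : (1 : ℝ) ≤ maxDim dB := by exact_mod_cast one_le_maxDim hn0 dB
  have hn' : (2 : ℝ) ≤ n := by exact_mod_cast hn
  rw [queryScale] at hN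
  rw [accuracy]
  set a : ℝ := (maxDim dA : ℝ)
  set b : ℝ := (maxDim dB : ℝ)
  set m : ℝ := (n : ℝ)
  set l : ℝ := lambdaMin P Q
  set X : ℝ := m * a * b / κ with hX
  have hab : 1 ≤ a * b := by nlinarith
  -- Here `n ≥ 2` matters: for `n` and all dimensions equal to one, `X = 1 / κ` can be arbitrarily
  -- close to `1`.
  have hX2 : 2 ≤ X := by
    rw [hX, le_div_iff₀ hκ]
    nlinarith
  have hL : 0 ≤ Real.log X := Real.log_nonneg (by linarith)
  -- `720 / (36 · 4) = 5`. The surplus factor `a b ≥ 1` is discarded.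
  have hexp : 5 * Real.log X ≤
      N * (ε * l / (6 * m * a * (√(a * b) * (a * b)))) ^ 2 / 4 := by
    have hs : (√(a * b)) ^ 2 = a * b := Real.sq_sqrt (by linarith)
    have e1 : (ε * l / (6 * m * a * (√(a * b) * (a * b)))) ^ 2 =
        ε ^ 2 * l ^ 2 / (36 * m ^ 2 * a ^ 5 * b ^ 3) := by
      rw [div_pow, mul_pow, mul_pow, mul_pow, mul_pow, mul_pow, mul_pow, hs]
      ring
    rw [e1]
    calc 5 * Real.log X ≤ 5 * (a * b * Real.log X) := by nlinarith
      _ = 720 * (m ^ 2 * a ^ 6 * b ^ 4 / (l ^ 2 * ε ^ 2) * Real.log X) *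
          (ε ^ 2 * l ^ 2 / (36 * m ^ 2 * a ^ 5 * b ^ 3)) / 4 := by field_simp; ring
      _ ≤ _ := by gcongr
  have hX0 : 0 < X := by linarith
  have he : Real.exp (-(N * (ε * l / (6 * m * a * (√(a * b) * (a * b)))) ^ 2 / 4)) ≤ (X ^ 5)⁻¹ := by
    calc _ ≤ Real.exp (-(5 * Real.log X)) := Real.exp_le_exp.mpr (by linarith)
      _ = _ := by
        rw [Real.exp_neg, mul_comm, Real.exp_mul, Real.exp_log hX0]
        norm_cast
  -- The union bound becomes `8 (X κ)² / X⁵ = 8 κ² / X³`, and `X ≥ 2` absorbs the `8`.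
  have hmab : m * a * b = X * κ := by rw [hX]; field_simp
  have hX3 : 8 ≤ X ^ 3 := by
    calc (8 : ℝ) = 2 ^ 3 := by norm_num
      _ ≤ X ^ 3 := by gcongr
  calc _ ≤ 4 * m ^ 2 * a ^ 2 * b ^ 2 * (2 * (X ^ 5)⁻¹) := by gcongr
    _ = 8 * (m * a * b) ^ 2 * (X ^ 5)⁻¹ := by ring
    _ = 8 / X ^ 3 * (κ * κ) := by rw [hmab]; field_simp
    _ ≤ 1 * (κ * 1) := by
      gcongr
      exact div_le_one_of_le₀ hX3 (by positivity)
    _ = κ := by ring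

theorem queryScale_pos (hn : 0 < n) {ε κ : ℝ} (hε : 0 < ε) (hκ : 0 < κ) (hκ1 : κ < 1) :
    0 < queryScale P Q ε κ := by
  have hl := lambdaMin_pos P Q hn
  have hA : (1 : ℝ) ≤ maxDim dA := by exact_mod_cast one_le_maxDim hn dA
  have hB : (1 : ℝ) ≤ maxDim dB := by exact_mod_cast one_le_maxDim hn dB
  have hn' : (1 : ℝ) ≤ n := by exact_mod_cast hn
  have hX : 1 < (n : ℝ) * maxDim dA * maxDim dB / κ := by
    rw [lt_div_iff₀ hκ]
    have h1 : (1 : ℝ) ≤ n * maxDim dA := by nlinarith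
    nlinarith
  have := Real.log_pos hX
  rw [queryScale]
  positivity

theorem pow_dims_le (hn : 0 < n) {ε κ : ℝ} (hε : 0 < ε) (hκ : 0 < κ) (hκ1 : κ < 1) (hε2 : ε ≤ 2)
    {N : ℕ} (hN0 : 0 < N) (hN : 720 * queryScale P Q ε κ ≤ N) :
    (maxDim dA * maxDim dB) ^ 4 ≤ N := by
  have hA' := one_le_maxDim hn dA
  have hB' := one_le_maxDim hn dB
  -- In dimension one the logarithm may be arbitrarily small, but then `N ≥ 1` suffices. Otherwise
  -- it is at least `log 2 ≥ 1 / 2`.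
  by_cases h1 : maxDim dA * maxDim dB = 1
  · rw [h1]; exact hN0
  have hab' : 2 ≤ maxDim dA * maxDim dB := by
    have := Nat.mul_le_mul hA' hB'
    omega
  have hl := lambdaMin_pos P Q hn
  have hl1 := lambdaMin_le_one P Q hn
  have hA : (1 : ℝ) ≤ maxDim dA := by exact_mod_cast hA'
  have hB : (1 : ℝ) ≤ maxDim dB := by exact_mod_cast hB'
  have hab : (2 : ℝ) ≤ maxDim dA * maxDim dB := by exact_mod_cast hab'
  have hn' : (1 : ℝ) ≤ n := by exact_mod_cast hn
  rw [queryScale] at hN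
  have hgoal : ((maxDim dA : ℝ) * maxDim dB) ^ 4 ≤ N := by
    set a : ℝ := (maxDim dA : ℝ)
    set b : ℝ := (maxDim dB : ℝ)
    set m : ℝ := (n : ℝ)
    set l : ℝ := lambdaMin P Q
    have hX : 2 ≤ m * a * b / κ := by
      rw [le_div_iff₀ hκ, mul_assoc]
      nlinarith
    have hL : 1 / 2 ≤ Real.log (m * a * b / κ) :=
      (by linarith [Real.log_two_gt_d9] : (1 : ℝ) / 2 ≤ Real.log 2).trans
        (Real.log_le_log (by norm_num) hX)
    have hd : l ^ 2 * ε ^ 2 ≤ 4 := by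
      calc l ^ 2 * ε ^ 2 ≤ 1 ^ 2 * 2 ^ 2 := by gcongr
        _ = 4 := by norm_num
    have hnum : a ^ 4 * b ^ 4 ≤ m ^ 2 * a ^ 6 * b ^ 4 := by
      calc a ^ 4 * b ^ 4 = 1 ^ 2 * a ^ 4 * b ^ 4 := by ring
        _ ≤ m ^ 2 * a ^ 6 * b ^ 4 := by gcongr; norm_num
    have hfrac : a ^ 4 * b ^ 4 / 4 ≤ m ^ 2 * a ^ 6 * b ^ 4 / (l ^ 2 * ε ^ 2) :=
      div_le_div₀ (by positivity) hnum (by positivity) hd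
    calc (a * b) ^ 4 ≤ 720 * (a ^ 4 * b ^ 4 / 4 * (1 / 2)) := by
          have : 0 ≤ a ^ 4 * b ^ 4 := by positivity
          rw [mul_pow]; linarith
      _ ≤ 720 * (m ^ 2 * a ^ 6 * b ^ 4 / (l ^ 2 * ε ^ 2) * Real.log (m * a * b / κ)) := by gcongr
      _ ≤ N := hN
  exact_mod_cast hgoal

end Correctness

end CausalOrder

end

/-! ### Choice of constants and conclusion -/

open CausalOrder
theorem theorem3 :
    ∃ K : ℝ, 0 < K ∧ ∀ c : ℕ, ∃ K' : ℝ, 0 < K' ∧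
      ∀ (n : ℕ) (_ : 0 < n) (dA dB : Fin n → ℕ) [∀ i, NeZero (dA i)] [∀ j, NeZero (dB j)]
        (P : ∀ i, ICPOVM (dA i)) (Q : ∀ j, ICPOVM (dB j))
        (C : Channel (∀ i, Fin (dA i)) (∀ j, Fin (dB j))) (_ : IsMemoryless C)
        (ε κ : ℝ) (_ : 0 < ε) (_ : 0 < κ) (_ : κ < 1)
        (cost : CostModel) (_ : cost.BoundedBy c) (N : ℕ)
        (_ : N = ⌈K * queryScale P Q ε κ⌉₊),
        ENNReal.ofReal (1 - κ) ≤
            (discoverOrder cost C P Q N (ε / (2 * n * maxDim dA))).law.toOuterMeasure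
              {r | IsGoodOutput C ε r.1} ∧
          ∀ r ∈ (discoverOrder cost C P Q N (ε / (2 * n * maxDim dA))).law.support,
            r.2.queries = N ∧
              (ε ≤ 2 → (r.2.steps : ℝ) ≤
                K' * (N * n * (n + maxDim dA + (maxDim dB : ℝ) ^ 4))) := by
  -- `720` makes the failure exponent `5 log X`. `5 c + 30` dominates both the coefficient `4 c` of
  -- the rounds and the coefficient `30 + c` of the classical processing.
  refine ⟨720, by norm_num, fun c => ⟨5 * c + 30, by positivity, ?_⟩⟩
  intro n hn dA dB _ _ P Q C hC ε κ hε hκ hκ1 cost hcost N hN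
  obtain ⟨τ, Ch, hCh⟩ := hC
  have hscale := queryScale_pos P Q hn hε hκ hκ1
  have hN0 : 0 < N := by rw [hN]; exact Nat.ceil_pos.mpr (by positivity)
  have hNle : 720 * queryScale P Q ε κ ≤ N := by rw [hN]; exact Nat.le_ceil _
  refine ⟨?_, fun r hr => ?_⟩
  · have hlaw : (discoverOrder cost C P Q N (ε / (2 * n * maxDim dA))).law.toOuterMeasure
        {r | IsGoodOutput C ε r.1} = (iidList (roundLaw C P Q) N).toOuterMeasure
        {data | IsGoodOutput C ε
          (processData cost P Q (ε / (2 * n * maxDim dA)) data).val} := by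
      have h1 := PMF.toOuterMeasure_map_apply Prod.fst
        (discoverOrder cost C P Q N (ε / (2 * n * maxDim dA))).law {o | IsGoodOutput C ε o}
      rw [discoverOrder_map_fst, PMF.toOuterMeasure_map_apply] at h1
      exact h1.symm
    rw [hlaw]
    -- For `n = 1` there is only one permutation, so every data set leads to a good output and no
    -- concentration is needed.
    rcases Nat.lt_or_ge n 2 with h2 | h2
    · have huniv : {data | IsGoodOutput C ε
          (processData cost P Q (ε / (2 * n * maxDim dA)) data).val} = Set.univ := by
        refine Set.eq_univ_of_forall fun data => ?_
        refine isGoodOutput_of_estimates P Q τ hn hCh cost hε.le data (fun i j hij => ?_)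
          fun h => by omega
        have : Subsingleton (Fin n) := Fin.subsingleton_iff_le_one.mpr (by omega)
        exact absurd (Subsingleton.elim _ _) hij
      have hone := toOuterMeasure_add_compl (iidList (roundLaw C P Q) N) Set.univ
      rw [Set.compl_univ, MeasureTheory.measure_empty, add_zero] at hone
      rw [huniv, hone, ← ENNReal.ofReal_one]
      exact ENNReal.ofReal_le_ofReal (by linarith)
    · have hl := lambdaMin_pos P Q hn
      have hacc : 0 ≤ accuracy P Q ε := by rw [accuracy]; positivity
      have hbad := (not_representative_le C P Q hN0 hacc).trans
        (ENNReal.ofReal_le_ofReal (failure_bound P Q h2 hε hκ hκ1 hNle))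
      have hadd := toOuterMeasure_add_compl (iidList (roundLaw C P Q) N)
        {data | Representative C P Q (accuracy P Q ε) data}
      have hmono : (iidList (roundLaw C P Q) N).toOuterMeasure
          {data | Representative C P Q (accuracy P Q ε) data} ≤ _ :=
        (iidList (roundLaw C P Q) N).toOuterMeasure.mono
          fun data h => Representative.isGoodOutput P Q τ hn hCh cost hε h
      refine le_trans ?_ hmono
      rw [ENNReal.ofReal_sub _ hκ.le, ENNReal.ofReal_one, ← hadd]
      refine tsub_le_iff_right.mpr ?_
      gcongr
      exact hbad
  · obtain ⟨hq, data, hlen, hsteps⟩ := discoverOrder_resources cost C P Q hr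
    refine ⟨hq, fun hε2 => ?_⟩
    have h1 := roundSteps_le hcost dA dB
    have h2 := discover_time_le hcost P Q (ε / (2 * n * maxDim dA)) data
    rw [hlen] at h2
    have h3 := pow_dims_le P Q hn hε hκ hκ1 hε2 hN0 hNle
    have h4 : r.2.steps ≤ (5 * c + 30) * (N * n * (n + maxDim dA + maxDim dB ^ 4)) := by
      rw [hsteps]
      calc N * roundSteps cost dA dB + _
          ≤ N * (4 * c * n * (maxDim dA + maxDim dB ^ 4)) +
            -- Since `(d_A d_B) ^ 4 ≤ N` and `1 ≤ N`, each term of the processing time is linear in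
            -- `N`.
            n ^ 2 * (2 * N + (13 + c) * N + 15 * N) := by
            refine Nat.add_le_add (Nat.mul_le_mul_left _ h1) (h2.trans ?_)
            gcongr
            omega
        _ = 4 * c * (N * n * (maxDim dA + maxDim dB ^ 4)) + (30 + c) * (N * n * n) := by ring
        _ ≤ (5 * c + 30) * (N * n * (maxDim dA + maxDim dB ^ 4)) +
            (5 * c + 30) * (N * n * n) :=
            Nat.add_le_add (Nat.mul_le_mul_right _ (by omega)) (Nat.mul_le_mul_right _ (by omega))
        _ = _ := by ring
    exact_mod_cast h4
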